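/- \textbf{Formulas.} Consider quantifier-free formulas $\varphi(\bar x,\bar y)$ of Presburger arithmetic with input variables $\bar x=(x_1,\dots,x_n)$ and output variables $\bar y=(y_1,\dots,y_m)$ ($n,m\ge 0$) in negation normal form, i.e. binary trees with internal nodes $\land,\lor$ and with leaves that are linear inequalities $\sum_i a_ix_i+\sum_j c_jy_j+b\ge 0$ or modulo constraints $\sum_i a_ix_i+\sum_j c_jy_j\equiv r\pmod M$ or $\sum_i a_ix_i+\sum_j c_jy_j\not\equiv r\pmod M$, where all constants are integers and $0\le r<M$. The size $|\varphi|$ is the number of nodes, plus the number $n+m$ of variables, plus the number of bits of all constants in binary (including sign bits). A function $f\colon\mathbb Z^n\to\mathbb Z^m$ is a \emph{Skolem function} for $\bar y$ in $\forall\bar x\,\exists\bar y\colon\varphi$ if for every $\bar x\in\mathbb Z^n$ such that $\varphi(\bar x,\bar y)$ holds for some $\bar y\in\mathbb Z^m$, also $\varphi(\bar x,f(\bar x))$ holds. \textbf{Circuits.} A \emph{Presburger circuit} with $n$ inputs and $m$ outputs is an acyclic circuit over $\mathbb Z$ whose gates compute integer linear functions $(v_1,\dots,v_k)\mapsto a_1v_1+\dots+a_kv_k+b$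 with $a_1,\dots,a_k,b\in\mathbb Z$, or $\max(u,v)$, or $\mathsf E(u,v)$ (which is $v$ if $u=0$, and $0$ otherwise), or $\mathsf{div}_d(u)=\lfloor u/d\rfloor$ for an integer constant $d\ge 1$. Its size is the number of inputs, outputs, gates and wires, plus the number of bits of all constants of the gates in binary. \textbf{Theorem.} There are a constant $c\in\mathbb N$ and a multi-tape Turing machine such that for all $n,m\ge 0$ and every formula $\varphi(\bar x,\bar y)$ as above, the machine, given $\varphi$ (written as a string over a finite alphabet with constants in binary), outputs within $2^{|\varphi|^{c}}$ steps a Presburger circuit of size at most $2^{|\varphi|^{c}}$ that computes a Skolem function for $\bar y$ in $\forall\bar x\,\exists\bar y\colon\varphi$. In short: Presburger circuits for Skolem functions can be constructed in time $2^{|\varphi|^{O(1)}}$ and have size $2^{|\varphi|^{O(1)}}$. -/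

import Mathlib

namespace PFnS

/-! ### Quantifier-free Presburger formulas -/

/-- Quantifier-free formulas of Presburger arithmetic in negation normal form, over the input
variables `x₁, …, xₙ` and the output variables `y₁, …, yₘ`, as binary trees whose leaves are linear
inequalities and modulo constraints. -/
inductive Formula (n m : ℕ) : Type
  /-- `∑ aᵢ xᵢ + ∑ cⱼ yⱼ + b ≥ 0` -/
  | ineq (a : Fin n → ℤ) (c : Fin m → ℤ) (b : ℤ)
  /-- `∑ aᵢ xᵢ + ∑ cⱼ yⱼ ≡ r (mod M)`, with `0 ≤ r < M` -/
  | congr (a : Fin n → ℤ) (c : Fin m → ℤ) (r M : ℕ) (hr : r < M)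
  /-- `∑ aᵢ xᵢ + ∑ cⱼ yⱼ ≢ r (mod M)`, with `0 ≤ r < M` -/
  | ncongr (a : Fin n → ℤ) (c : Fin m → ℤ) (r M : ℕ) (hr : r < M)
  | and (φ ψ : Formula n m)
  | or (φ ψ : Formula n m)

/-- The linear form `∑ aᵢ xᵢ + ∑ cⱼ yⱼ`. -/
def linForm {n m : ℕ} (a : Fin n → ℤ) (c : Fin m → ℤ) (x : Fin n → ℤ) (y : Fin m → ℤ) : ℤ :=
  ∑ i, a i * x i + ∑ j, c j * y j

/-- Number of bits of an integer constant in binary: its magnitude and a sign bit. -/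
def bitLength (z : ℤ) : ℕ := Nat.size z.natAbs + 1

/-- Number of bits of all the coefficients of a linear form. -/
def coeffBits {n m : ℕ} (a : Fin n → ℤ) (c : Fin m → ℤ) : ℕ :=
  ∑ i, bitLength (a i) + ∑ j, bitLength (c j)

namespace Formula

variable {n m : ℕ}

/-- Truth of `φ(x̄, ȳ)` over the integers. -/
def Holds : Formula n m → (Fin n → ℤ) → (Fin m → ℤ) → Prop
  | ineq a c b, x, y => 0 ≤ linForm a c x y + b
  | congr a c r M _, x, y => ∃ k : ℤ, linForm a c x y = k * M + r
  | ncongr a c r M _, x, y => ¬ ∃ k : ℤ, linForm a c x y = k * M + r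
  | and φ ψ, x, y => φ.Holds x y ∧ ψ.Holds x y
  | or φ ψ, x, y => φ.Holds x y ∨ ψ.Holds x y

/-- Number of nodes of the tree. -/
def nodes : Formula n m → ℕ
  | ineq _ _ _ => 1
  | congr _ _ _ _ _ => 1
  | ncongr _ _ _ _ _ => 1
  | and φ ψ => φ.nodes + ψ.nodes + 1
  | or φ ψ => φ.nodes + ψ.nodes + 1

/-- Number of bits of all the constants in the leaves. -/
def constBits : Formula n m → ℕ
  | ineq a c b => coeffBits a c + bitLength b
  | congr a c r M _ => coeffBits a c + bitLength r + bitLength M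
  | ncongr a c r M _ => coeffBits a c + bitLength r + bitLength M
  | and φ ψ => φ.constBits + ψ.constBits
  | or φ ψ => φ.constBits + ψ.constBits

/-- The size `|φ|`: number of nodes, plus number of variables, plus number of bits of the
constants. -/
def size (φ : Formula n m) : ℕ := φ.nodes + (n + m) + φ.constBits

/-- `f` is a Skolem function for `ȳ` in `∀ x̄ ∃ ȳ, φ(x̄, ȳ)`. -/
def IsSkolem (φ : Formula n m) (f : (Fin n → ℤ) → (Fin m → ℤ)) : Prop :=
  ∀ x, (∃ y, φ.Holds x y) → φ.Holds x (f x)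

end Formula

/-! ### Presburger circuits -/

/-- Gates. A natural number argument called `i` or `j` (and the second component of a term of a
linear gate) names the wire from which an input is read. -/
inductive Gate : Type
  /-- integer linear function: `(v₁, …, vₖ) ↦ a₁ v₁ + … + aₖ vₖ + b`, with terms `(aₗ, wire of vₗ)` -/
  | linear (terms : List (ℤ × ℕ)) (b : ℤ)
  /-- `(u, v) ↦ max u v` -/
  | maximum (i j : ℕ)
  /-- the zero-conditional `E`: `E(u, v) = v` if `u = 0`, and `E(u, v) = 0` otherwise -/
  | zeroCond (i j : ℕ)
  /-- `div_d`: `u ↦ ⌊u / d⌋` -/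
  | floorDiv (d : ℕ) (i : ℕ)

namespace Gate

/-- The gate reads only wires below `k`, and a division is by a positive number. -/
def WellFormed (k : ℕ) : Gate → Prop
  | linear terms _ => ∀ t ∈ terms, t.2 < k
  | maximum i j => i < k ∧ j < k
  | zeroCond i j => i < k ∧ j < k
  | floorDiv d i => 0 < d ∧ i < k

/-- Value of the gate, given the values `w` of the wires. -/
def eval (w : ℕ → ℤ) : Gate → ℤ
  | linear terms b => (terms.map fun t => t.1 * w t.2).sum + b
  | maximum i j => max (w i) (w j)
  | zeroCond i j => if w i = 0 then w j else 0
  | floorDiv d i => Int.fdiv (w i) d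

/-- Size of a gate: one for the gate itself, one for each of its input wires, and the number of bits
of its integer constants. -/
def size : Gate → ℕ
  | linear terms b => 1 + (terms.map fun t => 1 + bitLength t.1).sum + bitLength b
  | maximum _ _ => 3
  | zeroCond _ _ => 3
  | floorDiv d _ => 2 + bitLength d

end Gate

/-- Presburger circuits with `n` inputs and `m` outputs. Wires `0, …, n - 1` carry the inputs, wire
`n + k` carries the value of gate number `k`. Each gate reads earlier wires only (so that the circuit
is acyclic, with arbitrary fan-out), and output `j` is read off from wire `outputs j`. -/
structure Circuit (n m : ℕ) where
  gates : List Gate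
  outputs : Fin m → ℕ
  gates_wf : ∀ (k : ℕ) (hk : k < gates.length), (gates[k]).WellFormed (n + k)
  outputs_lt : ∀ j, outputs j < n + gates.length

/-- Evaluates the gates in order; each value is appended to the list of wire values. -/
def evalGates : List Gate → List ℤ → List ℤ
  | [], v => v
  | g :: gs, v => evalGates gs (v ++ [g.eval fun i => v.getD i 0])

namespace Circuit

variable {n m : ℕ}

/-- The function `ℤⁿ → ℤᵐ` that the circuit computes. -/
def eval (C : Circuit n m) (x : Fin n → ℤ) : Fin m → ℤ :=
  fun j => (evalGates C.gates (List.ofFn x)).getD (C.outputs j) 0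

/-- The size of a circuit: inputs, outputs, gates, wires, and bits of all integer constants. -/
def size (C : Circuit n m) : ℕ := n + m + (C.gates.map Gate.size).sum

end Circuit

/-! ### Formulas and circuits as strings over a finite alphabet -/

/-- The tape alphabet for formulas and circuits. -/
inductive Sym : Type
  | bit (b : Bool)
  | sign (negative : Bool)
  | mark
  | ineq | congr | ncongr | and | or
  | linear | term | maximum | zeroCond | floorDiv | output
  deriving DecidableEq, Fintype

/-- A natural number in binary, least significant bit first, followed by a terminator. -/
def encodeNat (k : ℕ) : List Sym := k.bits.map Sym.bit ++ [Sym.mark]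

/-- An integer: sign, then absolute value in binary. -/
def encodeInt (z : ℤ) : List Sym := Sym.sign (decide (z < 0)) :: encodeNat z.natAbs

/-- The coefficients of a linear form, in the order of the variables. -/
def encodeCoeffs {n m : ℕ} (a : Fin n → ℤ) (c : Fin m → ℤ) : List Sym :=
  (List.ofFn a).flatMap encodeInt ++ (List.ofFn c).flatMap encodeInt

/-- The tree in prefix notation. -/
def Formula.encodeTree {n m : ℕ} : Formula n m → List Sym
  | .ineq a c b => Sym.ineq :: (encodeCoeffs a c ++ encodeInt b)
  | .congr a c r M _ => Sym.congr :: (encodeCoeffs a c ++ encodeNat r ++ encodeNat M)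
  | .ncongr a c r M _ => Sym.ncongr :: (encodeCoeffs a c ++ encodeNat r ++ encodeNat M)
  | .and φ ψ => Sym.and :: (φ.encodeTree ++ ψ.encodeTree)
  | .or φ ψ => Sym.or :: (φ.encodeTree ++ ψ.encodeTree)

/-- The string of a formula: the numbers of input and output variables, then the tree. -/
def Formula.encode {n m : ℕ} (φ : Formula n m) : List Sym :=
  encodeNat n ++ encodeNat m ++ φ.encodeTree

/-- The string of a gate. -/
def Gate.encode : Gate → List Sym
  | .linear terms b =>
      Sym.linear :: (encodeInt b ++
        (terms.flatMap fun t => Sym.term :: (encodeInt t.1 ++ encodeNat t.2)) ++ [Sym.mark])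
  | .maximum i j => Sym.maximum :: (encodeNat i ++ encodeNat j)
  | .zeroCond i j => Sym.zeroCond :: (encodeNat i ++ encodeNat j)
  | .floorDiv d i => Sym.floorDiv :: (encodeNat d ++ encodeNat i)

/-- The string of a circuit: the numbers of inputs and outputs, the gates in order, and the wires
from which the outputs are read. -/
def Circuit.encode {n m : ℕ} (C : Circuit n m) : List Sym :=
  encodeNat n ++ encodeNat m ++ C.gates.flatMap Gate.encode ++
    (List.ofFn C.outputs).flatMap fun i => Sym.output :: encodeNat i

/-- The multi-tape Turing machine `T`, started on the string `u`, halts after at most `t` steps with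
the string `v` as its output. -/
def RunsInTime (T : Turing.TM2ComputableAux Sym Sym) (u v : List Sym) (t : ℕ) : Prop :=
  Nonempty (Turing.TM2OutputsInTime T.tm (u.map T.inputAlphabet.symm)
    (some (v.map T.outputAlphabet.symm)) t)

end PFnS

/-!
The construction is by exhaustive search, carried out inside the circuit.

*Small solutions.* Let `x` be such that `φ(x, y)` holds for some `y`. Among the inequalities of `φ` that
are true at `(x, y)`, together with the true ones among `yⱼ ≥ 0` and `-yⱼ ≥ 0`, there are `m` whose
coefficient vectors for `y` are linearly independent. As long as `y` is moved by multiples of the product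
`M` of all moduli and violates none of these inequalities, it remains a solution, because `φ` is in
negation normal form (`Formula.Holds.move`). If fewer than `m` independent inequalities have been made
nearly tight, Siegel's lemma gives a small integer vector in the kernel of their coefficient matrix, and
moving along it until another inequality is about to be violated makes one more of them nearly tight
(`exists_nearly_tight`). When `m` of them are nearly tight, Cramer's rule writes `yⱼ` as
`⌊(∑ αᵢ xᵢ + β) / d⌋` with integers `αᵢ`, `β`, `d` of polynomially many bits
(`isRounded_of_nearly_tight`, `Formula.exists_isRounded`). These numbers do depend on `x`, but they are at
most `H = 2 ^ L ^ 4` in absolute value (`2 H + 1` for `d`), where `L` is the length of the string of `φ`.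

*The circuit.* There are `N = (2 H + 1) ^ (m (n + 2))` choices for all the coefficients and denominators:
these are the candidates, and the digits of `K < N` in base `2 H + 1` encode candidate `K` (`Par.cand`,
`exists_cand_eq`). The circuit computes all candidates, and for each of them a nonnegative number, the
defect, that is zero if and only if the candidate satisfies `φ` (`Formula.defect`). The output is the last
candidate of defect zero, selected by gates `v + E(defect, y - v)` (`Cmd.select`, `pick`).

*The machine.* The circuit is written by a loop program `Cmd.generator`, in a small language with number
registers and symbol stacks. The gates are arranged in rows of `N`, the `K`-th gate of a row belonging to
candidate `K`, so that the addresses of wires are arithmetic expressions. The program reads the string of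
`φ` once, writes the rows of the leaves, and then evaluates the connectives with the help of stacks of
row addresses, coded as numbers. The program is compiled to structured programs on stacks
(`Cmd.comp_spec`), where numbers are kept in unary, and these to multi-tape Turing machines
(`Prog.exists_machine`). There is no need to count steps: for a fixed program, the running time is bounded
by a polynomial in any bound `P` on the numbers that occur (`Prog.exists_cost_le`), and
`P = 2 ^ L ^ 11` suffices (`parameter_bounds`). The size of the circuit is bounded by the length of its
string (`Circuit.size_le`), and hence by the running time.
-/

namespace PFnS

/-! ### Structured stack programs -/

/-- Structured programs over finitely many stacks of symbols, indexed by `ρ`. A stack also serves as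
a register for a natural number in unary, namely its height. -/
inductive Prog (ρ : Type) : Type
  | skip
  | push (r : ρ) (a : Sym)
  /-- pop a symbol (if there is one) and continue according to it -/
  | pop (r : ρ) (f : Option Sym → Prog ρ)
  | seq (p q : Prog ρ)
  /-- run `p` as many times as stack `r` was high when the loop was entered -/
  | loop (r : ρ) (p : Prog ρ)

namespace Prog

variable {ρ : Type}

/-- The labels of the machine of `Prog.code`. -/
inductive Lab : Prog ρ → Type
  | skip : Lab .skip
  | push {r a} : Lab (.push r a)
  | popHead {r f} : Lab (.pop r f)
  | popBody {r f} (o : Option Sym) (l : Lab (f o)) : Lab (.pop r f)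
  | seqLeft {p q} (l : Lab p) : Lab (.seq p q)
  | seqRight {p q} (l : Lab q) : Lab (.seq p q)
  | loopHead {r p} (i : Fin 4) : Lab (.loop r p)
  | loopBody {r p} (l : Lab p) : Lab (.loop r p)

instance finite_lab (p : Prog ρ) : Finite (Lab p) := by
  induction p with
  | skip => exact Finite.of_surjective (fun _ : Unit => Lab.skip) fun l => by cases l; exact ⟨(), rfl⟩
  | push => exact Finite.of_surjective (fun _ : Unit => Lab.push) fun l => by cases l; exact ⟨(), rfl⟩
  | pop r f ih =>
    have := ih
    refine Finite.of_surjective (α := Option (Σ o, Lab (f o)))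
      (fun l => l.elim Lab.popHead fun l => Lab.popBody l.1 l.2) fun l => ?_
    cases l with
    | popHead => exact ⟨none, rfl⟩
    | popBody o l => exact ⟨some ⟨o, l⟩, rfl⟩
  | seq p q ihp ihq =>
    refine Finite.of_surjective (Sum.elim (α := Lab p) (β := Lab q) Lab.seqLeft Lab.seqRight)
      fun l => ?_
    cases l with
    | seqLeft l => exact ⟨Sum.inl l, rfl⟩
    | seqRight l => exact ⟨Sum.inr l, rfl⟩
  | loop r p ih =>
    refine Finite.of_surjective (Sum.elim (β := Lab p) Lab.loopHead Lab.loopBody) fun l => ?_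
    cases l with
    | loopHead i => exact ⟨Sum.inl i, rfl⟩
    | loopBody l => exact ⟨Sum.inr l, rfl⟩

/-- The label at which a program starts. -/
def entry : (p : Prog ρ) → Lab p
  | skip => .skip
  | push _ _ => .push
  | pop _ _ => .popHead
  | seq p _ => .seqLeft (entry p)
  | loop _ _ => .loopHead 0

/-- Machine code for a program, its labels embedded by `em` into the labels of a larger machine; after
the program control passes to `ex`. The machine has two more stacks than the program: `inr true` holds
the counters of the running loops, in unary above a `Sym.mark`, and `inr false` is used to restore the
stack that controls a loop. -/
def code {Λ : Type} : {p : Prog ρ} → Lab p → (Lab p → Λ) → Λ →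
    Turing.TM2.Stmt (fun _ : ρ ⊕ Bool => Sym) Λ (Option Sym)
  | _, .skip, _, ex => .goto fun _ => ex
  | _, .push (r := r) (a := a), _, ex => .push (Sum.inl r) (fun _ => a) (.goto fun _ => ex)
  | _, .popHead (r := r) (f := f), em, _ =>
    .pop (Sum.inl r) (fun _ o => o) (.goto fun v => em (.popBody v (entry (f v))))
  | _, .popBody o l, em, ex => code l (fun l => em (.popBody o l)) ex
  | _, .seqLeft (q := q) l, em, _ => code l (fun l => em (.seqLeft l)) (em (.seqRight (entry q)))
  | _, .seqRight l, em, ex => code l (fun l => em (.seqRight l)) ex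
  | _, .loopHead (r := r) (p := p) i, em, ex =>
    match i with
    | 0 => .push (Sum.inr true) (fun _ => Sym.mark) (.goto fun _ => em (.loopHead 1))
    | 1 => .pop (Sum.inl r) (fun _ o => o) (.branch Option.isSome
        (.push (Sum.inr false) (fun v => v.getD Sym.mark)
          (.push (Sum.inr true) (fun _ => Sym.term) (.goto fun _ => em (.loopHead 1))))
        (.goto fun _ => em (.loopHead 2)))
    | 2 => .pop (Sum.inr false) (fun _ o => o) (.branch Option.isSome
        (.push (Sum.inl r) (fun v => v.getD Sym.mark) (.goto fun _ => em (.loopHead 2)))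
        (.goto fun _ => em (.loopHead 3)))
    | 3 => .pop (Sum.inr true) (fun _ o => o) (.goto fun v =>
        if v = some Sym.term then em (.loopBody (entry p)) else ex)
  | _, .loopBody l, em, _ => code l (fun l => em (.loopBody l)) (em (.loopHead 3))

/-- The stacks of the machine: those of the program, the loop counters, the restoring stack. -/
def stk (S : ρ → List Sym) (c t : List Sym) : ρ ⊕ Bool → List Sym :=
  Sum.elim S fun b => cond b c t

@[simp] theorem stk_inl (S : ρ → List Sym) (c t : List Sym) (r : ρ) :
    stk S c t (Sum.inl r) = S r := rfl
@[simp] theorem stk_true (S : ρ → List Sym) (c t : List Sym) : stk S c t (Sum.inr true) = c := rfl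
@[simp] theorem stk_false (S : ρ → List Sym) (c t : List Sym) : stk S c t (Sum.inr false) = t := rfl

variable [DecidableEq ρ]

/-- The effect of a program on the stacks. -/
def exec : Prog ρ → (ρ → List Sym) → (ρ → List Sym)
  | skip, S => S
  | push r a, S => Function.update S r (a :: S r)
  | pop r f, S => exec (f (S r).head?) (Function.update S r (S r).tail)
  | seq p q, S => exec q (exec p S)
  | loop r p, S => (exec p)^[(S r).length] S

/-- The number of steps that the machine of `Prog.code` takes. -/
def cost : Prog ρ → (ρ → List Sym) → ℕ
  | skip, _ => 1
  | push _ _, _ => 1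
  | pop r f, S => 1 + cost (f (S r).head?) (Function.update S r (S r).tail)
  | seq p q, S => cost p S + cost q (exec p S)
  | loop r p, S => 2 * (S r).length + 4 +
      ∑ i ∈ Finset.range (S r).length, (1 + cost p ((exec p)^[i] S))

/-- The machine `M` gets from the configuration `a` to `b` in exactly `k` steps. -/
def Steps {Λ : Type} (M : Λ → Turing.TM2.Stmt (fun _ : ρ ⊕ Bool => Sym) Λ (Option Sym)) (k : ℕ)
    (a b : Turing.TM2.Cfg (fun _ : ρ ⊕ Bool => Sym) Λ (Option Sym)) : Prop :=
  (flip bind (Turing.TM2.step M))^[k] (some a) = some b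

theorem Steps.trans {Λ : Type} {M : Λ → Turing.TM2.Stmt (fun _ : ρ ⊕ Bool => Sym) Λ (Option Sym)}
    {j k : ℕ} {a b c} (h₁ : Steps M j a b) (h₂ : Steps M k b c) : Steps M (j + k) a c := by
  unfold Steps at *
  rw [add_comm, Function.iterate_add_apply, h₁, h₂]

theorem Steps.one {Λ : Type} {M : Λ → Turing.TM2.Stmt (fun _ : ρ ⊕ Bool => Sym) Λ (Option Sym)}
    {l v S c} (h : Turing.TM2.stepAux (M l) v S = c) : Steps M 1 ⟨some l, v, S⟩ c := by
  simp [Steps, flip, Turing.TM2.step, h]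

@[simp] theorem update_stk_inl (S : ρ → List Sym) (c t : List Sym) (r : ρ) (w : List Sym) :
    Function.update (stk S c t) (Sum.inl r) w = stk (Function.update S r w) c t := by
  funext k
  rcases k with k | k
  · by_cases h : k = r
    · subst h; simp
    · simp [h]
  · cases k <;> simp

@[simp] theorem update_stk_true (S : ρ → List Sym) (c t w : List Sym) :
    Function.update (stk S c t) (Sum.inr true) w = stk S w t := by
  funext k
  rcases k with k | (_ | _) <;> simp

@[simp] theorem update_stk_false (S : ρ → List Sym) (c t w : List Sym) :
    Function.update (stk S c t) (Sum.inr false) w = stk S c w := by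
  funext k
  rcases k with k | (_ | _) <;> simp

section LoopHead

variable {r : ρ} {p : Prog ρ} {Λ : Type} {em : Lab (loop r p) → Λ} {ex : Λ}
  {M : Λ → Turing.TM2.Stmt (fun _ : ρ ⊕ Bool => Sym) Λ (Option Sym)}

/-- First phase of a loop: stack `r` is moved to the restoring stack while its height is counted. -/
theorem steps_loop_count (hM : ∀ l, M (em l) = code l em ex) :
    ∀ (w : List Sym) (S : ρ → List Sym) (v : Option Sym) (c t : List Sym), S r = w →
      Steps M (w.length + 1) ⟨some (em (.loopHead 1)), v, stk S c t⟩
        ⟨some (em (.loopHead 2)), none,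
          stk (Function.update S r []) (List.replicate w.length Sym.term ++ c) (w.reverse ++ t)⟩
  | [], S, v, c, t, h => by
    refine Steps.one ?_
    simp [hM, code, h, Turing.TM2.stepAux]
  | a :: w, S, v, c, t, h => by
    have h₁ : Steps M 1 ⟨some (em (.loopHead 1)), v, stk S c t⟩
        ⟨some (em (.loopHead 1)), some a,
          stk (Function.update S r w) (Sym.term :: c) (a :: t)⟩ := by
      refine Steps.one ?_
      simp [hM, code, h, Turing.TM2.stepAux]
    have h₂ := steps_loop_count hM w (Function.update S r w) (some a) (Sym.term :: c) (a :: t)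
      (by simp)
    have h₃ := h₁.trans h₂
    rw [add_comm] at h₃
    convert h₃ using 2
    · simp
    · simp [List.replicate_succ']

/-- Second phase of a loop: stack `r` is restored. -/
theorem steps_loop_restore (hM : ∀ l, M (em l) = code l em ex) :
    ∀ (w : List Sym) (S : ρ → List Sym) (v : Option Sym) (c : List Sym),
      Steps M (w.length + 1) ⟨some (em (.loopHead 2)), v, stk S c w⟩
        ⟨some (em (.loopHead 3)), none, stk (Function.update S r (w.reverse ++ S r)) c []⟩
  | [], S, v, c => by
    refine Steps.one ?_
    simp [hM, code, Turing.TM2.stepAux]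
  | a :: w, S, v, c => by
    have h₁ : Steps M 1 ⟨some (em (.loopHead 2)), v, stk S c (a :: w)⟩
        ⟨some (em (.loopHead 2)), some a, stk (Function.update S r (a :: S r)) c w⟩ := by
      refine Steps.one ?_
      simp [hM, code, Turing.TM2.stepAux]
    have h₂ := steps_loop_restore hM w (Function.update S r (a :: S r)) (some a) c
    have h₃ := h₁.trans h₂
    rw [add_comm] at h₃
    convert h₃ using 2
    · simp
    · simp

end LoopHead

/-- The machine code of a program has the effect `exec` within `cost` steps. -/
theorem steps_code (p : Prog ρ) : ∀ {Λ : Type} (em : Lab p → Λ) (ex : Λ)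
    (M : Λ → Turing.TM2.Stmt (fun _ : ρ ⊕ Bool => Sym) Λ (Option Sym)),
    (∀ l, M (em l) = code l em ex) → ∀ (S : ρ → List Sym) (v : Option Sym) (c : List Sym),
    ∃ v', Steps M (cost p S) ⟨some (em (entry p)), v, stk S c []⟩
      ⟨some ex, v', stk (exec p S) c []⟩ := by
  induction p with
  | skip =>
    intro Λ em ex M hM S v c
    exact ⟨v, Steps.one (by simp [hM, code, entry, exec, Turing.TM2.stepAux])⟩
  | push r a =>
    intro Λ em ex M hM S v c
    exact ⟨v, Steps.one (by simp [hM, code, entry, exec, Turing.TM2.stepAux])⟩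
  | pop r f ih =>
    intro Λ em ex M hM S v c
    obtain ⟨v', h⟩ := ih (S r).head? (fun l => em (.popBody _ l)) ex M
      (fun l => by rw [hM, code]) (Function.update S r (S r).tail) (S r).head? c
    refine ⟨v', Steps.trans (Steps.one ?_) h⟩
    simp [hM, code, entry, Turing.TM2.stepAux]
  | seq p q ihp ihq =>
    intro Λ em ex M hM S v c
    obtain ⟨v₁, h₁⟩ := ihp (fun l => em (.seqLeft l)) (em (.seqRight (entry q))) M
      (fun l => by rw [hM, code]) S v c
    obtain ⟨v₂, h₂⟩ := ihq (fun l => em (.seqRight l)) ex M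
      (fun l => by rw [hM, code]) (exec p S) v₁ c
    exact ⟨v₂, h₁.trans h₂⟩
  | loop r p ih =>
    intro Λ em ex M hM S v c
    have h₀ : Steps M 1 ⟨some (em (.loopHead 0)), v, stk S c []⟩
        ⟨some (em (.loopHead 1)), v, stk S (Sym.mark :: c) []⟩ :=
      Steps.one (by simp [hM, code, Turing.TM2.stepAux])
    have h₁ := steps_loop_count hM (S r) S v (Sym.mark :: c) [] rfl
    have h₂ := steps_loop_restore hM ((S r).reverse ++ []) (Function.update S r []) none
      (List.replicate (S r).length Sym.term ++ Sym.mark :: c)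
    have h₃ : ∀ (k : ℕ) (T : ρ → List Sym) (v : Option Sym), ∃ v', Steps M
        (∑ i ∈ Finset.range k, (1 + cost p ((exec p)^[i] T)) + 1)
        ⟨some (em (.loopHead 3)), v, stk T (List.replicate k Sym.term ++ Sym.mark :: c) []⟩
        ⟨some ex, v', stk ((exec p)^[k] T) c []⟩ := by
      intro k
      induction k with
      | zero =>
        intro T v
        exact ⟨some Sym.mark, Steps.one (by simp [hM, code, Turing.TM2.stepAux])⟩
      | succ k ihk =>
        intro T v
        have h₄ : Steps M 1 ⟨some (em (.loopHead 3)), v,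
            stk T (List.replicate (k + 1) Sym.term ++ Sym.mark :: c) []⟩
            ⟨some (em (.loopBody (entry p))), some Sym.term,
              stk T (List.replicate k Sym.term ++ Sym.mark :: c) []⟩ :=
          Steps.one (by simp [hM, code, Turing.TM2.stepAux, List.replicate_succ])
        obtain ⟨v₅, h₅⟩ := ih (fun l => em (.loopBody l)) (em (.loopHead 3)) M
          (fun l => by rw [hM, code]) T (some Sym.term)
          (List.replicate k Sym.term ++ Sym.mark :: c)
        obtain ⟨v₆, h₆⟩ := ihk (exec p T) v₅
        refine ⟨v₆, ?_⟩
        have := (h₄.trans h₅).trans h₆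
        rw [Finset.sum_range_succ']
        simp only [Function.iterate_succ_apply, Function.iterate_zero, id] at this ⊢
        convert this using 1
        ring
    obtain ⟨v', h₃⟩ := h₃ (S r).length S none
    refine ⟨v', ?_⟩
    have e : Function.update (Function.update S r []) r
        (((S r).reverse ++ []).reverse ++ Function.update S r [] r) = S := by simp
    rw [e] at h₂
    have h := ((h₀.trans h₁).trans h₂).trans h₃
    have hc : cost (loop r p) S = 1 + ((S r).length + 1) + (((S r).reverse ++ []).length + 1) +
        (∑ i ∈ Finset.range (S r).length, (1 + cost p ((exec p)^[i] S)) + 1) := by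
      simp only [cost, List.append_nil, List.length_reverse]
      ring
    rw [hc]
    exact h

/-- Heights of stacks grow by at most one per step. -/
theorem length_exec_le (p : Prog ρ) : ∀ (S : ρ → List Sym) (r : ρ),
    (exec p S r).length ≤ (S r).length + cost p S := by
  have upd : ∀ (S : ρ → List Sym) (r r' : ρ) (w : List Sym), w.length ≤ (S r').length + 1 →
      (Function.update S r' w r).length ≤ (S r).length + 1 := by
    intro S r r' w h
    by_cases e : r = r'
    · subst e; simpa using h
    · simp [e]
  induction p with
  | skip => intro S r; simp [exec]
  | push r' a =>
    intro S r
    exact upd S r r' _ (by simp)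
  | pop r' f ih =>
    intro S r
    have h₁ := ih (S r').head? (Function.update S r' (S r').tail) r
    have h₂ := upd S r r' (S r').tail (by simp; omega)
    simp only [exec, cost]
    omega
  | seq p q ihp ihq =>
    intro S r
    have h₁ := ihp S r
    have h₂ := ihq (exec p S) r
    simp only [exec, cost]
    omega
  | loop r' p ih =>
    intro S r
    have : ∀ k, ((exec p)^[k] S r).length ≤ (S r).length +
        ∑ i ∈ Finset.range k, (1 + cost p ((exec p)^[i] S)) := by
      intro k
      induction k with
      | zero => simp
      | succ k ihk =>
        have := ih ((exec p)^[k] S) r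
        rw [Function.iterate_succ_apply', Finset.sum_range_succ]
        omega
    have := this (S r').length
    simp only [exec, cost]
    omega

/-- Every loop of the program runs at most `P` times whenever it is entered. -/
def Bdd (P : ℕ) : Prog ρ → (ρ → List Sym) → Prop
  | skip, _ => True
  | push _ _, _ => True
  | pop r f, S => Bdd P (f (S r).head?) (Function.update S r (S r).tail)
  | seq p q, S => Bdd P p S ∧ Bdd P q (exec p S)
  | loop r p, S => (S r).length ≤ P ∧ ∀ i < (S r).length, Bdd P p ((exec p)^[i] S)

/-- If all loops run at most `P` times, the running time is polynomial in `P`. -/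
theorem exists_cost_le (p : Prog ρ) : ∃ C : ℕ, ∀ P S, Bdd P p S → cost p S ≤ C * (P + 1) ^ C := by
  have mono : ∀ {C D P : ℕ}, C ≤ D → C * (P + 1) ^ C ≤ D * (P + 1) ^ D := fun h =>
    Nat.mul_le_mul h (Nat.pow_le_pow_right (by omega) h)
  have one : ∀ {C P : ℕ}, 1 ≤ (P + 1) ^ C := Nat.one_le_pow _ _ (by omega)
  induction p with
  | skip => exact ⟨1, fun P S _ => by simp [cost]⟩
  | push => exact ⟨1, fun P S _ => by simp [cost]⟩
  | pop r f ih =>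
    choose C hC using ih
    refine ⟨∑ o, C o + 1, fun P S h => ?_⟩
    have h₁ := hC _ P _ h
    have h₂ : C (S r).head? ≤ ∑ o, C o :=
      Finset.single_le_sum (f := C) (fun _ _ => Nat.zero_le _) (Finset.mem_univ _)
    have h₃ := mono (P := P) h₂
    have h₄ : (P + 1) ^ (∑ o, C o) ≤ (P + 1) ^ (∑ o, C o + 1) :=
      Nat.pow_le_pow_right (by omega) (by omega)
    have h₅ := one (C := ∑ o, C o + 1) (P := P)
    simp only [cost]
    nlinarith [Nat.zero_le (∑ o, C o)]
  | seq p q ihp ihq =>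
    obtain ⟨C, hC⟩ := ihp
    obtain ⟨D, hD⟩ := ihq
    refine ⟨C + D, fun P S h => ?_⟩
    have h₁ := hC P _ h.1
    have h₂ := hD P _ h.2
    have h₃ : (P + 1) ^ C ≤ (P + 1) ^ (C + D) := Nat.pow_le_pow_right (by omega) (by omega)
    have h₄ : (P + 1) ^ D ≤ (P + 1) ^ (C + D) := Nat.pow_le_pow_right (by omega) (by omega)
    simp only [cost]
    calc _ ≤ C * (P + 1) ^ (C + D) + D * (P + 1) ^ (C + D) := by gcongr <;> nlinarith
      _ = _ := by ring
  | loop r p ih =>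
    obtain ⟨C, hC⟩ := ih
    refine ⟨C + 5, fun P S h => ?_⟩
    have h₁ : ∑ i ∈ Finset.range (S r).length, (1 + cost p ((exec p)^[i] S)) ≤
        (S r).length * (1 + C * (P + 1) ^ C) := by
      refine (Finset.sum_le_card_nsmul _ _ (1 + C * (P + 1) ^ C) fun i hi => ?_).trans (by simp)
      have := hC P _ (h.2 i (Finset.mem_range.mp hi))
      omega
    have h₂ : (S r).length * (1 + C * (P + 1) ^ C) ≤ P * (1 + C * (P + 1) ^ C) :=
      Nat.mul_le_mul_right _ h.1
    have h₃ := h.1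
    have h₅ : P + 1 ≤ (P + 1) ^ (C + 5) := Nat.le_self_pow (by omega) _
    have h₄ : (P + 1) ^ C * (P + 1) ≤ (P + 1) ^ (C + 5) := by
      rw [← pow_succ]; exact Nat.pow_le_pow_right (by omega) (by omega)
    simp only [cost]
    calc _ ≤ 5 * (P + 1) + C * ((P + 1) ^ C * (P + 1)) := by nlinarith [Nat.zero_le (C * (P+1)^C)]
      _ ≤ 5 * (P + 1) ^ (C + 5) + C * (P + 1) ^ (C + 5) := by gcongr
      _ = _ := by ring

end Prog

namespace Prog

variable {ρ : Type}

/-! ### The Turing machine of a program -/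

/-- Empties the given stacks. -/
def clear : List ρ → Prog ρ
  | [] => skip
  | r :: l => seq (loop r (pop r fun _ => skip)) (clear l)

/-- Moves the stack `r` onto the stack `r'`, reversing it. -/
def move (r r' : ρ) : Prog ρ := loop r (pop r fun o => o.elim skip (push r'))

variable [DecidableEq ρ]

theorem iterate_exec_pop (r : ρ) : ∀ (k : ℕ) (S : ρ → List Sym),
    (exec (pop r fun _ => skip))^[k] S = Function.update S r ((S r).drop k)
  | 0, S => by simp
  | k + 1, S => by
    rw [Function.iterate_succ_apply, iterate_exec_pop r k]
    simp [exec]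

theorem exec_clear : ∀ (l : List ρ) (S : ρ → List Sym),
    exec (clear l) S = fun r => if r ∈ l then [] else S r
  | [], S => by simp [clear, exec]
  | r :: l, S => by
    rw [clear, exec, exec_clear l, exec, iterate_exec_pop]
    funext r'
    by_cases h : r' = r
    · subst h; simp
    · simp [h]

theorem bdd_clear {P : ℕ} : ∀ (l : List ρ) (S : ρ → List Sym), (∀ r, (S r).length ≤ P) →
    Bdd P (clear l) S
  | [], S, _ => trivial
  | r :: l, S, h => by
    refine ⟨⟨h r, fun _ _ => trivial⟩, bdd_clear l _ fun r' => ?_⟩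
    rw [exec, iterate_exec_pop]
    by_cases e : r' = r
    · subst e; simp
    · simpa [e] using h r'

theorem iterate_exec_move {r r' : ρ} (hr : r ≠ r') : ∀ (w : List Sym) (S : ρ → List Sym), S r = w →
    (exec (pop r fun o => o.elim skip (push r')))^[w.length] S =
      Function.update (Function.update S r []) r' (w.reverse ++ S r')
  | [], S, h => by
    have e : Function.update S r [] = S := by rw [← h, Function.update_eq_self]
    simp [e]
  | a :: w, S, h => by
    have h₁ : exec (pop r fun o => o.elim skip (push r')) S =
        Function.update (Function.update S r w) r' (a :: S r') := by
      simp [exec, h, hr.symm]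
    rw [List.length_cons, Function.iterate_succ_apply, h₁, iterate_exec_move hr w _ (by simp [hr])]
    funext k
    by_cases e : k = r'
    · subst e; simp
    · by_cases e' : k = r
      · subst e'; simp [e]
      · simp [e, e']

theorem bdd_move {P : ℕ} {r r' : ρ} {S : ρ → List Sym} (h : (S r).length ≤ P) :
    Bdd P (move r r') S := by
  refine ⟨h, fun i _ => ?_⟩
  generalize (exec (pop r fun o => o.elim skip (push r')))^[i] S = T
  simp only [Bdd]
  cases (T r).head? <;> trivial

/-- The multi-tape Turing machine of a program, with input stack `i` and output stack `o`. -/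
noncomputable def machine [Fintype ρ] (p : Prog ρ) (i o : ρ) :
    Turing.TM2ComputableAux Sym Sym where
  tm :=
    { K := ρ ⊕ Bool
      k₀ := Sum.inl i
      k₁ := Sum.inl o
      Γ := fun _ => Sym
      Λ := Option (Lab p)
      main := some (entry p)
      ΛFin := Fintype.ofFinite _
      σ := Option Sym
      initialState := none
      m := fun l => match l with
        | none => .load (fun _ => none) .halt
        | some l => code l some none }
  inputAlphabet := Equiv.refl _
  outputAlphabet := Equiv.refl _

/-- If a program started with only the input leaves only the output on the stacks, then its machine
computes this output; the additional step is the final halt. -/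
theorem runsInTime_machine [Fintype ρ] {p : Prog ρ} {i o : ρ} {u w : List Sym}
    (h : exec p (Function.update (fun _ => []) i u) = Function.update (fun _ => []) o w) :
    RunsInTime (machine p i o) u w (cost p (Function.update (fun _ => []) i u) + 1) := by
  have single : ∀ (r : ρ) (w : List Sym) (k : ρ ⊕ Bool),
      stk (Function.update (fun _ => []) r w) [] [] k = if k = Sum.inl r then w else [] := by
    rintro r w (k | (_ | _))
    · by_cases e : k = r
      · subst e; simp
      · simp [e]
    · simp
    · simp
  obtain ⟨v, hv⟩ := steps_code p some none (machine p i o).tm.m (fun l => rfl)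
    (Function.update (fun _ => []) i u) none []
  have hv' := hv.trans (Steps.one (M := (machine p i o).tm.m)
    (c := ⟨none, none, stk (Function.update (fun _ => []) o w) [] []⟩) (by rw [h]; rfl))
  refine ⟨⟨⟨_, ?_⟩, le_rfl⟩⟩
  have e₁ : Turing.initList (machine p i o).tm (u.map (machine p i o).inputAlphabet.symm) =
      ⟨some (some (entry p)), none, stk (Function.update (fun _ => []) i u) [] []⟩ := by
    have : u.map (machine p i o).inputAlphabet.symm = u := List.map_id _
    rw [this]
    unfold Turing.initList
    congr 1
    funext k
    refine Eq.trans ?_ (single i u k).symm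
    by_cases e : k = (Sum.inl i : ρ ⊕ Bool)
    · exact (dif_pos e).trans (Eq.trans (b := u) (by subst e; rfl) (if_pos e).symm)
    · exact (dif_neg e).trans (if_neg e).symm
  have e₂ : Turing.haltList (machine p i o).tm (w.map (machine p i o).outputAlphabet.symm) =
      ⟨none, none, stk (Function.update (fun _ => []) o w) [] []⟩ := by
    have : w.map (machine p i o).outputAlphabet.symm = w := List.map_id _
    rw [this]
    unfold Turing.haltList
    congr 1
    funext k
    refine Eq.trans ?_ (single o w k).symm
    by_cases e : k = (Sum.inl o : ρ ⊕ Bool)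
    · exact (dif_pos e).trans (Eq.trans (b := w) (by subst e; rfl) (if_pos e).symm)
    · exact (dif_neg e).trans (if_neg e).symm
  rw [Option.map_some, e₁, e₂]
  exact hv'

/-- A program that leaves its output, last symbol on top, on the stack `out` and keeps the stack `fin`
empty can be turned into a Turing machine, whose running time is polynomial in the length of the input
and the number of rounds of any loop. -/
theorem exists_machine [Fintype ρ] (p : Prog ρ) {inp out fin : ρ} (hf : out ≠ fin) :
    ∃ (T : Turing.TM2ComputableAux Sym Sym) (C : ℕ), ∀ (u w : List Sym) (P : ℕ), u.length ≤ P →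
      Bdd P p (Function.update (fun _ => []) inp u) →
      exec p (Function.update (fun _ => []) inp u) out = w.reverse →
      exec p (Function.update (fun _ => []) inp u) fin = [] →
      RunsInTime T u w (C * (P + 1) ^ C) ∧ w.length ≤ C * (P + 1) ^ C := by
  -- `q` reverses the output onto `fin` and empties all other stacks, as the machine model demands
  let q : Prog ρ := seq (move out fin) (clear (Finset.univ.erase fin).toList)
  obtain ⟨C, hC⟩ := exists_cost_le p
  obtain ⟨D, hD⟩ := exists_cost_le q
  refine ⟨machine (seq p q) inp fin, D * (C + 2) ^ D + C + (C + 1) * D + (C + 2),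
    fun u w P hu hb ho hfin => ?_⟩
  set S₀ : ρ → List Sym := Function.update (fun _ => []) inp u with hS₀
  have hc := hC P S₀ hb
  have hone : 1 ≤ (P + 1) ^ C := Nat.one_le_pow _ _ (by omega)
  have hlen : ∀ r, (exec p S₀ r).length ≤ P + cost p S₀ := fun r => by
    have h₁ := length_exec_le p S₀ r
    have h₂ : (S₀ r).length ≤ P := by
      by_cases e : r = inp
      · subst e; simpa [hS₀] using hu
      · simp [hS₀, e]
    omega
  have hmove : exec (move out fin) (exec p S₀) =
      Function.update (Function.update (exec p S₀) out []) fin w := by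
    have := iterate_exec_move hf _ (exec p S₀) rfl
    rw [move, exec, this, ho, hfin]
    simp
  have hexec : exec (seq p q) S₀ = Function.update (fun _ => []) fin w := by
    rw [exec, exec, hmove, exec_clear]
    funext r
    by_cases e : r = fin
    · subst e; simp
    · simp [e]
  have hbq : Bdd (P + cost p S₀) q (exec p S₀) := by
    refine ⟨bdd_move (hlen _), bdd_clear _ _ fun r => ?_⟩
    rw [hmove]
    by_cases e : r = fin
    · subst e
      have := hlen out
      rw [ho] at this
      simpa using this
    · by_cases e' : r = out
      · subst e'; simp [e]
      · simpa [e, e'] using hlen r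
  have hcq := hD _ _ hbq
  have h₁ : P + cost p S₀ + 1 ≤ (C + 2) * (P + 1) ^ (C + 1) := by
    have a₁ : P + 1 ≤ (P + 1) ^ (C + 1) := Nat.le_self_pow (by omega) _
    have a₂ : (P + 1) ^ C ≤ (P + 1) ^ (C + 1) := Nat.pow_le_pow_right (by omega) (by omega)
    nlinarith
  -- the four summands of `E` serve as coefficient and as exponent in the estimates below
  set E := D * (C + 2) ^ D + C + (C + 1) * D + (C + 2) with hE
  have h₂ : D * (P + cost p S₀ + 1) ^ D ≤ D * (C + 2) ^ D * (P + 1) ^ E := by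
    calc _ ≤ D * ((C + 2) * (P + 1) ^ (C + 1)) ^ D := by gcongr
      _ = D * (C + 2) ^ D * (P + 1) ^ ((C + 1) * D) := by rw [mul_pow, ← pow_mul]; ring
      _ ≤ _ := Nat.mul_le_mul_left _ (Nat.pow_le_pow_right (by omega) (by omega))
  have h₃ : C * (P + 1) ^ C ≤ C * (P + 1) ^ E :=
    Nat.mul_le_mul_left _ (Nat.pow_le_pow_right (by omega) (by omega))
  have h₄ : 1 ≤ (P + 1) ^ E := Nat.one_le_pow _ _ (by omega)
  have htime : cost (seq p q) S₀ + 1 ≤ E * (P + 1) ^ E := by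
    have e : cost (seq p q) S₀ = cost p S₀ + cost q (exec p S₀) := rfl
    have h₅ : E * (P + 1) ^ E = D * (C + 2) ^ D * (P + 1) ^ E + C * (P + 1) ^ E +
        (C + 1) * D * (P + 1) ^ E + (C + 2) * (P + 1) ^ E := by rw [hE]; ring
    rw [e, h₅]
    nlinarith [Nat.zero_le ((C + 1) * D * (P + 1) ^ E), Nat.zero_le (C * (P + 1) ^ E)]
  refine ⟨?_, ?_⟩
  · obtain ⟨h⟩ := runsInTime_machine hexec
    exact ⟨⟨h.toEvalsTo, h.steps_le_m.trans htime⟩⟩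
  · have h₅ := hlen out
    rw [ho, List.length_reverse] at h₅
    have h₆ : (C + 2) * (P + 1) ^ (C + 1) ≤ E * (P + 1) ^ E :=
      Nat.mul_le_mul (by omega) (Nat.pow_le_pow_right (by omega) (by omega))
    omega

end Prog

/-! ### A register language -/

/-- The number registers of the circuit generator. -/
inductive Var : Type
  | n | m | H | Q | N | W | D | K | i | y | B | T | S | a | c | p | q | pw | dn | k | n₁
  deriving DecidableEq

instance : Fintype Var where
  elems := {.n, .m, .H, .Q, .N, .W, .D, .K, .i, .y, .B, .T, .S, .a, .c, .p, .q, .pw, .dn, .k, .n₁}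
  complete v := by cases v <;> decide

/-- The symbol stacks of the circuit generator. -/
inductive Stack : Type
  | inp | skel | out
  deriving DecidableEq

instance : Fintype Stack where
  elems := {.inp, .skel, .out}
  complete k := by cases k <;> decide

/-- The memory of the circuit generator. The number registers are: the numbers `n` and `m` of variables,
`n₁ = n + 1`, the bound `H` on coefficients, `Q = 2 H + 1`, the number `N` of candidates, the number `W`
of the next wire, a power `D` of `Q`, the number `K` of a candidate, a counter `i`, a wire `y`, the
base `B` of the stacks of wires coded in the numbers `T` and `S`, wires `a` and `c`, an integer
`p - q`, and the scratch registers `pw`, `dn`, `k`. -/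
structure St : Type where
  n : ℕ
  m : ℕ
  H : ℕ
  Q : ℕ
  N : ℕ
  W : ℕ
  D : ℕ
  K : ℕ
  i : ℕ
  y : ℕ
  B : ℕ
  T : ℕ
  S : ℕ
  a : ℕ
  c : ℕ
  p : ℕ
  q : ℕ
  pw : ℕ
  dn : ℕ
  k : ℕ
  n₁ : ℕ
  inp : List Sym
  skel : List Sym
  out : List Sym

namespace St

/-- The content of a number register. -/
def get (s : St) : Var → ℕ
  | .n => s.n | .m => s.m | .H => s.H | .Q => s.Q | .N => s.N | .W => s.W | .D => s.D | .K => s.K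
  | .i => s.i | .y => s.y | .B => s.B | .T => s.T | .S => s.S | .a => s.a | .c => s.c | .p => s.p
  | .q => s.q | .pw => s.pw | .dn => s.dn | .k => s.k | .n₁ => s.n₁

/-- Overwrites a number register. -/
def set (s : St) (v : Var) (x : ℕ) : St :=
  match v with
  | .n => {s with n := x} | .m => {s with m := x} | .H => {s with H := x} | .Q => {s with Q := x}
  | .N => {s with N := x} | .W => {s with W := x} | .D => {s with D := x} | .K => {s with K := x}
  | .i => {s with i := x} | .y => {s with y := x} | .B => {s with B := x} | .T => {s with T := x}
  | .S => {s with S := x} | .a => {s with a := x} | .c => {s with c := x} | .p => {s with p := x}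
  | .q => {s with q := x} | .pw => {s with pw := x} | .dn => {s with dn := x} | .k => {s with k := x}
  | .n₁ => {s with n₁ := x}

/-- The content of a symbol stack. -/
def getS (s : St) : Stack → List Sym
  | .inp => s.inp | .skel => s.skel | .out => s.out

/-- Overwrites a symbol stack. -/
def setS (s : St) (k : Stack) (w : List Sym) : St :=
  match k with
  | .inp => {s with inp := w} | .skel => {s with skel := w} | .out => {s with out := w}

theorem get_set (s : St) (v w : Var) (x : ℕ) :
    (s.set v x).get w = Function.update s.get v x w := by
  by_cases h : w = v
  · subst h
    cases w <;> simp [get, set]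
  · cases v <;> cases w <;> rfl

@[simp] theorem getS_set (s : St) (v : Var) (x : ℕ) : (s.set v x).getS = s.getS := by
  funext k; cases v <;> cases k <;> rfl

@[simp] theorem get_setS (s : St) (k : Stack) (w : List Sym) : (s.setS k w).get = s.get := by
  funext v; cases k <;> cases v <;> rfl

theorem getS_setS (s : St) (k k' : Stack) (w : List Sym) :
    (s.setS k w).getS k' = Function.update s.getS k w k' := by
  cases k <;> cases k' <;> rfl

end St

/-- Arithmetic expressions in the number registers, with truncated subtraction and division. -/
inductive Expr : Type
  | lit (k : ℕ)
  | var (v : Var)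
  | add (e f : Expr)
  | sub (e f : Expr)
  | mul (e f : Expr)
  | div (e f : Expr)

namespace Expr

instance : Coe Var Expr := ⟨Expr.var⟩
instance (k : ℕ) : OfNat Expr k := ⟨Expr.lit k⟩
instance : Add Expr := ⟨Expr.add⟩
instance : Sub Expr := ⟨Expr.sub⟩
instance : Mul Expr := ⟨Expr.mul⟩
instance : Div Expr := ⟨Expr.div⟩

/-- The remainder of a division. -/
instance : Mod Expr := ⟨fun e f => e - f * (e / f)⟩

/-- The value of an expression. -/
def eval (s : St) : Expr → ℕ
  | lit k => k
  | var v => s.get v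
  | add e f => e.eval s + f.eval s
  | sub e f => e.eval s - f.eval s
  | mul e f => e.eval s * f.eval s
  | div e f => e.eval s / f.eval s

/-- All numbers that occur in the evaluation are at most `P`, provided the registers are, and no
division is by zero. Nothing is required of a difference, since it is truncated. -/
def Bdd (P : ℕ) (s : St) : Expr → Prop
  | lit k => k ≤ P
  | var _ => True
  | add e f => e.Bdd P s ∧ f.Bdd P s ∧ e.eval s + f.eval s ≤ P
  | sub e f => e.Bdd P s ∧ f.Bdd P s
  | mul e f => e.Bdd P s ∧ f.Bdd P s ∧ e.eval s * f.eval s ≤ P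
  | div e f => e.Bdd P s ∧ f.Bdd P s ∧ 0 < f.eval s

/-- The number of temporary registers needed for the evaluation. -/
def depth : Expr → ℕ
  | lit _ => 1
  | var _ => 1
  | add e f => max e.depth (f.depth + 1)
  | sub e f => max e.depth (f.depth + 1)
  | mul e f => max (max (e.depth + 1) (f.depth + 2)) 1
  | div e f => max (max (e.depth + 1) (f.depth + 2)) 4

section
variable (s : St) (e f : Expr) (P : ℕ)

@[simp] theorem eval_zero : (0 : Expr).eval s = 0 := rfl
@[simp] theorem eval_one : (1 : Expr).eval s = 1 := rfl
@[simp] theorem eval_two : (2 : Expr).eval s = 2 := rfl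
@[simp] theorem eval_three : (3 : Expr).eval s = 3 := rfl
@[simp] theorem eval_var (v : Var) : (Expr.var v).eval s = s.get v := rfl
@[simp] theorem eval_add : (e + f).eval s = e.eval s + f.eval s := rfl
@[simp] theorem eval_sub : (e - f).eval s = e.eval s - f.eval s := rfl
@[simp] theorem eval_mul : (e * f).eval s = e.eval s * f.eval s := rfl
@[simp] theorem eval_div : (e / f).eval s = e.eval s / f.eval s := rfl
@[simp] theorem eval_mod : (e % f).eval s = e.eval s % f.eval s :=
  Nat.mod_eq_sub_mul_div.symm

@[simp] theorem bdd_zero : (0 : Expr).Bdd P s ↔ 0 ≤ P := Iff.rfl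
@[simp] theorem bdd_one : (1 : Expr).Bdd P s ↔ 1 ≤ P := Iff.rfl
@[simp] theorem bdd_two : (2 : Expr).Bdd P s ↔ 2 ≤ P := Iff.rfl
@[simp] theorem bdd_three : (3 : Expr).Bdd P s ↔ 3 ≤ P := Iff.rfl
@[simp] theorem bdd_var (v : Var) : (Expr.var v).Bdd P s ↔ True := Iff.rfl
@[simp] theorem bdd_add :
    (e + f).Bdd P s ↔ e.Bdd P s ∧ f.Bdd P s ∧ e.eval s + f.eval s ≤ P := Iff.rfl
@[simp] theorem bdd_sub : (e - f).Bdd P s ↔ e.Bdd P s ∧ f.Bdd P s := Iff.rfl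
@[simp] theorem bdd_mul :
    (e * f).Bdd P s ↔ e.Bdd P s ∧ f.Bdd P s ∧ e.eval s * f.eval s ≤ P := Iff.rfl
@[simp] theorem bdd_div : (e / f).Bdd P s ↔ e.Bdd P s ∧ f.Bdd P s ∧ 0 < f.eval s := Iff.rfl

theorem depth_pos : 0 < e.depth := by
  cases e <;> simp [depth]

theorem eval_le (h : ∀ v, s.get v ≤ P) : e.Bdd P s → e.eval s ≤ P := by
  induction e with
  | lit k => exact fun h => h
  | var v => exact fun _ => h v
  | add e f _ _ => exact fun h => h.2.2
  | sub e f ihe _ => exact fun h => (Nat.sub_le _ _).trans (ihe h.1)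
  | mul e f _ _ => exact fun h => h.2.2
  | div e f ihe _ => exact fun h => (Nat.div_le_self _ _).trans (ihe h.1)

@[simp] theorem bdd_mod (h : ∀ v, s.get v ≤ P) :
    (e % f).Bdd P s ↔ e.Bdd P s ∧ f.Bdd P s ∧ 0 < f.eval s := by
  change (e - f * (e / f)).Bdd P s ↔ _
  simp only [bdd_sub, bdd_mul, bdd_div]
  constructor
  · tauto
  · rintro ⟨he, hf, h0⟩
    exact ⟨he, hf, ⟨he, hf, h0⟩, (Nat.mul_div_le _ _).trans (eval_le s e P h he)⟩

end
end Expr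

/-- Programs of the register language. -/
inductive Cmd : Type
  | skip
  | seq (c d : Cmd)
  | assign (v : Var) (e : Expr)
  /-- `c` if the register is zero, `d` otherwise -/
  | ifz (v : Var) (c d : Cmd)
  | push (k : Stack) (a : Sym)
  | pop (k : Stack) (f : Option Sym → Cmd)
  /-- run `c` as many times as the content of `v` at the beginning -/
  | loop (v : Var) (c : Cmd)
  /-- run `c` as many times as the height of the stack `k` at the beginning -/
  | loopS (k : Stack) (c : Cmd)

namespace Cmd

/-- The effect of a program on the memory. -/
def run : Cmd → St → St
  | skip, s => s
  | seq c d, s => run d (run c s)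
  | assign v e, s => s.set v (e.eval s)
  | ifz v c d, s => if s.get v = 0 then run c s else run d s
  | push k a, s => s.setS k (a :: s.getS k)
  | pop k f, s => run (f (s.getS k).head?) (s.setS k (s.getS k).tail)
  | loop v c, s => (run c)^[s.get v] s
  | loopS k c, s => (run c)^[(s.getS k).length] s

/-- No number larger than `P` occurs in the computation, provided the registers contain no larger
numbers at the beginning, and the expressions can be evaluated with 16 temporary registers. -/
def Ok (P : ℕ) : Cmd → St → Prop
  | skip, _ => True
  | seq c d, s => Ok P c s ∧ Ok P d (run c s)
  | assign _ e, s => e.depth ≤ 16 ∧ e.Bdd P s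
  | ifz v c d, s => if s.get v = 0 then Ok P c s else Ok P d s
  | push _ _, _ => True
  | pop k f, s => Ok P (f (s.getS k).head?) (s.setS k (s.getS k).tail)
  | loop v c, s => ∀ i < s.get v, Ok P c ((run c)^[i] s)
  | loopS k c, s => (s.getS k).length ≤ P ∧ ∀ i < (s.getS k).length, Ok P c ((run c)^[i] s)

end Cmd

/-! ### Compilation of the register language -/

/-- The stacks used by compiled programs. -/
inductive Reg : Type
  | num (v : Var)
  | tmp (i : Fin 16)
  | stack (k : Stack)
  | fin
  deriving DecidableEq, Fintype

/-- The temporary registers, numbered by natural numbers below 16. -/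
def Reg.temp (d : ℕ) : Reg := .tmp (Fin.ofNat 16 d)

theorem Reg.temp_ne {d e : ℕ} (hd : d < 16) (he : e < 16) (h : d ≠ e) : Reg.temp d ≠ Reg.temp e := by
  simp only [Reg.temp, ne_eq, Reg.tmp.injEq, Fin.ext_iff, Fin.val_ofNat]
  omega

/-- The stacks that represent a memory; numbers are represented in unary. -/
def St.repr (s : St) : Reg → List Sym
  | .num v => List.replicate (s.get v) Sym.mark
  | .tmp _ => []
  | .stack k => s.getS k
  | .fin => []

theorem St.repr_set (s : St) (v : Var) (x : ℕ) :
    (s.set v x).repr = Function.update s.repr (.num v) (List.replicate x Sym.mark) := by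
  funext r
  cases r with
  | num w =>
    by_cases h : w = v
    · subst h; simp [repr, get_set]
    · simp [repr, get_set, h]
  | tmp => simp [repr]
  | stack k => simp [repr]
  | fin => simp [repr]

theorem St.repr_setS (s : St) (k : Stack) (w : List Sym) :
    (s.setS k w).repr = Function.update s.repr (.stack k) w := by
  funext r
  cases r with
  | num w => simp [repr]
  | tmp => simp [repr]
  | stack k' =>
    by_cases h : k' = k
    · subst h; simp [repr, getS_setS]
    · simp [repr, getS_setS, h]
  | fin => simp [repr]

namespace Prog

/-- Empties a stack. -/
def erase (r : Reg) : Prog Reg := loop r (pop r fun _ => skip)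

/-- Adds the height of `r` to the number `r'`. -/
def addTo (r r' : Reg) : Prog Reg := loop r (push r' Sym.mark)

/-- Subtracts the height of `r` from the number `r'`. -/
def subFrom (r r' : Reg) : Prog Reg := loop r (pop r' fun _ => skip)

theorem iterate_exec_push {ρ : Type} [DecidableEq ρ] (r : ρ) (a : Sym) : ∀ (k : ℕ) (S : ρ → List Sym),
    (exec (push r a))^[k] S = Function.update S r (List.replicate k a ++ S r)
  | 0, S => by simp
  | k + 1, S => by
    rw [Function.iterate_succ_apply, iterate_exec_push r a k]
    simp [exec, List.replicate_succ']

theorem exec_erase (r : Reg) (S : Reg → List Sym) : exec (erase r) S = Function.update S r [] := by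
  rw [erase, exec, iterate_exec_pop, List.drop_length]

theorem exec_addTo (r r' : Reg) (S : Reg → List Sym) : exec (addTo r r') S =
    Function.update S r' (List.replicate (S r).length Sym.mark ++ S r') := by
  rw [addTo, exec, iterate_exec_push]

theorem exec_subFrom (r r' : Reg) (S : Reg → List Sym) : exec (subFrom r r') S =
    Function.update S r' ((S r').drop (S r).length) := by
  rw [subFrom, exec, iterate_exec_pop]

theorem bdd_erase {P : ℕ} (r : Reg) (S : Reg → List Sym) : Bdd P (erase r) S ↔ (S r).length ≤ P :=
  ⟨fun h => h.1, fun h => ⟨h, fun _ _ => trivial⟩⟩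

theorem bdd_addTo {P : ℕ} (r r' : Reg) (S : Reg → List Sym) :
    Bdd P (addTo r r') S ↔ (S r).length ≤ P :=
  ⟨fun h => h.1, fun h => ⟨h, fun _ _ => trivial⟩⟩

theorem bdd_subFrom {P : ℕ} (r r' : Reg) (S : Reg → List Sym) :
    Bdd P (subFrom r r') S ↔ (S r).length ≤ P :=
  ⟨fun h => h.1, fun h => ⟨h, fun _ _ => trivial⟩⟩

end Prog

namespace Expr
open Prog Reg

/-- The loop body for division: counts `temp (d + 3)` down from the divisor `temp (d + 2)`, and
increments the quotient `temp d` whenever it has reached zero. -/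
def divStep (d : ℕ) : Prog Reg :=
  seq (pop (temp (d + 3)) fun _ => skip)
    (pop (temp (d + 3)) fun o => match o with
      | some a => push (temp (d + 3)) a
      | none => seq (push (temp d) Sym.mark) (addTo (temp (d + 2)) (temp (d + 3))))

/-- A program that puts the value of the expression into `temp d`, using higher temporary registers
only. -/
def comp : Expr → ℕ → Prog Reg
  | lit k, d => Nat.rec skip (fun _ p => seq p (push (temp d) Sym.mark)) k
  | var v, d => addTo (.num v) (temp d)
  | add e f, d => seq (comp e d) (seq (comp f (d + 1))
      (seq (addTo (temp (d + 1)) (temp d)) (erase (temp (d + 1)))))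
  | sub e f, d => seq (comp e d) (seq (comp f (d + 1))
      (seq (subFrom (temp (d + 1)) (temp d)) (erase (temp (d + 1)))))
  | mul e f, d => seq (comp e (d + 1)) (seq (comp f (d + 2))
      (seq (loop (temp (d + 1)) (addTo (temp (d + 2)) (temp d)))
        (seq (erase (temp (d + 1))) (erase (temp (d + 2))))))
  | div e f, d => seq (comp e (d + 1)) (seq (comp f (d + 2))
      (seq (addTo (temp (d + 2)) (temp (d + 3))) (seq (loop (temp (d + 1)) (divStep d))
        (seq (erase (temp (d + 1))) (seq (erase (temp (d + 2))) (erase (temp (d + 3))))))))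

theorem iterate_addTo {r r' : Reg} (h : r ≠ r') (x k : ℕ) (S : Reg → List Sym)
    (hS : (S r).length = x) : (exec (addTo r r'))^[k] S =
      Function.update S r' (List.replicate (k * x) Sym.mark ++ S r') := by
  induction k with
  | zero => simp
  | succ k ih =>
    rw [Function.iterate_succ_apply', ih, exec_addTo]
    simp [h, hS, ← List.append_assoc, List.replicate_append_replicate, Nat.succ_mul, Nat.add_comm]

/-- After `k` rounds, the quotient is `k / b` and the countdown stands at `b - k % b`. -/
theorem iterate_divStep {d b : ℕ} (hd : d + 3 < 16) (hb : 0 < b) (S : Reg → List Sym)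
    (h₀ : S (temp d) = []) (h₂ : S (temp (d + 2)) = List.replicate b Sym.mark)
    (h₃ : S (temp (d + 3)) = List.replicate b Sym.mark) (k : ℕ) :
    (exec (divStep d))^[k] S = Function.update
      (Function.update S (temp d) (List.replicate (k / b) Sym.mark))
      (temp (d + 3)) (List.replicate (b - k % b) Sym.mark) := by
  have n₁ : temp d ≠ temp (d + 3) := temp_ne (by omega) (by omega) (by omega)
  have n₂ : temp (d + 2) ≠ temp (d + 3) := temp_ne (by omega) (by omega) (by omega)
  have n₃ : temp d ≠ temp (d + 2) := temp_ne (by omega) (by omega) (by omega)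
  induction k with
  | zero =>
    simp only [Function.iterate_zero, id, Nat.zero_div, Nat.zero_mod, Nat.sub_zero,
      List.replicate_zero]
    rw [← h₀, ← h₃]
    simp
  | succ k ih =>
    rw [Function.iterate_succ_apply', ih]
    have hk := Nat.mod_lt k hb
    obtain ⟨x, hx⟩ : ∃ x, b - k % b = x + 1 := ⟨b - k % b - 1, by omega⟩
    rw [hx]
    by_cases hx0 : x = 0
    · subst hx0
      have e₁ : (k + 1) % b = 0 := by
        rw [Nat.add_mod]
        by_cases hb1 : b = 1
        · subst hb1; simp [Nat.mod_one]
        · rw [Nat.mod_eq_of_lt (a := 1) (by omega), show k % b + 1 = b by omega, Nat.mod_self]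
      have e₂ : (k + 1) / b = k / b + 1 := by
        rw [Nat.succ_div, if_pos (Nat.dvd_of_mod_eq_zero e₁)]
      rw [e₁, e₂]
      funext r
      by_cases r₁ : r = temp (d + 3)
      · subst r₁
        simp [divStep, exec, exec_addTo, n₁.symm, n₂, n₃.symm, h₂]
      · by_cases r₂ : r = temp d
        · subst r₂
          simp [divStep, exec, exec_addTo, n₁, List.replicate_succ]
        · simp [divStep, exec, exec_addTo, r₁, r₂]
    · obtain ⟨z, rfl⟩ : ∃ z, x = z + 1 := ⟨x - 1, by omega⟩
      have e₁ : (k + 1) % b = k % b + 1 := by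
        rw [Nat.add_mod, Nat.mod_eq_of_lt (a := 1) (by omega), Nat.mod_eq_of_lt (by omega)]
      have e₂ : (k + 1) / b = k / b := by
        rw [Nat.succ_div, if_neg]
        · rfl
        · intro h
          have := Nat.mod_eq_zero_of_dvd h
          omega
      rw [e₁, e₂, show b - (k % b + 1) = z + 1 by omega]
      simp [divStep, exec, List.replicate_succ]

/-- The compiled expression computes the value in `temp d`, and its loops are bounded by the numbers
that occur in the evaluation. -/
theorem comp_spec {P : ℕ} {s : St} (hs : ∀ v, s.get v ≤ P) (e : Expr) : ∀ (d : ℕ) (S : Reg → List Sym),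
    d + e.depth ≤ 16 → (∀ v, S (.num v) = List.replicate (s.get v) Sym.mark) →
    (∀ j, d ≤ j → j < 16 → S (temp j) = []) → e.Bdd P s →
    Prog.Bdd P (e.comp d) S ∧
      exec (e.comp d) S = Function.update S (temp d) (List.replicate (e.eval s) Sym.mark) := by
  induction e with
  | lit k =>
    intro d S hd hv ht hb
    simp only [depth] at hd
    have h0 := ht d le_rfl (by omega)
    simp only [comp, eval]
    clear hb
    induction k with
    | zero => exact ⟨trivial, by simp [exec, ← h0]⟩
    | succ k ih => exact ⟨⟨ih.1, trivial⟩, by simp [exec, ih.2, List.replicate_succ]⟩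
  | var v =>
    intro d S hd hv ht hb
    simp only [depth] at hd
    have h0 := ht d le_rfl (by omega)
    exact ⟨by simpa [comp, bdd_addTo, hv] using hs v, by simp [comp, exec_addTo, hv, eval, h0]⟩
  | add e f ihe ihf =>
    intro d S hd hv ht hb
    simp only [depth] at hd
    have := f.depth_pos
    have hn : temp d ≠ temp (d + 1) := temp_ne (by omega) (by omega) (by omega)
    obtain ⟨b₁, h₁⟩ := ihe d S (by omega) hv ht hb.1
    obtain ⟨b₂, h₂⟩ := ihf (d + 1) (exec (e.comp d) S) (by omega)
      (fun v => by rw [h₁, ← hv]; simp [temp])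
      (fun j hj hj' => by
        rw [h₁, Function.update_of_ne (temp_ne hj' (by omega) (by omega)), ht j (by omega) hj'])
      hb.2.1
    rw [h₁] at h₂
    have hf := eval_le s f P hs hb.2.1
    refine ⟨⟨b₁, b₂, ?_, ?_⟩, ?_⟩
    · simpa [bdd_addTo, h₁, h₂] using hf
    · simpa [bdd_erase, exec_addTo, h₁, h₂, hn.symm] using hf
    · simp only [comp, exec, exec_addTo, exec_erase, h₁, h₂, eval]
      funext r
      by_cases r₁ : r = temp (d + 1)
      · subst r₁; simp [hn.symm, ht (d + 1) (by omega) (by omega)]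
      · by_cases r₂ : r = temp d
        · subst r₂; simp [hn, List.replicate_append_replicate, Nat.add_comm]
        · simp [r₁, r₂]
  | sub e f ihe ihf =>
    intro d S hd hv ht hb
    simp only [depth] at hd
    have := f.depth_pos
    have hn : temp d ≠ temp (d + 1) := temp_ne (by omega) (by omega) (by omega)
    obtain ⟨b₁, h₁⟩ := ihe d S (by omega) hv ht hb.1
    obtain ⟨b₂, h₂⟩ := ihf (d + 1) (exec (e.comp d) S) (by omega)
      (fun v => by rw [h₁, ← hv]; simp [temp])
      (fun j hj hj' => by
        rw [h₁, Function.update_of_ne (temp_ne hj' (by omega) (by omega)), ht j (by omega) hj'])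
      hb.2
    rw [h₁] at h₂
    have hf := eval_le s f P hs hb.2
    refine ⟨⟨b₁, b₂, ?_, ?_⟩, ?_⟩
    · simpa [bdd_subFrom, h₁, h₂] using hf
    · simpa [bdd_erase, exec_subFrom, h₁, h₂, hn.symm] using hf
    · simp only [comp, exec, exec_subFrom, exec_erase, h₁, h₂, eval]
      funext r
      by_cases r₁ : r = temp (d + 1)
      · subst r₁; simp [hn.symm, ht (d + 1) (by omega) (by omega)]
      · by_cases r₂ : r = temp d
        · subst r₂; simp [hn]
        · simp [r₁, r₂]
  | mul e f ihe ihf =>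
    intro d S hd hv ht hb
    simp only [depth] at hd
    have := f.depth_pos
    have hn : temp d ≠ temp (d + 1) := temp_ne (by omega) (by omega) (by omega)
    have hn' : temp d ≠ temp (d + 2) := temp_ne (by omega) (by omega) (by omega)
    have hn'' : temp (d + 1) ≠ temp (d + 2) := temp_ne (by omega) (by omega) (by omega)
    obtain ⟨b₁, h₁⟩ := ihe (d + 1) S (by omega) hv (fun j hj => ht j (by omega)) hb.1
    obtain ⟨b₂, h₂⟩ := ihf (d + 2) (exec (e.comp (d + 1)) S) (by omega)
      (fun v => by rw [h₁, ← hv]; simp [temp])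
      (fun j hj hj' => by
        rw [h₁, Function.update_of_ne (temp_ne hj' (by omega) (by omega)), ht j (by omega) hj'])
      hb.2.1
    have hf := eval_le s f P hs hb.2.1
    have he := eval_le s e P hs hb.1
    rw [h₁] at h₂
    set X := Function.update (Function.update S (temp (d + 1)) (List.replicate (e.eval s) Sym.mark))
      (temp (d + 2)) (List.replicate (f.eval s) Sym.mark) with hX
    have h₃ := fun k => iterate_addTo hn'.symm (f.eval s) k X (by simp [hX])
    have hXe : X (temp (d + 1)) = List.replicate (e.eval s) Sym.mark := by simp [hX, hn'']
    have hXd : X (temp d) = [] := by simp [hX, hn, hn', ht d le_rfl (by omega)]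
    have h₄ : exec (loop (temp (d + 1)) (addTo (temp (d + 2)) (temp d)))
        (exec (f.comp (d + 2)) (exec (e.comp (d + 1)) S)) =
        Function.update X (temp d) (List.replicate (e.eval s * f.eval s) Sym.mark) := by
      rw [h₁, h₂, exec, h₃, hXe, hXd]
      simp
    have hXf : X (temp (d + 2)) = List.replicate (f.eval s) Sym.mark := by simp [hX]
    refine ⟨⟨b₁, b₂, ⟨?_, fun i _ => ?_⟩, ?_, ?_⟩, ?_⟩
    · simpa [h₁, h₂, hXe] using he
    · rw [h₁, h₂, h₃]
      simpa [bdd_addTo, hn'.symm, hXf] using hf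
    · rw [h₄]
      simpa [bdd_erase, hn.symm, hXe] using he
    · rw [h₄]
      simpa [bdd_erase, exec_erase, hn''.symm, hn'.symm, hXf] using hf
    · rw [comp, exec, exec, exec, h₄]
      simp only [exec, exec_erase, eval]
      funext r
      by_cases r₁ : r = temp (d + 2)
      · subst r₁; simp [hn'.symm, ht (d + 2) (by omega) (by omega)]
      · by_cases r₂ : r = temp (d + 1)
        · subst r₂; simp [hn.symm, r₁, ht (d + 1) (by omega) (by omega)]
        · by_cases r₃ : r = temp d
          · subst r₃; simp [r₁, r₂]
          · simp [r₁, r₂, r₃, hX]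
  | div e f ihe ihf =>
    intro d S hd hv ht hb
    simp only [depth] at hd
    have n₀₁ : temp d ≠ temp (d + 1) := temp_ne (by omega) (by omega) (by omega)
    have n₀₂ : temp d ≠ temp (d + 2) := temp_ne (by omega) (by omega) (by omega)
    have n₀₃ : temp d ≠ temp (d + 3) := temp_ne (by omega) (by omega) (by omega)
    have n₁₂ : temp (d + 1) ≠ temp (d + 2) := temp_ne (by omega) (by omega) (by omega)
    have n₁₃ : temp (d + 1) ≠ temp (d + 3) := temp_ne (by omega) (by omega) (by omega)
    have n₂₃ : temp (d + 2) ≠ temp (d + 3) := temp_ne (by omega) (by omega) (by omega)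
    obtain ⟨b₁, h₁⟩ := ihe (d + 1) S (by omega) hv (fun j hj => ht j (by omega)) hb.1
    obtain ⟨b₂, h₂⟩ := ihf (d + 2) (exec (e.comp (d + 1)) S) (by omega)
      (fun v => by rw [h₁, ← hv]; simp [temp])
      (fun j hj hj' => by
        rw [h₁, Function.update_of_ne (temp_ne hj' (by omega) (by omega)), ht j (by omega) hj'])
      hb.2.1
    have hf := eval_le s f P hs hb.2.1
    have he := eval_le s e P hs hb.1
    rw [h₁] at h₂
    set S' := Function.update (Function.update (Function.update S (temp (d + 1))
      (List.replicate (e.eval s) Sym.mark)) (temp (d + 2)) (List.replicate (f.eval s) Sym.mark))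
      (temp (d + 3)) (List.replicate (f.eval s) Sym.mark) with hS'
    have h₃ : exec (addTo (temp (d + 2)) (temp (d + 3)))
        (exec (f.comp (d + 2)) (exec (e.comp (d + 1)) S)) = S' := by
      rw [h₁, h₂, exec_addTo]
      simp [hS', n₁₃.symm, n₂₃.symm, ht (d + 3) (by omega) (by omega)]
    have h₄ := iterate_divStep (d := d) (b := f.eval s) (by omega) hb.2.2 S'
      (by simp [hS', n₀₁, n₀₂, n₀₃, ht d (by omega) (by omega)])
      (by simp [hS', n₂₃]) (by simp [hS'])
    have h₅ : S' (temp (d + 1)) = List.replicate (e.eval s) Sym.mark := by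
      simp [hS', n₁₂, n₁₃]
    have h₆ : exec (loop (temp (d + 1)) (divStep d)) S' = Function.update
        (Function.update S' (temp d) (List.replicate (e.eval s / f.eval s) Sym.mark))
        (temp (d + 3)) (List.replicate (f.eval s - e.eval s % f.eval s) Sym.mark) := by
      rw [exec, h₄, h₅, List.length_replicate]
    have hmod := Nat.mod_lt (e.eval s) hb.2.2
    refine ⟨⟨b₁, b₂, ?_, ⟨?_, fun i _ => ?_⟩, ?_, ?_, ?_⟩, ?_⟩
    · rw [bdd_addTo, h₁, h₂]
      simpa using hf
    · rw [h₃, h₅]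
      simpa using he
    · rw [h₃, h₄]
      simp only [divStep, Prog.Bdd, true_and]
      split
      · trivial
      · refine ⟨trivial, ?_⟩
        rw [bdd_addTo]
        simpa [exec, n₀₂.symm, n₂₃, hS'] using hf
    · rw [h₃, h₆, bdd_erase]
      simpa [n₀₁.symm, n₁₃, h₅] using he
    · rw [h₃, h₆, bdd_erase, exec_erase]
      simpa [n₀₂.symm, n₁₂.symm, n₂₃, hS'] using hf
    · rw [h₃, h₆, bdd_erase, exec_erase, exec_erase]
      simp [n₁₃.symm, n₂₃.symm]
      omega
    · rw [comp, exec, exec, exec, h₃, exec, h₆, exec, exec]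
      simp only [exec_erase, eval]
      funext r
      by_cases r₃ : r = temp (d + 3)
      · subst r₃; simp [n₀₃.symm, ht (d + 3) (by omega) (by omega)]
      · by_cases r₂ : r = temp (d + 2)
        · subst r₂; simp [n₂₃, n₀₂.symm, ht (d + 2) (by omega) (by omega)]
        · by_cases r₁ : r = temp (d + 1)
          · subst r₁; simp [n₁₂, n₁₃, n₀₁.symm, ht (d + 1) (by omega) (by omega)]
          · by_cases r₀ : r = temp d
            · subst r₀; simp [r₁, r₂, r₃]
            · simp [r₀, r₁, r₂, r₃, hS']

end Expr

namespace Cmd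
open Prog Reg

/-- Compilation to a program on stacks. -/
def comp : Cmd → Prog Reg
  | skip => .skip
  | seq c d => .seq (comp c) (comp d)
  | assign v e => .seq (e.comp 0) (.seq (erase (.num v)) (.seq (addTo (temp 0) (.num v))
      (erase (temp 0))))
  | ifz v c d => .pop (.num v) fun o => match o with
    | none => comp c
    | some a => .seq (.push (.num v) a) (comp d)
  | push k a => .push (.stack k) a
  | pop k f => .pop (.stack k) fun o => comp (f o)
  | loop v c => .loop (.num v) (comp c)
  | loopS k c => .loop (.stack k) (comp c)

/-- The compiled program has the effect of the original one on the stacks that represent the memory,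
and its loops are bounded if no large number occurs. -/
theorem comp_spec {P : ℕ} (c : Cmd) : ∀ s : St, (∀ v, s.get v ≤ P) → c.Ok P s →
    Prog.Bdd P c.comp s.repr ∧ exec c.comp s.repr = (c.run s).repr ∧ ∀ v, (c.run s).get v ≤ P := by
  have iter : ∀ (c : Cmd) (k : ℕ) (s : St), (∀ s : St, (∀ v, s.get v ≤ P) → c.Ok P s →
      Prog.Bdd P c.comp s.repr ∧ exec c.comp s.repr = (c.run s).repr ∧ ∀ v, (c.run s).get v ≤ P) →
      (∀ v, s.get v ≤ P) → (∀ i < k, c.Ok P ((run c)^[i] s)) →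
      (exec c.comp)^[k] s.repr = ((run c)^[k] s).repr ∧ ∀ v, ((run c)^[k] s).get v ≤ P := by
    intro c k s ih hs h
    induction k with
    | zero => exact ⟨rfl, hs⟩
    | succ k ihk =>
      obtain ⟨e, b⟩ := ihk fun i hi => h i (by omega)
      obtain ⟨_, h₂, h₃⟩ := ih _ b (h k (by omega))
      rw [Function.iterate_succ_apply', Function.iterate_succ_apply', e]
      exact ⟨h₂, h₃⟩
  induction c with
  | skip => exact fun s hs _ => ⟨trivial, rfl, hs⟩
  | seq c d ihc ihd =>
    intro s hs h
    obtain ⟨b₁, e₁, g₁⟩ := ihc s hs h.1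
    obtain ⟨b₂, e₂, g₂⟩ := ihd _ g₁ h.2
    exact ⟨⟨b₁, by rwa [e₁]⟩, by rw [comp, exec, e₁, e₂, run], g₂⟩
  | assign v e =>
    intro s hs h
    obtain ⟨b, he⟩ := Expr.comp_spec hs e 0 s.repr (by have := h.1; omega) (fun v => rfl)
      (fun j _ _ => rfl) h.2
    have hle := Expr.eval_le s e P hs h.2
    refine ⟨⟨b, ?_, ?_, ?_⟩, ?_, fun w => ?_⟩
    · rw [bdd_erase, he]
      simpa [temp, St.repr] using hs v
    · rw [bdd_addTo, exec_erase, he]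
      simpa [temp] using hle
    · rw [bdd_erase, exec_addTo, exec_erase, he]
      simpa [temp] using hle
    · rw [comp, exec, exec, exec, he, exec_erase, exec_addTo, exec_erase, run, St.repr_set]
      funext r
      by_cases h₁ : r = temp 0
      · subst h₁; simp [temp, St.repr]
      · by_cases h₂ : r = .num v
        · subst h₂; simp [temp]
        · simp [h₁, h₂]
    · rw [run, St.get_set]
      by_cases h₁ : w = v
      · subst h₁; simpa using hle
      · simpa [h₁] using hs w
  | ifz v c d ihc ihd =>
    intro s hs h
    by_cases h0 : s.get v = 0
    · have e₂ : s.repr (.num v) = [] := by simp [St.repr, h0]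
      have e : Function.update s.repr (.num v) [] = s.repr := by
        rw [← e₂, Function.update_eq_self]
      simp only [Ok, h0, if_true] at h
      obtain ⟨b, e₁, g⟩ := ihc s hs h
      refine ⟨?_, ?_, ?_⟩
      · simpa [comp, Prog.Bdd, e₂, e] using b
      · simpa [comp, exec, e₂, e, run, h0] using e₁
      · simpa [run, h0] using g
    · obtain ⟨x, hx⟩ := Nat.exists_eq_succ_of_ne_zero h0
      simp only [Ok, h0, if_false] at h
      obtain ⟨b, e₁, g⟩ := ihd s hs h
      have e₂ : s.repr (.num v) = Sym.mark :: List.replicate x Sym.mark := by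
        simp [St.repr, hx, List.replicate_succ]
      have e : Function.update s.repr (.num v) (Sym.mark :: List.replicate x Sym.mark) = s.repr := by
        rw [← e₂, Function.update_eq_self]
      refine ⟨?_, ?_, ?_⟩
      · simpa [comp, Prog.Bdd, exec, e₂, e] using b
      · simpa [comp, exec, e₂, e, run, h0] using e₁
      · simpa [run, h0] using g
  | push k a =>
    intro s hs _
    exact ⟨trivial, by rw [run, St.repr_setS, comp, exec]; rfl, by simpa [run] using hs⟩
  | pop k f ih =>
    intro s hs h
    obtain ⟨b, e, g⟩ := ih (s.getS k).head? _ (by simpa using hs) h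
    rw [St.repr_setS] at b e
    exact ⟨b, e, g⟩
  | loop v c ih =>
    intro s hs h
    have e : (s.repr (.num v)).length = s.get v := by simp [St.repr]
    have := iter c (s.get v) s ih hs h
    refine ⟨⟨e.trans_le (hs v), fun i hi => ?_⟩, ?_, this.2⟩
    · rw [e] at hi
      have := iter c i s ih hs fun j hj => h j (by omega)
      rw [this.1]
      exact (ih _ this.2 (h i hi)).1
    · rw [comp, exec, e, this.1, run]
  | loopS k c ih =>
    intro s hs h
    have e : s.repr (.stack k) = s.getS k := rfl
    have := iter c (s.getS k).length s ih hs h.2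
    refine ⟨⟨h.1, fun i hi => ?_⟩, ?_, this.2⟩
    · have := iter c i s ih hs fun j hj => h.2 j (by rw [e] at hi; omega)
      rw [this.1]
      exact (ih _ this.2 (h.2 i hi)).1
    · rw [comp, exec, e, this.1, run]

end Cmd

/-! ### Wires of circuits -/

theorem evalGates_append (G G' : List Gate) (v : List ℤ) :
    evalGates (G ++ G') v = evalGates G' (evalGates G v) := by
  induction G generalizing v with
  | nil => rfl
  | cons g G ih => simp only [List.cons_append, evalGates, ih]

theorem length_evalGates (G : List Gate) (v : List ℤ) :
    (evalGates G v).length = v.length + G.length := by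
  induction G generalizing v with
  | nil => rfl
  | cons g G ih => simp only [evalGates, ih, List.length_append, List.length_cons, List.length_nil]; omega

theorem getD_evalGates (G : List Gate) (v : List ℤ) {i : ℕ} (hi : i < v.length) :
    (evalGates G v).getD i 0 = v.getD i 0 := by
  induction G generalizing v with
  | nil => rfl
  | cons g G ih =>
    rw [evalGates, ih _ (by simp; omega), List.getD_append _ _ _ _ hi]

variable {n m : ℕ}

/-- The value of wire `i` when the gates `G` are evaluated on the input `x`. -/
def wire (G : List Gate) (x : Fin n → ℤ) (i : ℕ) : ℤ := (evalGates G (List.ofFn x)).getD i 0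

/-- Every gate of the list reads earlier wires only. -/
def WF (n : ℕ) (G : List Gate) : Prop :=
  ∀ (k : ℕ) (hk : k < G.length), (G[k]).WellFormed (n + k)

theorem WF.append {G G' : List Gate} (h : WF n G)
    (h' : ∀ (k : ℕ) (hk : k < G'.length), (G'[k]).WellFormed (n + G.length + k)) :
    WF n (G ++ G') := by
  intro k hk
  by_cases hk' : k < G.length
  · rw [List.getElem_append_left hk']
    exact h k hk'
  · rw [List.getElem_append_right (by omega)]
    have := h' (k - G.length) (by rw [List.length_append] at hk; omega)
    rwa [show n + G.length + (k - G.length) = n + k by omega] at this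

theorem Gate.WellFormed.mono {g : Gate} {k l : ℕ} (h : g.WellFormed k) (hkl : k ≤ l) :
    g.WellFormed l := by
  cases g with
  | linear t b => exact fun u hu => (h u hu).trans_le hkl
  | maximum i j => exact ⟨h.1.trans_le hkl, h.2.trans_le hkl⟩
  | zeroCond i j => exact ⟨h.1.trans_le hkl, h.2.trans_le hkl⟩
  | floorDiv d i => exact ⟨h.1, h.2.trans_le hkl⟩

theorem Gate.eval_congr {g : Gate} {k : ℕ} (h : g.WellFormed k) {w w' : ℕ → ℤ}
    (hw : ∀ i < k, w i = w' i) : g.eval w = g.eval w' := by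
  cases g with
  | linear t b =>
    simp only [eval]
    congr 2
    exact List.map_congr_left fun u hu => by rw [hw _ (h u hu)]
  | maximum i j => simp only [eval, hw _ h.1, hw _ h.2]
  | zeroCond i j => simp only [eval, hw _ h.1, hw _ h.2]
  | floorDiv d i => simp only [eval, hw _ h.2]

theorem wire_append (G G' : List Gate) (x : Fin n → ℤ) {i : ℕ} (hi : i < n + G.length) :
    wire (G ++ G') x i = wire G x i := by
  rw [wire, evalGates_append, getD_evalGates _ _ (by simpa [length_evalGates] using hi), wire]

theorem wire_concat (G : List Gate) (g : Gate) (x : Fin n → ℤ) :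
    wire (G ++ [g]) x (n + G.length) = g.eval (wire G x) := by
  have : (evalGates G (List.ofFn x)).length = n + G.length := by simp [length_evalGates]
  rw [wire, evalGates_append, evalGates, evalGates, List.getD_append_right _ _ _ _ this.le, this,
    Nat.sub_self]
  rfl

theorem wire_input (G : List Gate) (x : Fin n → ℤ) (i : Fin n) : wire G x i = x i := by
  rw [wire, getD_evalGates _ _ (by simp)]
  simp

/-- The gate at any position of a list computes the value of its wire. -/
theorem wire_gate {G : List Gate} (hG : WF n G) (x : Fin n → ℤ) {k : ℕ} (hk : k < G.length) :
    wire G x (n + k) = (G[k]).eval (wire G x) := by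
  have e : G = (G.take k ++ [G[k]]) ++ G.drop (k + 1) := by simp
  have hl : (G.take k).length = k := by simp; omega
  have h₁ : wire G x (n + k) = wire (G.take k ++ [G[k]]) x (n + k) := by
    conv_lhs => rw [e]
    exact wire_append _ _ _ (by simp; omega)
  have h₂ := wire_concat (G.take k) G[k] x
  rw [hl] at h₂
  rw [h₁, h₂]
  refine Gate.eval_congr (hG k hk) fun i hi => ?_
  conv_rhs => rw [e, List.append_assoc]
  exact (wire_append _ _ _ (by simp; omega)).symm

/-- `N` gates in a row. -/
def gateRow (N : ℕ) (g : ℕ → Gate) : List Gate := (List.range N).map g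

@[simp] theorem length_gateRow (N : ℕ) (g : ℕ → Gate) : (gateRow N g).length = N := by
  simp [gateRow]

theorem WF.append_row {G : List Gate} (h : WF n G) {N : ℕ} {g : ℕ → Gate}
    (hg : ∀ K < N, (g K).WellFormed (n + G.length)) : WF n (G ++ gateRow N g) := by
  refine h.append fun k hk => ?_
  rw [length_gateRow] at hk
  simpa [gateRow] using (hg k hk).mono (Nat.le_add_right _ k)

theorem wire_row {G : List Gate} (h : WF n G) {N : ℕ} {g : ℕ → Gate}
    (hg : ∀ K < N, (g K).WellFormed (n + G.length)) (x : Fin n → ℤ) {K : ℕ} (hK : K < N) :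
    wire (G ++ gateRow N g) x (n + G.length + K) = (g K).eval (wire G x) := by
  have h₁ := wire_gate (h.append_row hg) x (k := G.length + K) (by simp; omega)
  rw [← add_assoc] at h₁
  rw [h₁, List.getElem_append_right (by omega)]
  simp only [gateRow, List.getElem_map, List.getElem_range, Nat.add_sub_cancel_left]
  exact Gate.eval_congr (hg K hK) fun i hi => wire_append _ _ _ hi

theorem Gate.size_le_length_encode (g : Gate) : g.size ≤ g.encode.length := by
  have hnat : ∀ k : ℕ, (encodeNat k).length = Nat.size k + 1 := fun k => by
    simp [encodeNat, Nat.size_eq_bits_len]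
  have hint : ∀ z : ℤ, (encodeInt z).length = bitLength z + 1 := fun z => by
    simp [encodeInt, hnat, bitLength]
  cases g with
  | linear t b =>
    have : (t.map fun t => 1 + bitLength t.1).sum ≤
        (t.flatMap fun t => Sym.term :: (encodeInt t.1 ++ encodeNat t.2)).length := by
      induction t with
      | nil => simp
      | cons u t ih =>
        simp only [List.map_cons, List.sum_cons, List.flatMap_cons, List.length_append,
          List.length_cons, hint, hnat]
        omega
    simp only [size, encode, List.length_cons, List.length_append, hint]
    omega
  | maximum i j => simp [size, encode, hnat]; omega
  | zeroCond i j => simp [size, encode, hnat]; omega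
  | floorDiv d i => simp [size, encode, hnat, bitLength]; omega

/-- The size of a circuit is bounded by the length of its string. -/
theorem Circuit.size_le {n m : ℕ} (C : Circuit n m) : C.size ≤ n + m + C.encode.length := by
  have : (C.gates.map Gate.size).sum ≤ (C.gates.flatMap Gate.encode).length := by
    generalize C.gates = G
    induction G with
    | nil => simp
    | cons g G ih =>
      have := g.size_le_length_encode
      simp only [List.map_cons, List.sum_cons, List.flatMap_cons, List.length_append]
      omega
  simp only [size, encode, List.length_append]
  omega

/-! ### Truth values of formulas as numbers -/

namespace Formula

/-- A nonnegative number that vanishes if and only if the formula holds. It is composed of operations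
that gates can perform: the conditional terms are values of `E`. -/
def defect : Formula n m → (Fin n → ℤ) → (Fin m → ℤ) → ℤ
  | ineq a c b, x, y => max (0 - (linForm a c x y + b)) 0
  | congr a c r M _, x, y => linForm a c x y - r - M * Int.fdiv (linForm a c x y - r) M
  | ncongr a c r M _, x, y =>
    if linForm a c x y - r - M * Int.fdiv (linForm a c x y - r) M = 0 then 1 else 0
  | and φ ψ, x, y => φ.defect x y + ψ.defect x y
  | or φ ψ, x, y => ψ.defect x y - if φ.defect x y = 0 then ψ.defect x y else 0

theorem sub_mul_fdiv_eq_zero_iff {u : ℤ} {r M : ℕ} :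
    u - r - M * Int.fdiv (u - r) M = 0 ↔ ∃ k : ℤ, u = k * M + r := by
  constructor
  · intro h
    exact ⟨Int.fdiv (u - r) M, by linarith⟩
  · rintro ⟨k, rfl⟩
    rw [Int.fdiv_eq_ediv_of_nonneg _ (by omega), add_sub_cancel_right,
      Int.mul_ediv_cancel' (Int.dvd_mul_left k M), sub_self]

theorem defect_spec (φ : Formula n m) (x : Fin n → ℤ) (y : Fin m → ℤ) :
    0 ≤ φ.defect x y ∧ (φ.defect x y = 0 ↔ φ.Holds x y) := by
  induction φ with
  | ineq a c b =>
    refine ⟨le_max_right _ _, ?_⟩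
    simp only [defect, Holds]
    rw [max_eq_right_iff]
    omega
  | congr a c r M hr =>
    refine ⟨?_, sub_mul_fdiv_eq_zero_iff⟩
    have := Int.emod_nonneg (linForm a c x y - r) (b := (M : ℤ)) (by omega)
    rw [Int.emod_def] at this
    simpa [defect, Int.fdiv_eq_ediv_of_nonneg] using this
  | ncongr a c r M hr =>
    simp only [defect, Holds]
    rw [← sub_mul_fdiv_eq_zero_iff]
    split <;> simp_all
  | and φ ψ ihφ ihψ =>
    simp only [defect, Holds, ← ihφ.2, ← ihψ.2]
    have := ihφ.1
    have := ihψ.1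
    omega
  | or φ ψ ihφ ihψ =>
    simp only [defect, Holds, ← ihφ.2, ← ihψ.2]
    have := ihφ.1
    have := ihψ.1
    split <;> omega

end Formula

/-! ### Reasoning about programs of the register language -/

/-- All number registers are at most `P`. -/
def St.Le (P : ℕ) (s : St) : Prop := ∀ v, s.get v ≤ P

/-- The memory with other scratch registers and output. -/
@[simps]
def St.scr (s : St) (k dn : ℕ) (out : List Sym) : St := {s with k := k, dn := dn, out := out}

namespace Cmd

/-- Started in the memory `s`, the program `c` leads to the memory `s'`, and if the registers are at
most `P` at the beginning, then no number larger than `P` occurs. -/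
def Tr (P : ℕ) (c : Cmd) (s s' : St) : Prop := s.Le P → c.Ok P s ∧ c.run s = s' ∧ s'.Le P

/-- The `k`-fold repetition of `c` leads from `s` to `s'`, without numbers larger than `P`. -/
def TrN (P : ℕ) (c : Cmd) (k : ℕ) (s s' : St) : Prop :=
  s.Le P → (∀ i < k, c.Ok P (c.run^[i] s)) ∧ c.run^[k] s = s' ∧ s'.Le P

/-- Runs programs one after the other. -/
def block : List Cmd → Cmd
  | [] => skip
  | c :: l => seq c (block l)

/-- Writes symbols. -/
def write (l : List Sym) : Cmd := block (l.map (push .out))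

section Rules

variable {P : ℕ} {c : Cmd} {s s' s'' : St}

theorem Tr.of_eq (h : Tr P c s s') (e : s' = s'') : Tr P c s s'' := e ▸ h

theorem TrN.of_eq {k : ℕ} (h : TrN P c k s s') (e : s' = s'') : TrN P c k s s'' := e ▸ h

theorem Tr.skip : Tr P .skip s s := fun h => ⟨trivial, rfl, h⟩

theorem Tr.nil (h : s = s') : Tr P (block []) s s' := h ▸ Tr.skip

theorem Tr.cons {l : List Cmd} (h₁ : Tr P c s s') (h₂ : Tr P (block l) s' s'') :
    Tr P (block (c :: l)) s s'' := fun h => by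
  obtain ⟨a₁, rfl, b₁⟩ := h₁ h
  obtain ⟨a₂, e₂, b₂⟩ := h₂ b₁
  exact ⟨⟨a₁, a₂⟩, e₂, b₂⟩

theorem Tr.assign {v : Var} {e : Expr} (hd : e.depth ≤ 16) (hb : s.Le P → e.Bdd P s) :
    Tr P (.assign v e) s (s.set v (e.eval s)) := fun h => by
  refine ⟨⟨hd, hb h⟩, rfl, fun w => ?_⟩
  rw [St.get_set]
  by_cases hw : w = v
  · subst hw; simpa using Expr.eval_le s e P h (hb h)
  · simpa [hw] using h w

theorem Tr.push {k : Stack} {a : Sym} : Tr P (.push k a) s (s.setS k (a :: s.getS k)) :=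
  fun h => ⟨trivial, rfl, by simpa [St.Le] using h⟩

theorem Tr.pop {k : Stack} {f : Option Sym → Cmd} (o : Option Sym) (ho : (s.getS k).head? = o)
    (h : Tr P (f o) (s.setS k (s.getS k).tail) s') : Tr P (.pop k f) s s' := fun hs => by
  subst ho
  exact h (by simpa [St.Le] using hs)

theorem Tr.ifz_pos {v : Var} {d : Cmd} (h0 : s.get v = 0) (h : Tr P c s s') :
    Tr P (.ifz v c d) s s' := fun hs => by simpa [Ok, run, h0] using h hs

theorem Tr.ifz_neg {v : Var} {d : Cmd} (h0 : s.get v ≠ 0) (h : Tr P c s s') :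
    Tr P (.ifz v d c) s s' := fun hs => by simpa [Ok, run, h0] using h hs

theorem TrN.zero : TrN P c 0 s s := fun h => ⟨by simp, rfl, h⟩

theorem TrN.succ {k : ℕ} (h₁ : Tr P c s s') (h₂ : TrN P c k s' s'') : TrN P c (k + 1) s s'' :=
  fun h => by
    obtain ⟨a₁, rfl, b₁⟩ := h₁ h
    obtain ⟨a₂, e₂, b₂⟩ := h₂ b₁
    refine ⟨fun i hi => ?_, e₂, b₂⟩
    cases i with
    | zero => exact a₁
    | succ i => exact a₂ i (by omega)

theorem TrN.add {j k : ℕ} (h₁ : TrN P c j s s') (h₂ : TrN P c k s' s'') :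
    TrN P c (j + k) s s'' := fun h => by
  obtain ⟨a₁, rfl, b₁⟩ := h₁ h
  obtain ⟨a₂, e₂, b₂⟩ := h₂ b₁
  refine ⟨fun i hi => ?_, ?_, b₂⟩
  · by_cases hij : i < j
    · exact a₁ i hij
    · obtain ⟨d, rfl⟩ := Nat.exists_eq_add_of_le (not_lt.mp hij)
      rw [add_comm, Function.iterate_add_apply]
      exact a₂ d (by omega)
  · rw [add_comm, Function.iterate_add_apply, e₂]

theorem TrN.const {k : ℕ} (h : Tr P c s s) : TrN P c k s s := by
  induction k with
  | zero => exact .zero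
  | succ k ih => exact .succ h ih

theorem TrN.of_seq {k : ℕ} (f : ℕ → St) (h : ∀ i < k, Tr P c (f i) (f (i + 1))) :
    TrN P c k (f 0) (f k) := by
  induction k with
  | zero => exact .zero
  | succ k ih =>
    exact (ih fun i hi => h i (by omega)).add (TrN.succ (h k (by omega)) .zero)

theorem Tr.loop {v : Var} {k : ℕ} (hk : s.get v = k) (h : TrN P c k s s') :
    Tr P (.loop v c) s s' := by
  subst hk; exact h

theorem Tr.loopS {v : Stack} {k : ℕ} (hk : (s.getS v).length = k) (hP : k ≤ P)
    (h : TrN P c k s s') : Tr P (.loopS v c) s s' := by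
  subst hk
  exact fun hs => ⟨⟨hP, (h hs).1⟩, (h hs).2⟩

theorem Tr.write : ∀ (l : List Sym) (s : St),
    Tr P (write l) s {s with out := l.reverse ++ s.out}
  | [], s => .nil rfl
  | a :: l, s => Tr.cons Tr.push
      (Tr.of_eq (Tr.write l (s.setS .out (a :: s.out))) (by simp [St.setS]))

/-- A fact about the memory may be derived from the bound on the registers. -/
theorem Tr.of_le (h : s.Le P → Tr P c s s') : Tr P c s s' := fun hs => h hs hs

end Rules
end Cmd

/-! ### Writing numbers and gates -/

namespace Cmd

/-- Writes the value of an expression in binary. -/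
def emitNat (e : Expr) : Cmd := block [
  assign .k e,
  assign .dn 0,
  loop .k (ifz .k skip (block [
    assign .dn (Var.k % 2),
    ifz .dn (push .out (.bit false)) (push .out (.bit true)),
    assign .dn 0,
    assign .k (Var.k / 2)])),
  push .out .mark]

/-- Writes the difference of the values of two expressions. -/
def emitInt (e f : Expr) : Cmd := block [
  assign .dn (f - e),
  ifz .dn (push .out (.sign false)) (push .out (.sign true)),
  emitNat ((e - f) + (f - e))]

theorem bits_of_pos {x : ℕ} (hx : 0 < x) : x.bits = decide (x % 2 = 1) :: (x / 2).bits := by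
  have h := Nat.bits_append_bit (x / 2) (decide (x % 2 = 1)) (fun h => by
    have : x = 1 := by omega
    subst this; rfl)
  rw [← h]
  congr 1
  rw [Nat.bit_val]
  have := Nat.mod_two_eq_zero_or_one x
  rcases this with h | h <;> simp [h] <;> omega

variable {P : ℕ}

/-- Each round writes the last bit of `k` and halves `k`; when `k` is zero, nothing happens any more. -/
theorem trN_emitBits (hP : 2 ≤ P) : ∀ (l x : ℕ) (s : St), s.k = x → s.dn = 0 → x < 2 ^ l →
    TrN P (ifz .k skip (block [
      assign .dn (Var.k % 2),
      ifz .dn (push .out (.bit false)) (push .out (.bit true)),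
      assign .dn 0,
      assign .k (Var.k / 2)])) l s
      {s with k := 0, out := (x.bits.map Sym.bit).reverse ++ s.out}
  | 0, x, s, hk, hd, hx => by
    have : x = 0 := by simpa using hx
    subst this
    have e : {s with k := 0, out := ((Nat.bits 0).map Sym.bit).reverse ++ s.out} = s := by
      cases s; simp_all
    rw [e]
    exact .zero
  | l + 1, x, s, hk, hd, hx => by
    rcases Nat.eq_zero_or_pos x with h0 | hpos
    · subst h0
      have e : {s with k := 0, out := ((Nat.bits 0).map Sym.bit).reverse ++ s.out} = s := by
        cases s; simp_all
      rw [e]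
      exact .const (.ifz_pos hk .skip)
    · have ih := trN_emitBits hP l (x / 2)
        {s with k := x / 2, out := Sym.bit (decide (x % 2 = 1)) :: s.out} rfl hd (by
          rw [pow_succ] at hx; omega)
      refine TrN.succ (.ifz_neg (by simpa [St.get, hk] using hpos.ne') ?_) (ih.of_eq ?_)
      · refine Tr.cons (.assign (by decide) fun h => ?_) ?_
        · rw [Expr.bdd_mod _ _ _ _ h]
          simpa using hP
        · refine Tr.cons (s' := {s with dn := x % 2, out := Sym.bit (decide (x % 2 = 1)) :: s.out})
            ?_ (Tr.cons (.assign (by decide) fun h => by simp)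
              (Tr.cons (.assign (by decide) fun h => by simpa using hP) (.nil ?_)))
          · rcases Nat.mod_two_eq_zero_or_one x with h | h
            · exact .ifz_pos (by simp [St.get, St.set, hk, h])
                (Tr.push.of_eq (by simp [St.set, St.get, St.setS, St.getS, hk, h]))
            · exact .ifz_neg (by simp [St.get, St.set, hk, h])
                (Tr.push.of_eq (by simp [St.set, St.get, St.setS, St.getS, hk, h]))
          · simp [St.set, St.get, hk, hd]
      · simp [bits_of_pos hpos]

theorem tr_emitNat (hP : 2 ≤ P) {e : Expr} {s : St} (hd : e.depth ≤ 16)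
    (hb : s.Le P → e.Bdd P s) : Tr P (emitNat e) s
      {s with k := 0, dn := 0, out := (encodeNat (e.eval s)).reverse ++ s.out} := by
  refine Tr.cons (.assign hd hb) (Tr.cons (.assign (by decide) fun _ => by simp)
    (Tr.cons (.loop rfl (trN_emitBits hP _ _ _ rfl rfl Nat.lt_two_pow_self))
      (Tr.cons .push (.nil ?_))))
  simp [St.set, St.setS, St.getS, encodeNat]

end Cmd

namespace Expr

/-- The expression does not mention the scratch registers `k` and `dn`. -/
def Fresh : Expr → Prop
  | lit _ => True
  | var v => v ≠ .k ∧ v ≠ .dn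
  | add e f => e.Fresh ∧ f.Fresh
  | sub e f => e.Fresh ∧ f.Fresh
  | mul e f => e.Fresh ∧ f.Fresh
  | div e f => e.Fresh ∧ f.Fresh

instance decidableFresh : ∀ e : Expr, Decidable e.Fresh
  | lit _ => inferInstanceAs (Decidable True)
  | var v => inferInstanceAs (Decidable (v ≠ .k ∧ v ≠ .dn))
  | add e f | sub e f | mul e f | div e f =>
    have := decidableFresh e
    have := decidableFresh f
    inferInstanceAs (Decidable (e.Fresh ∧ f.Fresh))

theorem eval_fresh {e : Expr} (h : e.Fresh) (s : St) (k dn : ℕ) (out : List Sym) :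
    e.eval (s.scr k dn out) = e.eval s := by
  induction e with
  | lit k => rfl
  | var v => cases v <;> first | rfl | exact absurd rfl h.1 | exact absurd rfl h.2
  | add e f ihe ihf => simp only [eval, ihe h.1, ihf h.2]
  | sub e f ihe ihf => simp only [eval, ihe h.1, ihf h.2]
  | mul e f ihe ihf => simp only [eval, ihe h.1, ihf h.2]
  | div e f ihe ihf => simp only [eval, ihe h.1, ihf h.2]

theorem bdd_fresh {e : Expr} (h : e.Fresh) (P : ℕ) (s : St) (k dn : ℕ) (out : List Sym) :
    e.Bdd P (s.scr k dn out) ↔ e.Bdd P s := by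
  induction e with
  | lit k => rfl
  | var v => rfl
  | add e f ihe ihf => simp only [Bdd, ihe h.1, ihf h.2, eval_fresh h.1, eval_fresh h.2]
  | sub e f ihe ihf => simp only [Bdd, ihe h.1, ihf h.2]
  | mul e f ihe ihf => simp only [Bdd, ihe h.1, ihf h.2, eval_fresh h.1, eval_fresh h.2]
  | div e f ihe ihf => simp only [Bdd, ihe h.1, ihf h.2, eval_fresh h.2]

/-- The expression can be evaluated in the memory `s`, up to the scratch registers, with value `x` and
without numbers larger than `P`. Two of the 16 temporary registers are left over, so that the difference
of two such expressions can be written by `Cmd.emitInt`. -/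
structure Good (P : ℕ) (e : Expr) (s : St) (x : ℕ) : Prop where
  fresh : e.Fresh
  depth : e.depth ≤ 14
  bdd : (s.scr 0 0 []).Le P → e.Bdd P s
  eval : e.eval s = x

end Expr

theorem St.Le.scr {P : ℕ} {s : St} {k dn : ℕ} {out : List Sym} (h : (s.scr k dn out).Le P)
    {out' : List Sym} : (s.scr 0 0 out').Le P := by
  intro v
  have := h v
  cases v <;> first | exact this | exact Nat.zero_le _

namespace Cmd

variable {P : ℕ}

/-- The program `c` writes the gate `g`. -/
def Emits (P : ℕ) (c : Cmd) (s : St) (g : Gate) : Prop :=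
  ∀ k dn out, Tr P c (s.scr k dn out) (s.scr 0 0 (g.encode.reverse ++ out))

theorem tr_emitNat' (hP : 2 ≤ P) {e : Expr} {s : St} {x : ℕ} (he : e.Good P s x) (k dn : ℕ)
    (out : List Sym) :
    Tr P (emitNat e) (s.scr k dn out) (s.scr 0 0 ((encodeNat x).reverse ++ out)) := by
  refine Tr.of_eq (tr_emitNat hP (he.depth.trans (by norm_num)) fun h =>
    (Expr.bdd_fresh he.fresh _ _ _ _ _).mpr (he.bdd h.scr)) ?_
  rw [Expr.eval_fresh he.fresh, he.eval]
  rfl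

theorem tr_emitInt (hP : 2 ≤ P) {e f : Expr} {s : St} {x y : ℕ} (he : e.Good P s x)
    (hf : f.Good P s y) (k dn : ℕ) (out : List Sym) : Tr P (emitInt e f) (s.scr k dn out)
      (s.scr 0 0 ((encodeInt ((x : ℤ) - y)).reverse ++ out)) := by
  have hd := he.depth
  have hd' := hf.depth
  have fe : (f - e).Fresh := ⟨hf.fresh, he.fresh⟩
  have he' : (f - e).eval s = y - x := by simp [he.eval, hf.eval]
  refine Tr.cons (Tr.assign ?_ fun h => (Expr.bdd_fresh fe _ _ _ _ _).mpr
    ⟨hf.bdd h.scr, he.bdd h.scr⟩) ?_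
  · change max _ _ ≤ _; omega
  rw [Expr.eval_fresh fe, he']
  refine Tr.cons (s' := s.scr k (y - x) (Sym.sign (decide ((x : ℤ) - y < 0)) :: out)) ?_
    (Tr.cons (s' := s.scr 0 0 ((encodeInt ((x : ℤ) - y)).reverse ++ out)) ?_ (.nil rfl))
  · rcases Nat.eq_zero_or_pos (y - x) with h | h
    · refine .ifz_pos h (Tr.push.of_eq ?_)
      have : ¬ (x : ℤ) - y < 0 := by omega
      simp [this, St.setS, St.set, St.getS, St.scr]
    · refine .ifz_neg h.ne' (Tr.push.of_eq ?_)
      have : (x : ℤ) - y < 0 := by omega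
      simp [this, St.setS, St.set, St.getS, St.scr]
  · have ha : ((e - f) + (f - e)).eval s = ((x : ℤ) - y).natAbs := by
      simp only [Expr.eval_add, Expr.eval_sub, he.eval, hf.eval]
      omega
    have hfr : ((e - f) + (f - e)).Fresh := ⟨⟨he.fresh, hf.fresh⟩, hf.fresh, he.fresh⟩
    refine (tr_emitNat hP ?_ fun h => ?_).of_eq ?_
    · change max (max _ _) (max _ _ + 1) ≤ _; omega
    · rw [Expr.bdd_fresh hfr]
      have be := he.bdd h.scr
      have bf := hf.bdd h.scr
      refine ⟨⟨be, bf⟩, ⟨bf, be⟩, ?_⟩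
      have l₁ := Expr.eval_le _ e P h ((Expr.bdd_fresh he.fresh _ _ _ _ _).mpr be)
      have l₂ := Expr.eval_le _ f P h ((Expr.bdd_fresh hf.fresh _ _ _ _ _).mpr bf)
      rw [Expr.eval_fresh he.fresh, he.eval] at l₁
      rw [Expr.eval_fresh hf.fresh, hf.eval] at l₂
      simp only [Expr.eval_sub, he.eval, hf.eval]
      omega
    · rw [Expr.eval_fresh hfr, ha]
      simp [St.scr, encodeInt]

/-- Writes the gate `A + (p - q) * C` for wires `A` and `C`. -/
def emitLin (A p q C : Expr) : Cmd := block [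
  write [.linear, .sign false, .mark, .term, .sign false, .bit true, .mark],
  emitNat A, write [.term], emitInt p q, emitNat C, write [.mark]]

/-- Writes a gate with two inputs. -/
def emitBin (a : Sym) (A C : Expr) : Cmd := block [write [a], emitNat A, emitNat C]

/-- Writes a constant gate without inputs, of value zero or one. -/
def emitConst (b : Bool) : Cmd :=
  write ([.linear, .sign false] ++ (if b then [.bit true] else []) ++ [.mark, .mark])

/-- The gate that computes `A + z * C`. -/
def linGate (A : ℕ) (z : ℤ) (C : ℕ) : Gate := .linear [(1, A), (z, C)] 0

theorem emits_lin (hP : 2 ≤ P) {A p q C : Expr} {s : St} {a x y c : ℕ} (hA : A.Good P s a)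
    (hp : p.Good P s x) (hq : q.Good P s y) (hC : C.Good P s c) :
    Emits P (emitLin A p q C) s (linGate a ((x : ℤ) - y) c) := fun k dn out => by
  have hw : ∀ (l : List Sym) (k dn : ℕ) (out : List Sym),
      Tr P (write l) (s.scr k dn out) (s.scr k dn (l.reverse ++ out)) := fun l k dn out =>
    Tr.write l (s.scr k dn out)
  refine Tr.cons (hw _ _ _ _) (Tr.cons (tr_emitNat' hP hA _ _ _) (Tr.cons (hw _ _ _ _)
    (Tr.cons (tr_emitInt hP hp hq _ _ _) (Tr.cons (tr_emitNat' hP hC _ _ _)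
    (Tr.cons (hw _ _ _ _) (.nil ?_))))))
  have h0 : encodeInt 0 = [Sym.sign false, Sym.mark] := by simp [encodeInt, encodeNat]
  have h1 : encodeInt 1 = [Sym.sign false, Sym.bit true, Sym.mark] := by
    simp [encodeInt, encodeNat]
  simp [linGate, Gate.encode, h0, h1]

theorem emits_maximum (hP : 2 ≤ P) {A C : Expr} {s : St} {a c : ℕ} (hA : A.Good P s a)
    (hC : C.Good P s c) : Emits P (emitBin .maximum A C) s (.maximum a c) := fun k dn out => by
  refine Tr.cons (Tr.write _ (s.scr k dn out)) (Tr.cons (tr_emitNat' hP hA k dn _)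
    (Tr.cons (tr_emitNat' hP hC _ _ _) (.nil ?_)))
  simp [Gate.encode]

theorem emits_zeroCond (hP : 2 ≤ P) {A C : Expr} {s : St} {a c : ℕ} (hA : A.Good P s a)
    (hC : C.Good P s c) : Emits P (emitBin .zeroCond A C) s (.zeroCond a c) := fun k dn out => by
  refine Tr.cons (Tr.write _ (s.scr k dn out)) (Tr.cons (tr_emitNat' hP hA k dn _)
    (Tr.cons (tr_emitNat' hP hC _ _ _) (.nil ?_)))
  simp [Gate.encode]

theorem emits_floorDiv (hP : 2 ≤ P) {d A : Expr} {s : St} {x a : ℕ} (hd : d.Good P s x)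
    (hA : A.Good P s a) : Emits P (emitBin .floorDiv d A) s (.floorDiv x a) := fun k dn out => by
  refine Tr.cons (Tr.write _ (s.scr k dn out)) (Tr.cons (tr_emitNat' hP hd k dn _)
    (Tr.cons (tr_emitNat' hP hA _ _ _) (.nil ?_)))
  simp [Gate.encode]

theorem tr_emitConst (b : Bool) (s : St) : Tr P (emitConst b) s
    {s with out := (Gate.linear [] (if b then 1 else 0)).encode.reverse ++ s.out} := by
  refine (Tr.write _ _).of_eq ?_
  cases b <;> simp [Gate.encode, encodeInt, encodeNat]

/-- Runs `c` for `K = 0, …, N - 1`, and advances the number `W` of the next wire by `N`. -/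
def row (c : Cmd) : Cmd := block [
  assign .K 0, assign .k 0, assign .dn 0,
  loop .N (block [c, assign .K (Var.K + 1)]),
  assign .W (Var.W + Var.N)]

end Cmd

/-- The memory after writing a row of gates. -/
@[simps]
def St.addRow (s : St) (g : ℕ → Gate) : St :=
  {s with
    K := s.N, k := 0, dn := 0, W := s.W + s.N
    out := ((gateRow s.N g).flatMap Gate.encode).reverse ++ s.out}

namespace Cmd

variable {P : ℕ}

theorem tr_row {c : Cmd} {s : St} {g : ℕ → Gate} (h : ∀ K < s.N, Emits P c {s with K := K} (g K))
    (hW : s.W + s.N ≤ P) : Tr P (row c) s (s.addRow g) := by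
  refine Tr.of_le fun hs => ?_
  have hN : s.N ≤ P := hs .N
  refine Tr.cons (.assign (by decide) fun _ => by simp) (Tr.cons (.assign (by decide) fun _ => by simp)
    (Tr.cons (.assign (by decide) fun _ => by simp) (Tr.cons (.loop rfl (TrN.of_seq
      (fun i => {s with
        K := i, k := 0, dn := 0
        out := ((gateRow i g).flatMap Gate.encode).reverse ++ s.out}) fun i hi => ?_))
      (Tr.cons (.assign (by decide) fun _ => ?_) (.nil ?_)))))
  · replace hi : i < s.N := hi
    refine Tr.cons (h i hi 0 0 _) (Tr.cons (.assign (by decide) fun _ => ?_) (.nil ?_))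
    · simp [St.get, St.scr]
      omega
    · simp [St.get, St.set, St.scr, gateRow, List.range_succ]
  · simpa [St.get, St.set] using hW
  · simp [St.get, St.set, St.addRow]

end Cmd

/-- The gates `G` of a circuit with `n` inputs have been written, after a header `h`, and `W` is the
number of the next wire. -/
structure Built (n : ℕ) (h : List Sym) (G : List Gate) (s : St) : Prop where
  out : s.out = (h ++ G.flatMap Gate.encode).reverse
  W : s.W = n + G.length
  wf : WF n G

theorem Built.addRow {n : ℕ} {h : List Sym} {G : List Gate} {s : St} (hb : Built n h G s)
    {g : ℕ → Gate} (hg : ∀ K < s.N, (g K).WellFormed s.W) :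
    Built n h (G ++ gateRow s.N g) (s.addRow g) where
  out := by simp [hb.out]
  W := by simp [hb.W, add_assoc]
  wf := hb.wf.append_row fun K hK => hb.W ▸ hg K hK

theorem Built.wire_row {n : ℕ} {h : List Sym} {G : List Gate} {s : St} (hb : Built n h G s)
    {g : ℕ → Gate} (hg : ∀ K < s.N, (g K).WellFormed s.W) (x : Fin n → ℤ) {K : ℕ} (hK : K < s.N) :
    wire (G ++ gateRow s.N g) x (s.W + K) = (g K).eval (wire G x) := by
  rw [hb.W]
  exact PFnS.wire_row hb.wf (fun K hK => hb.W ▸ hg K hK) x hK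

/-! ### Reading numbers -/

namespace Cmd

variable {P : ℕ}

/-- Reads a bit of a number. -/
def readBit : Cmd := ifz .dn (pop .inp fun o => match o with
  | some (.bit true) => block [assign .p (Var.p + Var.pw), assign .pw (Var.pw + Var.pw)]
  | some (.bit false) => assign .pw (Var.pw + Var.pw)
  | _ => assign .dn 1) skip

/-- Reads a natural number in binary into the register `p`. -/
def readNat : Cmd := block [assign .p 0, assign .pw 1, assign .dn 0, loopS .inp readBit,
  assign .pw 0, assign .dn 0]

/-- Reads an integer as the difference of the registers `p` and `q`. -/
def readInt : Cmd := pop .inp fun o => match o with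
  | some (.sign false) => block [readNat, assign .q 0]
  | some (.sign true) => block [readNat, assign .q Var.p, assign .p 0]
  | _ => skip

/-- Each round reads a bit of weight `pw` and adds it to `p`; after the end of the number, which is
signalled by `dn`, nothing happens any more. -/
theorem trN_readBit (hP : 1 ≤ P) : ∀ (l x : ℕ) (s : St) (rest : List Sym),
    s.inp = encodeNat x ++ rest → s.dn = 0 →
    (encodeNat x).length ≤ l → s.pw * 2 ^ x.bits.length ≤ P → s.p + s.pw * x ≤ P →
    TrN P readBit l s
      {s with p := s.p + s.pw * x, pw := s.pw * 2 ^ x.bits.length, dn := 1, inp := rest} := by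
  intro l
  induction l with
  | zero => intro x s rest _ _ hl; simp [encodeNat] at hl
  | succ l ih =>
    intro x s rest hi hd hl hw hp
    rcases Nat.eq_zero_or_pos x with rfl | hx
    · have hi' : s.inp = Sym.mark :: rest := by simpa [encodeNat] using hi
      refine TrN.succ (s' := {s with dn := 1, inp := rest}) (.ifz_pos hd (.pop (some .mark)
        (by simp [St.getS, hi']) (Tr.of_le fun hs => ?_))) ((TrN.const ?_).of_eq (by simp))
      · refine (Tr.assign (by decide) fun _ => ?_).of_eq (by simp [St.set, St.setS, St.getS, hi'])
        have := hs .pw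
        have := hs .p
        simpa using hP
      · exact .ifz_neg (by simp [St.get]) .skip
    · have hb := bits_of_pos hx
      have hi' : s.inp = Sym.bit (decide (x % 2 = 1)) :: (encodeNat (x / 2) ++ rest) := by
        simpa [encodeNat, hb] using hi
      have hpw : s.pw * 2 ^ x.bits.length = (s.pw + s.pw) * 2 ^ (x / 2).bits.length := by
        rw [hb, List.length_cons, pow_succ]; ring
      have hpp : s.p + s.pw * x = (s.p + (x % 2) * s.pw) + (s.pw + s.pw) * (x / 2) := by
        conv_lhs => rw [← Nat.mod_add_div x 2]
        ring
      have hl' : (encodeNat (x / 2)).length ≤ l := by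
        simp only [encodeNat, List.length_append, List.length_map, hb, List.length_cons] at hl ⊢
        omega
      have hw2 : s.pw + s.pw ≤ P := by
        refine le_trans ?_ (hpw ▸ hw)
        exact Nat.le_mul_of_pos_right _ (by positivity)
      have := ih (x / 2) {s with
        p := s.p + (x % 2) * s.pw, pw := s.pw + s.pw, inp := encodeNat (x / 2) ++ rest} rest rfl hd hl'
        (hpw ▸ hw) (hpp ▸ hp)
      refine TrN.succ ?_ (this.of_eq (by simp only [hpw, hpp]))
      refine .ifz_pos hd (.pop (some (.bit (decide (x % 2 = 1)))) (by simp [St.getS, hi']) ?_)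
      rcases Nat.mod_two_eq_zero_or_one x with h | h
      · simp only [h, Nat.zero_ne_one, decide_false]
        exact (Tr.assign (by decide) fun _ => by simpa [St.get, St.setS] using hw2).of_eq
          (by simp [St.set, St.get, St.setS, St.getS, hi'])
      · simp only [h, decide_true]
        refine Tr.cons (.assign (by decide) fun _ => ?_)
          (Tr.cons (.assign (by decide) fun _ => by simpa [St.get, St.set, St.setS] using hw2)
            (.nil (by simp [St.set, St.get, St.setS, St.getS, hi'])))
        have : s.pw ≤ s.pw * x := Nat.le_mul_of_pos_right _ hx
        simp [St.get, St.setS]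
        omega

/-- A number is less than a power of two with an exponent that is less than the length of its string. -/
theorem lt_two_pow_length (x : ℕ) : x < 2 ^ x.bits.length := by
  have := Nat.lt_size_self x
  simpa [Nat.size_eq_bits_len] using this

theorem tr_readNat {s : St} {x : ℕ} {rest : List Sym} (hi : s.inp = encodeNat x ++ rest)
    (hP : 2 ^ s.inp.length ≤ P) :
    Tr P readNat s {s with p := x, pw := 0, dn := 0, inp := rest} := by
  have hlen : x.bits.length + 1 ≤ s.inp.length := by
    rw [hi]; simp [encodeNat]
  have h₁ : 2 ^ x.bits.length ≤ P :=
    (Nat.pow_le_pow_right (by norm_num) (by omega)).trans hP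
  have h₂ := lt_two_pow_length x
  refine Tr.cons (.assign (by decide) fun _ => by simp) (Tr.cons (.assign (by decide) fun _ => ?_)
    (Tr.cons (.assign (by decide) fun _ => by simp) (Tr.cons (.loopS rfl ?_
      (trN_readBit (Nat.one_le_two_pow.trans h₁) _ x _ rest
      hi rfl ?_ ?_ ?_)) (Tr.cons (.assign (by decide) fun _ => by simp)
      (Tr.cons (.assign (by decide) fun _ => by simp) (.nil ?_))))))
  · exact Nat.one_le_two_pow.trans h₁
  · exact (Nat.lt_two_pow_self.le).trans hP
  · change _ ≤ s.inp.length
    rw [hi]; simp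
  · simpa [St.set] using h₁
  · simpa [St.set] using h₂.le.trans h₁
  · simp [St.set]

theorem tr_readInt {s : St} {z : ℤ} {rest : List Sym} (hi : s.inp = encodeInt z ++ rest)
    (hP : 2 ^ s.inp.length ≤ P) :
    Tr P readInt s {s with p := z.toNat, q := (-z).toNat, pw := 0, dn := 0, inp := rest} := by
  have hi' : s.inp = Sym.sign (decide (z < 0)) :: (encodeNat z.natAbs ++ rest) := by
    simpa [encodeInt] using hi
  have hP' : 2 ^ (encodeNat z.natAbs ++ rest).length ≤ P :=
    (Nat.pow_le_pow_right (by norm_num) (by rw [hi']; simp)).trans hP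
  refine .pop (some (.sign (decide (z < 0)))) (by simp [St.getS, hi']) ?_
  have e : s.setS .inp (s.getS .inp).tail = {s with inp := encodeNat z.natAbs ++ rest} := by
    simp [St.setS, St.getS, hi']
  rw [e]
  by_cases hz : z < 0
  · simp only [hz, decide_true]
    refine Tr.cons (tr_readNat rfl hP') (Tr.cons (.assign (by decide) fun _ => by simp)
      (Tr.cons (.assign (by decide) fun _ => by simp) (.nil ?_)))
    have h₁ : z.toNat = 0 := by omega
    have h₂ : (-z).toNat = z.natAbs := by omega
    simp [St.set, St.get, h₁, h₂]
  · simp only [hz, decide_false]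
    refine Tr.cons (tr_readNat rfl hP') (Tr.cons (.assign (by decide) fun _ => by simp) (.nil ?_))
    have h₁ : z.toNat = z.natAbs := by omega
    have h₂ : (-z).toNat = 0 := by omega
    simp [St.set, h₁, h₂]

end Cmd

/-! ### Memory predicates -/

namespace Cmd

/-- Started in the memory `s`, the program `c` leads to a memory with the property `R`, and if the
registers are at most `P` at the beginning, then no number larger than `P` occurs. -/
def Run (P : ℕ) (c : Cmd) (s : St) (R : St → Prop) : Prop :=
  s.Le P → c.Ok P s ∧ R (c.run s) ∧ (c.run s).Le P

section Rules

variable {P : ℕ} {c : Cmd} {l : List Cmd} {s s' : St} {R R' : St → Prop}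

theorem Tr.toRun (h : Tr P c s s') (hR : R s') : Run P c s R := fun hs => by
  obtain ⟨h₁, rfl, h₂⟩ := h hs
  exact ⟨h₁, hR, h₂⟩

theorem Run.nil (h : R s) : Run P (block []) s R := Tr.toRun (.nil rfl) h

theorem Run.cons (h₁ : Run P c s R) (h₂ : ∀ t, R t → Run P (block l) t R') :
    Run P (block (c :: l)) s R' := fun hs => by
  obtain ⟨a₁, b₁, c₁⟩ := h₁ hs
  obtain ⟨a₂, b₂, c₂⟩ := h₂ _ b₁ c₁
  exact ⟨⟨a₁, a₂⟩, b₂, c₂⟩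

theorem Tr.run_cons (h₁ : Tr P c s s') (h₂ : Run P (block l) s' R) :
    Run P (block (c :: l)) s R :=
  .cons (Tr.toRun (R := fun t => t = s') h₁ rfl) fun _ ht => ht ▸ h₂

theorem Run.assign {v : Var} {e : Expr} (x : ℕ) (hd : e.depth ≤ 16) (hb : s.Le P → e.Bdd P s)
    (hx : e.eval s = x) (h : Run P (block l) (s.set v x) R) :
    Run P (block (.assign v e :: l)) s R :=
  (Tr.assign hd hb).run_cons (hx ▸ h)

theorem Run.loop {v : Var} {k : ℕ} (hk : s.get v = k) (R : ℕ → St → Prop) (h0 : R 0 s)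
    (hs : ∀ i < k, ∀ t, R i t → Run P c t (R (i + 1))) : Run P (.loop v c) s (R k) := by
  subst hk
  intro hle
  have key : ∀ i ≤ s.get v, (∀ j < i, c.Ok P (c.run^[j] s)) ∧ R i (c.run^[i] s) ∧
      St.Le P (c.run^[i] s) := by
    intro i
    induction i with
    | zero => exact fun _ => ⟨by simp, h0, hle⟩
    | succ i ih =>
      intro hi
      obtain ⟨h₁, h₂, h₃⟩ := ih (by omega)
      obtain ⟨g₁, g₂, g₃⟩ := hs i (by omega) _ h₂ h₃
      rw [Function.iterate_succ_apply']
      refine ⟨fun j hj => ?_, g₂, g₃⟩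
      rcases Nat.lt_succ_iff_lt_or_eq.mp hj with h | rfl
      · exact h₁ j h
      · exact g₁
  exact key _ le_rfl

end Rules
end Cmd

/-- The numbers of variables, the bound on coefficients, the number of candidates, and a bound on the
number of wires. -/
structure Par : Type where
  n : ℕ
  m : ℕ
  H : ℕ
  N : ℕ
  B : ℕ

/-- The number of values of a coefficient. -/
def Par.Q (κ : Par) : ℕ := 2 * κ.H + 1

/-- Registers with fixed values during the generation of the gates. -/
def Var.Fixed : Var → Bool
  | .n | .m | .H | .Q | .N | .B | .n₁ | .W => true
  | _ => false

/-- The registers have the values given by `κ`, and the gates `G` have been written, which begin with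
the constants one and zero. -/
structure Inv (κ : Par) (G : List Gate) (s : St) : Prop where
  built : Built κ.n (encodeNat κ.n ++ encodeNat κ.m) G s
  n : s.n = κ.n
  m : s.m = κ.m
  H : s.H = κ.H
  Q : s.Q = κ.Q
  N : s.N = κ.N
  B : s.B = κ.B
  n₁ : s.n₁ = κ.n + 1
  one : ∀ x : Fin κ.n → ℤ, wire G x κ.n = 1
  zero : ∀ x : Fin κ.n → ℤ, wire G x (κ.n + 1) = 0
  len : κ.n + 2 ≤ s.W

/-- The wires `A, A + 1, …, A + N - 1` carry the values `F`. -/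
def IsRow (κ : Par) (G : List Gate) (A : ℕ) (F : (Fin κ.n → ℤ) → ℕ → ℤ) : Prop :=
  A + κ.N ≤ κ.n + G.length ∧ ∀ x, ∀ K < κ.N, wire G x (A + K) = F x K

theorem IsRow.mono {κ : Par} {G G' : List Gate} {A : ℕ} {F : (Fin κ.n → ℤ) → ℕ → ℤ}
    (h : IsRow κ G A F) (hG : G <+: G') : IsRow κ G' A F := by
  obtain ⟨E, rfl⟩ := hG
  refine ⟨by have := h.1; simp; omega, fun x K hK => ?_⟩
  rw [wire_append _ _ _ (by have := h.1; omega)]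
  exact h.2 x K hK

namespace Inv

variable {κ : Par} {G : List Gate} {s : St}

theorem set (h : Inv κ G s) {v : Var} (hv : v.Fixed = false) (x : ℕ) : Inv κ G (s.set v x) := by
  cases v <;> first
    | exact absurd hv (by decide)
    | exact {h with built := {h.built with}}

theorem with_inp (h : Inv κ G s) (l : List Sym) : Inv κ G {s with inp := l} :=
  {h with built := {h.built with}}

theorem with_skel (h : Inv κ G s) (l : List Sym) : Inv κ G {s with skel := l} :=
  {h with built := {h.built with}}

/-- A row of gates that compute the values `F` may be written, and the invariant is preserved. -/
theorem row {P : ℕ} {c : Cmd} {l : List Cmd} {R : St → Prop} {g : ℕ → Gate} (h : Inv κ G s)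
    (F : (Fin κ.n → ℤ) → ℕ → ℤ) (he : ∀ K < κ.N, Cmd.Emits P c {s with K := K} (g K))
    (hg : ∀ K < κ.N, (g K).WellFormed s.W)
    (hF : ∀ x, ∀ K < κ.N, (g K).eval (wire G x) = F x K) (hP : s.W + κ.N ≤ P)
    (hR : ∀ G', G <+: G' → Inv κ G' (s.addRow g) → IsRow κ G' s.W F →
      Cmd.Run P (Cmd.block l) (s.addRow g) R) : Cmd.Run P (Cmd.block (Cmd.row c :: l)) s R := by
  have hN := h.N
  rw [← hN] at he hg hP
  have hl := h.built.W
  have hlen := h.len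
  refine (Cmd.tr_row he hP).run_cons (hR _ (List.prefix_append G (gateRow s.N g)) ?_ ?_)
  · refine ⟨h.built.addRow hg, h.n, h.m, h.H, h.Q, h.N, h.B, h.n₁, fun x => ?_, fun x => ?_, ?_⟩
    · rw [wire_append _ _ _ (by omega), h.one]
    · rw [wire_append _ _ _ (by omega), h.zero]
    · simp; omega
  · refine ⟨by simp [hl, hN]; omega, fun x K hK => ?_⟩
    rw [h.built.wire_row hg x (hN ▸ hK), hF x K hK]

theorem row_lin {P : ℕ} {l : List Cmd} {R : St → Prop} {A p q C : Expr} {α β γ δ : ℕ → ℕ}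
    (h : Inv κ G s) (F : (Fin κ.n → ℤ) → ℕ → ℤ)
    (hA : ∀ K < κ.N, A.Good P {s with K := K} (α K))
    (hp : ∀ K < κ.N, p.Good P {s with K := K} (β K))
    (hq : ∀ K < κ.N, q.Good P {s with K := K} (γ K))
    (hC : ∀ K < κ.N, C.Good P {s with K := K} (δ K))
    (hlt : ∀ K < κ.N, α K < s.W ∧ δ K < s.W)
    (hF : ∀ x, ∀ K < κ.N, wire G x (α K) + ((β K : ℤ) - γ K) * wire G x (δ K) = F x K)
    (hP2 : 2 ≤ P) (hP : s.W + κ.N ≤ P)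
    (hR : ∀ g G', G <+: G' → Inv κ G' (s.addRow g) → IsRow κ G' s.W F →
      Cmd.Run P (Cmd.block l) (s.addRow g) R) :
    Cmd.Run P (Cmd.block (Cmd.row (Cmd.emitLin A p q C) :: l)) s R := by
  refine h.row F (fun K hK => Cmd.emits_lin hP2 (hA K hK) (hp K hK) (hq K hK) (hC K hK))
    (fun K hK t ht => ?_) (fun x K hK => ?_) hP (hR _)
  · simp only [List.mem_cons, List.not_mem_nil, or_false] at ht
    rcases ht with rfl | rfl
    · exact (hlt K hK).1
    · exact (hlt K hK).2
  · simpa [Cmd.linGate, Gate.eval] using hF x K hK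

theorem row_max {P : ℕ} {l : List Cmd} {R : St → Prop} {A C : Expr} {α δ : ℕ → ℕ}
    (h : Inv κ G s) (F : (Fin κ.n → ℤ) → ℕ → ℤ)
    (hA : ∀ K < κ.N, A.Good P {s with K := K} (α K))
    (hC : ∀ K < κ.N, C.Good P {s with K := K} (δ K))
    (hlt : ∀ K < κ.N, α K < s.W ∧ δ K < s.W)
    (hF : ∀ x, ∀ K < κ.N, max (wire G x (α K)) (wire G x (δ K)) = F x K)
    (hP2 : 2 ≤ P) (hP : s.W + κ.N ≤ P)
    (hR : ∀ g G', G <+: G' → Inv κ G' (s.addRow g) → IsRow κ G' s.W F →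
      Cmd.Run P (Cmd.block l) (s.addRow g) R) :
    Cmd.Run P (Cmd.block (Cmd.row (Cmd.emitBin .maximum A C) :: l)) s R :=
  h.row F (fun K hK => Cmd.emits_maximum hP2 (hA K hK) (hC K hK)) hlt hF hP (hR _)

theorem row_zeroCond {P : ℕ} {l : List Cmd} {R : St → Prop} {A C : Expr} {α δ : ℕ → ℕ}
    (h : Inv κ G s) (F : (Fin κ.n → ℤ) → ℕ → ℤ)
    (hA : ∀ K < κ.N, A.Good P {s with K := K} (α K))
    (hC : ∀ K < κ.N, C.Good P {s with K := K} (δ K))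
    (hlt : ∀ K < κ.N, α K < s.W ∧ δ K < s.W)
    (hF : ∀ x, ∀ K < κ.N, (if wire G x (α K) = 0 then wire G x (δ K) else 0) = F x K)
    (hP2 : 2 ≤ P) (hP : s.W + κ.N ≤ P)
    (hR : ∀ g G', G <+: G' → Inv κ G' (s.addRow g) → IsRow κ G' s.W F →
      Cmd.Run P (Cmd.block l) (s.addRow g) R) :
    Cmd.Run P (Cmd.block (Cmd.row (Cmd.emitBin .zeroCond A C) :: l)) s R :=
  h.row F (fun K hK => Cmd.emits_zeroCond hP2 (hA K hK) (hC K hK)) hlt hF hP (hR _)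

theorem row_div {P : ℕ} {l : List Cmd} {R : St → Prop} {d A : Expr} {α δ : ℕ → ℕ}
    (h : Inv κ G s) (F : (Fin κ.n → ℤ) → ℕ → ℤ)
    (hd : ∀ K < κ.N, d.Good P {s with K := K} (δ K))
    (hA : ∀ K < κ.N, A.Good P {s with K := K} (α K))
    (hlt : ∀ K < κ.N, 0 < δ K ∧ α K < s.W)
    (hF : ∀ x, ∀ K < κ.N, Int.fdiv (wire G x (α K)) (δ K) = F x K)
    (hP2 : 2 ≤ P) (hP : s.W + κ.N ≤ P)
    (hR : ∀ g G', G <+: G' → Inv κ G' (s.addRow g) → IsRow κ G' s.W F →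
      Cmd.Run P (Cmd.block l) (s.addRow g) R) :
    Cmd.Run P (Cmd.block (Cmd.row (Cmd.emitBin .floorDiv d A) :: l)) s R :=
  h.row F (fun K hK => Cmd.emits_floorDiv hP2 (hd K hK) (hA K hK)) hlt hF hP (hR _)

end Inv

/-! ### The candidates -/

/-- The values of the inputs, and the constant one. -/
def inputVal {n : ℕ} (x : Fin n → ℤ) (i : ℕ) : ℤ := if h : i < n then x ⟨i, h⟩ else 1

/-- The digit of `K` at position `e` in base `Q`. -/
def Par.digit (κ : Par) (K e : ℕ) : ℕ := K / κ.Q ^ e % κ.Q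

/-- The `j`-th component of candidate `K`, an affine function of `x` that is divided by a positive
number and rounded down. The coefficients and the denominator are read from the digits of `K`. -/
def Par.cand (κ : Par) (j : ℕ) (x : Fin κ.n → ℤ) (K : ℕ) : ℤ :=
  Int.fdiv (∑ i ∈ Finset.range (κ.n + 1),
    ((κ.digit K (j * (κ.n + 2) + i) : ℤ) - κ.H) * inputVal x i)
    (κ.digit K (j * (κ.n + 2) + (κ.n + 1)) + 1 : ℕ)

theorem Inv.wire_input {κ : Par} {G : List Gate} {s : St} (h : Inv κ G s) (x : Fin κ.n → ℤ) {i : ℕ}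
    (hi : i ≤ κ.n) : wire G x i = inputVal x i := by
  unfold inputVal
  split
  · exact PFnS.wire_input G x ⟨i, _⟩
  · rw [show i = κ.n by omega, h.one]

/-- The first wire of the row that carries the `j`-th component of the candidates. -/
def Par.yAddr (κ : Par) (j : ℕ) : ℕ := κ.n + 2 + κ.N * (κ.n + 2) + j * (κ.N * (κ.n + 3))

namespace Cmd

/-- Writes a row of zeros. -/
def rowZero : Cmd := row (emitLin Var.n₁ 0 0 Var.n₁)

/-- The last row. -/
def lastRow : Expr := Var.W - Var.N + Var.K

/-- Writes the rows that compute a component of all candidates. -/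
def candidate : Cmd := block [rowZero, assign .i 0,
  loop .n₁ (block [row (emitLin lastRow (Var.K / Var.D % Var.Q) Var.H Var.i),
    assign .D (Var.D * Var.Q), assign .i (Var.i + 1)]),
  row (emitBin .floorDiv (Var.K / Var.D % Var.Q + 1) lastRow), assign .D (Var.D * Var.Q)]

variable {κ : Par} {G : List Gate} {s : St} {P : ℕ}

theorem good_var {v : Var} (hv : Expr.Fresh v) {s : St} : (v : Expr).Good P s (s.get v) :=
  ⟨hv, by change 1 ≤ 14; norm_num, fun _ => trivial, rfl⟩

theorem good_zero {s : St} : (0 : Expr).Good P s 0 :=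
  ⟨trivial, by change 1 ≤ 14; norm_num, fun _ => Nat.zero_le _, rfl⟩

theorem good_offset {v : Var} (hv : v ≠ .k ∧ v ≠ .dn ∧ v ≠ .K) {K : ℕ} (h : s.get v + K ≤ P) :
    ((v : Expr) + Var.K : Expr).Good P {s with K := K} (s.get v + K) := by
  have : St.get {s with K := K} v = s.get v := by cases v <;> simp_all [St.get]
  refine ⟨⟨⟨hv.1, hv.2.1⟩, by decide⟩, by change max 1 2 ≤ 14; norm_num, fun _ => ?_, ?_⟩
  · simp only [Expr.bdd_add, Expr.bdd_var, true_and, Expr.eval_var, this]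
    exact h
  · simp only [Expr.eval_add, Expr.eval_var, this]
    rfl

theorem _root_.PFnS.Inv.good_lastRow (h : Inv κ G s) {K : ℕ} (hK : K < κ.N) (hN : κ.N ≤ s.W)
    (hP : s.W ≤ P) : lastRow.Good P {s with K := K} (s.W - κ.N + K) := by
  have := h.N
  refine ⟨by decide, by decide, fun _ => ?_, ?_⟩
  · simp [lastRow, St.get]; omega
  · simp [lastRow, St.get]; omega

theorem _root_.PFnS.Inv.rowZero (h : Inv κ G s) {l : List Cmd} {R : St → Prop} (hP : s.W + κ.N ≤ P)
    (hR : ∀ g G', G <+: G' → Inv κ G' (s.addRow g) → IsRow κ G' s.W (fun _ _ => 0) →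
      Run P (block l) (s.addRow g) R) : Run P (block (rowZero :: l)) s R := by
  have := h.len
  have := h.n₁
  refine h.row_lin _ (fun K _ => good_var (by decide)) (fun K _ => good_zero)
    (fun K _ => good_zero) (fun K _ => good_var (by decide)) (fun K _ => ?_) (fun x K _ => ?_)
    (by omega) hP hR
  · change s.n₁ < _ ∧ s.n₁ < _
    omega
  · change wire G x s.n₁ + _ = _
    rw [h.n₁, h.zero]; simp

theorem _root_.PFnS.Inv.good_digit (h : Inv κ G s) {K e : ℕ} (hD : s.D = κ.Q ^ e) :
    (Var.K / Var.D % Var.Q : Expr).Good P {s with K := K} (κ.digit K e) := by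
  have hQ := h.Q
  have hQ0 : 0 < κ.Q := by simp [Par.Q]
  refine ⟨by decide, by decide, fun hs => ?_, ?_⟩
  · have e : ∀ s : St, (Var.K / Var.D % Var.Q : Expr).Bdd P s ↔
        (Var.K / Var.D % Var.Q : Expr).Bdd P (s.scr 0 0 []) :=
      fun s => (Expr.bdd_fresh (by decide) _ _ _ _ _).symm
    rw [e, Expr.bdd_mod _ _ _ _ hs]
    simp only [Expr.bdd_div, Expr.bdd_var, Expr.eval_var, true_and]
    simp only [St.get, St.scr, hD, hQ]
    exact ⟨by positivity, hQ0⟩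
  · simp [St.get, hD, hQ, Par.digit]

/-- The memory before writing the rows of component `j` of the candidates. -/
def CandInv (κ : Par) (s₀ : St) (j : ℕ) (s : St) : Prop :=
  ∃ G, Inv κ G s ∧ s.W = κ.n + 2 + κ.N * ((κ.n + 3) * j) ∧ s.D = κ.Q ^ (j * (κ.n + 2)) ∧
    (∀ j' < j, IsRow κ G (κ.yAddr j') (κ.cand j')) ∧
    s.inp = s₀.inp ∧ s.skel = s₀.skel ∧ s.S = s₀.S ∧ s.T = s₀.T

/-- The rows for component `j` of the candidates: partial sums of the affine function, then the
quotient. -/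
theorem run_candidate {s₀ : St} {j : ℕ} (hj : j < κ.m) (hN : κ.N = κ.Q ^ (κ.m * (κ.n + 2)))
    (hP : κ.n + 2 + κ.N * ((κ.n + 3) * κ.m) ≤ P) (h : CandInv κ s₀ j s) :
    Run P candidate s (CandInv κ s₀ (j + 1)) := by
  obtain ⟨G, hI, hW, hD, hy, h₁, h₂, h₃, h₄⟩ := h
  have hQ0 : 0 < κ.Q := by simp [Par.Q]
  have hN0 : 0 < κ.N := by rw [hN]; positivity
  have hP' : κ.n + 2 + κ.N * ((κ.n + 3) * j) + κ.N * (κ.n + 3) ≤ P := by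
    refine le_trans ?_ hP
    have : κ.N * ((κ.n + 3) * (j + 1)) ≤ κ.N * ((κ.n + 3) * κ.m) := by gcongr; omega
    nlinarith
  have hDle : ∀ i ≤ κ.n + 2, κ.Q ^ (j * (κ.n + 2) + i) ≤ P := fun i hi => by
    have : κ.Q ^ (j * (κ.n + 2) + i) ≤ κ.N := by
      rw [hN]
      refine Nat.pow_le_pow_right hQ0 ?_
      nlinarith
    nlinarith
  have hNn : ∀ i ≤ κ.n + 2, s.W + κ.N * i + κ.N ≤ P := fun i hi => by
    have : κ.N * i ≤ κ.N * (κ.n + 2) := by gcongr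
    rw [hW]; nlinarith
  have hP2 : 2 ≤ P := by omega
  refine hI.rowZero (by simpa using hNn 0 (by omega)) fun g G₁ hE hI' hrow => ?_
  refine Run.assign 0 (by decide) (fun _ => by simp) rfl ?_
  refine Run.cons (Run.loop (k := κ.n + 1) (by exact hI'.n₁) (fun i t => ∃ G', Inv κ G' t ∧
      t.W = s.W + κ.N * (i + 1) ∧ t.D = κ.Q ^ (j * (κ.n + 2) + i) ∧ t.i = i ∧
      (∀ j' < j, IsRow κ G' (κ.yAddr j') (κ.cand j')) ∧
      IsRow κ G' (t.W - κ.N) (fun x K => ∑ i ∈ Finset.range i,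
        ((κ.digit K (j * (κ.n + 2) + i) : ℤ) - κ.H) * inputVal x i) ∧
      t.inp = s₀.inp ∧ t.skel = s₀.skel ∧ t.S = s₀.S ∧ t.T = s₀.T) ?_ ?_) ?_
  · refine ⟨G₁, hI'.set rfl 0, ?_, ?_, rfl, fun j' hj' => (hy j' hj').mono hE, ?_, h₁, h₂, h₃, h₄⟩
    · simp [St.set, hI.N]
    · simpa [St.set] using hD
    · simpa [St.set, hI.N] using hrow
  · rintro i hi t ⟨G', hJ, hW', hD', hi', hy', hr, g₁, g₂, g₃, g₄⟩
    have hWP : t.W + κ.N ≤ P := by rw [hW']; exact hNn (i + 1) (by omega)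
    have hlen := hJ.len
    have hWN : κ.N ≤ t.W := by rw [hW', mul_add]; omega
    refine hJ.row_lin _ (fun K hK => hJ.good_lastRow hK hWN (by omega))
      (fun K _ => hJ.good_digit hD') (fun K _ => good_var (by decide))
      (fun K _ => good_var (by decide)) (fun K hK => ?_) (fun x K hK => rfl) hP2 hWP
      fun g G₂ hE' hJ' hrow' => ?_
    · change _ ∧ t.i < _
      omega
    · refine Run.assign (κ.Q ^ (j * (κ.n + 2) + (i + 1))) (by decide) (fun _ => ?_) ?_ ?_
      · simp only [Expr.bdd_mul, Expr.bdd_var, true_and, Expr.eval_var]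
        simp only [St.get, St.addRow_D, St.addRow_Q, hD', hJ.Q, ← pow_succ]
        exact hDle (i + 1) (by omega)
      · simp only [Expr.eval_mul, Expr.eval_var]
        simp only [St.get, St.addRow_D, St.addRow_Q, hD', hJ.Q, ← pow_succ]
        rfl
      · refine Run.assign (i + 1) (by decide) (fun _ => ?_) ?_ (Run.nil ?_)
        · simp [St.get, St.set, hi']; omega
        · simp [St.get, St.set, hi']
        · refine ⟨_, (hJ'.set rfl _).set rfl _, ?_, rfl, rfl,
            fun j' hj' => (hy' j' hj').mono hE', ?_, g₁, g₂, g₃, g₄⟩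
          · simp [St.set, hJ.N, hW']; ring
          · have : t.W + t.N - κ.N = t.W := by rw [hJ.N]; omega
            simp only [St.set, St.addRow_W, this]
            refine ⟨hrow'.1, fun x K hK => ?_⟩
            rw [hrow'.2 x K hK]
            beta_reduce
            rw [Finset.sum_range_succ, hr.2 x K hK]
            congr 2
            · change _ - ((t.H : ℕ) : ℤ) = _
              rw [hJ.H]
            · change wire G' x t.i = _
              rw [hi', hJ.wire_input x (by omega)]
  · rintro t ⟨G', hJ, hW', hD', hi', hy', hr, g₁, g₂, g₃, g₄⟩
    have hWP : t.W + κ.N ≤ P := by rw [hW']; exact hNn (κ.n + 2) (by omega)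
    have hWN : κ.N ≤ t.W := by rw [hW', mul_add]; omega
    have hdig : ∀ K, κ.digit K (j * (κ.n + 2) + (κ.n + 1)) + 1 ≤ P := fun K => by
      have : κ.digit K (j * (κ.n + 2) + (κ.n + 1)) < κ.Q := Nat.mod_lt _ hQ0
      have hQP : κ.Q ≤ κ.N := by
        rw [hN]; exact Nat.le_self_pow (by have : 0 < κ.m := by omega
                                           positivity) _
      omega
    refine hJ.row_div (κ.cand j) (δ := fun K => κ.digit K (j * (κ.n + 2) + (κ.n + 1)) + 1)
      (fun K hK => ?_) (fun K hK => hJ.good_lastRow hK hWN (by omega))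
      (fun K hK => ⟨by omega, by omega⟩) (fun x K hK => ?_) hP2 hWP fun g G₂ hE' hJ' hrow' => ?_
    · have h := hJ.good_digit (P := P) (K := K) hD'
      refine ⟨by decide, by decide, fun hs => ?_, ?_⟩
      · rw [Expr.bdd_add, h.eval]
        exact ⟨h.bdd hs, by simp; omega, hdig K⟩
      · rw [Expr.eval_add, h.eval]; rfl
    · rw [hr.2 x K hK]; rfl
    · refine Run.assign (κ.Q ^ (j * (κ.n + 2) + (κ.n + 2))) (by decide) (fun _ => ?_) ?_ (Run.nil ?_)
      · simp only [Expr.bdd_mul, Expr.bdd_var, true_and, Expr.eval_var]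
        simp only [St.get, St.addRow_D, St.addRow_Q, hD', hJ.Q, ← pow_succ]
        exact hDle (κ.n + 2) (by omega)
      · simp only [Expr.eval_mul, Expr.eval_var]
        simp only [St.get, St.addRow_D, St.addRow_Q, hD', hJ.Q, ← pow_succ]
        rfl
      · refine ⟨_, hJ'.set rfl _, ?_, ?_, fun j' hj' => ?_, g₁, g₂, g₃, g₄⟩
        · simp [St.set, hJ.N, hW', hW]; ring
        · simp only [St.set]; congr 1; ring
        · rcases Nat.lt_succ_iff_lt_or_eq.mp hj' with hlt | rfl
          · exact (hy' j' hlt).mono hE'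
          · have : t.W = κ.yAddr j' := by rw [hW', hW, Par.yAddr]; ring
            rwa [← this]

end Cmd

/-! ### The gates for a leaf of the formula -/

/-- The components of the candidates are available. -/
def CandRows (κ : Par) (G : List Gate) : Prop := ∀ j < κ.m, IsRow κ G (κ.yAddr j) (κ.cand j)

theorem CandRows.mono {κ : Par} {G G' : List Gate} (h : CandRows κ G) (hG : G <+: G') :
    CandRows κ G' := fun j hj => (h j hj).mono hG

/-- The two stacks of wires and the stack of connectives agree. -/
structure Frame (s t : St) : Prop where
  skel : t.skel = s.skel
  S : t.S = s.S
  T : t.T = s.T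

theorem Frame.trans {s t u : St} (h : Frame s t) (h' : Frame t u) : Frame s u :=
  ⟨h'.skel.trans h.skel, h'.S.trans h.S, h'.T.trans h.T⟩

namespace Cmd

/-- The wires of the first component of the candidates. -/
def yFirst : Expr := Var.n₁ + 1 + Var.N * (Var.n₁ + 1)

/-- Reads the coefficients of a linear form and writes the rows that compute its values for all
candidates. -/
def coeffs : Cmd := block [rowZero, assign .i 0,
  loop .n (block [readInt, row (emitLin lastRow Var.p Var.q Var.i), assign .i (Var.i + 1)]),
  assign .y yFirst,
  loop .m (block [readInt, row (emitLin lastRow Var.p Var.q (Var.y + Var.K)),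
    assign .y (Var.y + Var.N * (Var.n₁ + 2))])]

variable {κ : Par} {G : List Gate} {s : St} {P : ℕ}

theorem _root_.PFnS.Inv.readInt_row (h : Inv κ G s) {l : List Cmd} {R : St → Prop} {z : ℤ}
    {rest : List Sym} {C : Expr} {δ : ℕ → ℕ} {F F' : (Fin κ.n → ℤ) → ℕ → ℤ}
    (hi : s.inp = encodeInt z ++ rest) (hP : 2 ^ s.inp.length ≤ P) (hW : s.W + κ.N ≤ P)
    (hF : IsRow κ G (s.W - κ.N) F) (hN : κ.N ≤ s.W)
    (hC : ∀ t : St, t.i = s.i → t.y = s.y → t.n = s.n → ∀ K < κ.N, C.Good P {t with K := K} (δ K))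
    (hδ : ∀ K < κ.N, δ K < s.W)
    (hF' : ∀ x, ∀ K < κ.N, F x K + z * wire G x (δ K) = F' x K)
    (hR : ∀ t G', G <+: G' → Inv κ G' t → t.W = s.W + κ.N → t.inp = rest → t.i = s.i → t.y = s.y →
      Frame s t → 2 ^ t.inp.length ≤ P → IsRow κ G' (t.W - κ.N) F' → Run P (block l) t R) :
    Run P (block (readInt :: row (emitLin lastRow Var.p Var.q C) :: l)) s R := by
  have hlen := h.len
  refine (tr_readInt hi hP).run_cons ?_
  have hJ : Inv κ G {s with p := z.toNat, q := (-z).toNat, pw := 0, dn := 0, inp := rest} :=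
    {h with built := {h.built with}}
  refine hJ.row_lin F' (fun K hK => hJ.good_lastRow hK hN (by change s.W ≤ P; omega))
    (fun K _ => good_var (by decide))
    (fun K _ => good_var (by decide)) (hC _ rfl rfl rfl) (fun K hK => ⟨?_, hδ K hK⟩)
    (fun x K hK => ?_) (by omega) hW fun g G' hG hI' hr => ?_
  · change s.W - κ.N + K < s.W
    omega
  · change wire G x (s.W - κ.N + K) + ((z.toNat : ℤ) - (-z).toNat) * _ = _
    rw [hF.2 x K hK, Int.toNat_sub_toNat_neg, hF' x K hK]
  · refine hR _ G' hG hI' ?_ rfl rfl rfl ⟨rfl, rfl, rfl⟩ ?_ ?_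
    · simp [h.N]
    · refine le_trans (Nat.pow_le_pow_right (by norm_num) ?_) hP
      simp [hi]
    · have : s.W + s.N - κ.N = s.W := by rw [h.N]; omega
      simp only [St.addRow_W, this]
      exact hr

theorem _root_.PFnS.Par.lt_yAddr (κ : Par) (j : ℕ) : κ.yAddr j + κ.N * (κ.n + 3) = κ.yAddr (j + 1) := by
  simp only [Par.yAddr]; ring

theorem _root_.PFnS.Inv.eval_yFirst (h : Inv κ G s) : yFirst.eval s = κ.yAddr 0 := by
  simp [yFirst, St.get, h.n₁, h.N, Par.yAddr]

theorem _root_.PFnS.Inv.bdd_yFirst (h : Inv κ G s) (hP : κ.yAddr 0 ≤ P) : yFirst.Bdd P s := by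
  have h1 := h.n₁
  have h2 := h.N
  simp only [Par.yAddr, zero_mul, add_zero] at hP
  simp only [yFirst, Expr.bdd_add, Expr.bdd_var, Expr.bdd_one, Expr.bdd_mul, Expr.eval_var,
    Expr.eval_one, Expr.eval_add, Expr.eval_mul, true_and]
  simp only [St.get, h1, h2]
  refine ⟨⟨by omega, by omega⟩, ⟨⟨by omega, by omega⟩, ?_⟩, ?_⟩
  · linarith
  · linarith

theorem run_next_y {l : List Cmd} {R : St → Prop} {j : ℕ} (h : Inv κ G s) (hN0 : 0 < κ.N)
    (hP : κ.yAddr (j + 1) ≤ P)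
    (hy : s.y = κ.yAddr j) (hR : Inv κ G (s.set .y (κ.yAddr (j + 1))) →
      Run P (block l) (s.set .y (κ.yAddr (j + 1))) R) :
    Run P (block (assign .y (Var.y + Var.N * (Var.n₁ + 2)) :: l)) s R := by
  have h1 := h.n₁
  have h2 := h.N
  rw [← κ.lt_yAddr] at hP
  have h3 : κ.n + 2 ≤ κ.yAddr j := by simp only [Par.yAddr]; omega
  refine .assign _ (by decide) (fun _ => ?_) ?_ (hR (h.set rfl _))
  · simp only [Expr.bdd_add, Expr.bdd_var, Expr.bdd_two, Expr.bdd_mul, Expr.eval_var,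
      Expr.eval_two, Expr.eval_add, Expr.eval_mul, true_and]
    simp only [St.get, h1, h2, hy]
    have : κ.n + 3 ≤ κ.N * (κ.n + 3) := Nat.le_mul_of_pos_left _ hN0
    have e : κ.N * (κ.n + 1 + 2) = κ.N * (κ.n + 3) := by ring
    rw [e]
    omega
  · simp only [Expr.eval_add, Expr.eval_mul, Expr.eval_var, Expr.eval_two]
    simp only [St.get, h1, h2, hy, ← κ.lt_yAddr]

/-- The coefficient of variable number `i`. -/
def _root_.PFnS.coef {n : ℕ} (a : Fin n → ℤ) (i : ℕ) : ℤ := if h : i < n then a ⟨i, h⟩ else 0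

theorem drop_ofFn {n : ℕ} (a : Fin n → ℤ) {i : ℕ} (hi : i < n) :
    (List.ofFn a).drop i = coef a i :: (List.ofFn a).drop (i + 1) := by
  rw [List.drop_eq_getElem_cons (by simpa using hi)]
  simp [coef, hi]

/-- The row written last carries the values of the linear form at the candidates. -/
theorem run_coeffs (h : Inv κ G s) (hy : CandRows κ G) (hN0 : 0 < κ.N) {a : Fin κ.n → ℤ} {c : Fin κ.m → ℤ}
    {rest : List Sym} (hi : s.inp = encodeCoeffs a c ++ rest) (hP : 2 ^ s.inp.length ≤ P)
    (hW : s.W + κ.N * (κ.n + κ.m + 1) ≤ P) (hyP : κ.yAddr κ.m ≤ P) {l : List Cmd} {R : St → Prop}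
    (hR : ∀ t G', G <+: G' → Inv κ G' t → t.W = s.W + κ.N * (κ.n + κ.m + 1) → t.inp = rest →
      Frame s t → 2 ^ t.inp.length ≤ P →
      IsRow κ G' (t.W - κ.N) (fun x K => linForm a c x fun j => κ.cand j x K) →
      Run P (block l) t R) :
    Run P (block (coeffs :: l)) s R := by
  refine Run.cons (R := fun t => ∃ G', G <+: G' ∧ Inv κ G' t ∧ t.W = s.W + κ.N * (κ.n + κ.m + 1) ∧
      t.inp = rest ∧ Frame s t ∧ 2 ^ t.inp.length ≤ P ∧
      IsRow κ G' (t.W - κ.N) (fun x K => linForm a c x fun j => κ.cand j x K)) ?_ ?_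
  swap
  · rintro t ⟨G', h₁, h₂, h₃, h₄, h₅, h₆, h₇⟩
    exact hR t G' h₁ h₂ h₃ h₄ h₅ h₆ h₇
  have hWP : ∀ i ≤ κ.n + κ.m, s.W + κ.N * i + κ.N ≤ P := fun i hi => by
    have : κ.N * i ≤ κ.N * (κ.n + κ.m) := by gcongr
    linarith
  have hy0 : κ.yAddr 0 ≤ P := le_trans (by simp [Par.yAddr]) hyP
  have hyj : ∀ j < κ.m, κ.yAddr (j + 1) ≤ P := fun j hj => by
    refine le_trans ?_ hyP
    simp only [Par.yAddr]
    gcongr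
    omega
  refine h.rowZero (hWP 0 (by omega)) fun g G₁ hG₁ hI₁ hr₁ => ?_
  refine Run.assign 0 (by decide) (fun _ => by simp) rfl ?_
  refine Run.cons (Run.loop (k := κ.n) (by exact hI₁.n) (fun i t => ∃ G', G <+: G' ∧ Inv κ G' t ∧
      t.W = s.W + κ.N * (i + 1) ∧ t.i = i ∧
      t.inp = ((List.ofFn a).drop i).flatMap encodeInt ++ ((List.ofFn c).flatMap encodeInt ++ rest) ∧
      Frame s t ∧ 2 ^ t.inp.length ≤ P ∧
      IsRow κ G' (t.W - κ.N) (fun x _ => ∑ k ∈ Finset.range i, coef a k * inputVal x k)) ?_ ?_) ?_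
  · refine ⟨G₁, hG₁, hI₁.set rfl 0, ?_, rfl, ?_, ⟨rfl, rfl, rfl⟩, hP, ?_⟩
    · simp [St.set, h.N]
    · simp [St.set, hi, encodeCoeffs]
    · simpa [St.set, h.N] using hr₁
  · rintro i hik t ⟨G', hG', hJ, hW', hi', hinp, hfr, hP', hr⟩
    have hWN : κ.N ≤ t.W := by rw [hW', mul_add]; omega
    rw [drop_ofFn a hik, List.flatMap_cons, List.append_assoc] at hinp
    have hlen := hJ.len
    refine hJ.readInt_row hinp hP' (by rw [hW']; exact hWP (i + 1) (by omega)) hr hWN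
      (δ := fun _ => i) (fun u hu _ _ K hK => ?_) (fun K hK => by omega)
      (F' := fun x _ => ∑ k ∈ Finset.range (i + 1), coef a k * inputVal x k) (fun x K hK => ?_)
      fun u G₂ hG₂ hI₂ hW₂ hinp₂ hi₂ hy₂ hf₂ hP₂ hr₂ => ?_
    · have : u.i = i := hu.trans hi'
      subst this
      exact good_var (by decide)
    · rw [Finset.sum_range_succ, hJ.wire_input x (by omega)]
    · refine Run.assign (i + 1) (by decide) (fun _ => ?_) ?_ (Run.nil ?_)
      · have := hWP 0 (by omega)
        have := h.len
        simp [St.get, hi₂, hi']; omega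
      · simp [St.get, hi₂, hi']
      · exact ⟨G₂, hG'.trans hG₂, hI₂.set rfl _, by simp [St.set, hW₂, hW']; ring, rfl, hinp₂,
          hfr.trans ⟨hf₂.skel, hf₂.S, hf₂.T⟩, hP₂, hr₂⟩
  · rintro t ⟨G', hG', hJ, hW', -, hinp, hfr, hP', hr⟩
    rw [List.drop_of_length_le (by simp), List.flatMap_nil, List.nil_append] at hinp
    refine Run.assign _ (by decide) (fun _ => hJ.bdd_yFirst hy0) hJ.eval_yFirst ?_
    refine Run.cons (Run.loop (k := κ.m) (by exact hJ.m) (fun j t => ∃ G', G <+: G' ∧ Inv κ G' t ∧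
      t.W = s.W + κ.N * (κ.n + j + 1) ∧ t.y = κ.yAddr j ∧
      t.inp = ((List.ofFn c).drop j).flatMap encodeInt ++ rest ∧ Frame s t ∧ 2 ^ t.inp.length ≤ P ∧
      IsRow κ G' (t.W - κ.N) (fun x K => ∑ k ∈ Finset.range κ.n, coef a k * inputVal x k +
        ∑ k ∈ Finset.range j, coef c k * κ.cand k x K)) ?_ ?_) ?_
    · refine ⟨G', hG', hJ.set rfl _, hW', rfl, hinp, ⟨hfr.skel, hfr.S, hfr.T⟩, hP', ?_⟩
      simp only [Finset.range_zero, Finset.sum_empty, add_zero]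
      exact hr
    · rintro j hj u ⟨G₁, hG₁, hI₁, hW₁, hy₁, hinp₁, hf₁, hP₁, hr₁⟩
      have hWN : κ.N ≤ u.W := by rw [hW₁, mul_add]; omega
      rw [drop_ofFn c hj, List.flatMap_cons, List.append_assoc] at hinp₁
      have hcj := hy.mono hG₁ j hj
      have hlt : κ.yAddr j + κ.N ≤ u.W := by rw [hI₁.built.W]; exact hcj.1
      have hWu : u.W + κ.N ≤ P := by
        rw [hW₁, add_assoc κ.n]
        have := hWP (κ.n + (j + 1)) (by omega)
        exact this
      refine hI₁.readInt_row hinp₁ hP₁ hWu hr₁ hWN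
        (δ := fun K => κ.yAddr j + K) (fun v _ hv _ K hK => ?_) (fun K hK => by omega)
        (F' := fun x K => ∑ k ∈ Finset.range κ.n, coef a k * inputVal x k +
          ∑ k ∈ Finset.range (j + 1), coef c k * κ.cand k x K) (fun x K hK => ?_)
        fun v G₂ hG₂ hI₂ hW₂ hinp₂ hi₂ hy₂ hf₂ hP₂ hr₂ => ?_
      · rw [← hy₁, ← hv]
        refine good_offset (v := .y) (by decide) ?_
        change v.y + K ≤ P
        omega
      · rw [Finset.sum_range_succ, hcj.2 x K hK, add_assoc]
      · refine run_next_y hI₂ hN0 (hyj j hj) (hy₂.trans hy₁) fun hI₃ => Run.nil ?_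
        exact ⟨G₂, hG₁.trans hG₂, hI₃, by simp [St.set, hW₂, hW₁]; ring, rfl, hinp₂,
          hf₁.trans ⟨hf₂.skel, hf₂.S, hf₂.T⟩, hP₂, hr₂⟩
    · rintro u ⟨G₁, hG₁, hI₁, hW₁, hy₁, hinp₁, hf₁, hP₁, hr₁⟩
      rw [List.drop_of_length_le (by simp), List.flatMap_nil, List.nil_append] at hinp₁
      refine Run.nil ⟨G₁, hG₁, hI₁, hW₁, hinp₁, hf₁, hP₁, hr₁.1, fun x K hK => ?_⟩
      refine (hr₁.2 x K hK).trans ?_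
      simp only [linForm, Finset.sum_range]
      congr 1
      · exact Finset.sum_congr rfl fun i _ => by simp [coef, inputVal]
      · exact Finset.sum_congr rfl fun i _ => by simp [coef]

end Cmd

namespace Cmd

/-- Puts the last row on the stack `T`. -/
def pushLast : List Cmd := [assign .T (Var.T * Var.B + (Var.W - Var.N)), push .skel .mark]

/-- Reads the next symbol of the formula. For a connective, it is put on the stack of connectives. For
a leaf, the rows that compute its defect are written. -/
def leafStep : Cmd := pop .inp fun o => match o with
  | some .and => push .skel .and
  | some .or => push .skel .or
  | some .ineq => block (coeffs :: readInt :: row (emitLin lastRow Var.p Var.q Var.n) ::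
      row (emitLin Var.n₁ 0 1 lastRow) :: row (emitBin .maximum lastRow Var.n₁) :: pushLast)
  | some .congr => block (coeffs :: readNat :: row (emitLin lastRow 0 Var.p Var.n) :: readNat ::
      row (emitBin .floorDiv Var.p lastRow) ::
      row (emitLin (Var.W - (Var.N + Var.N) + Var.K) 0 Var.p lastRow) :: pushLast)
  | some .ncongr => block (coeffs :: readNat :: row (emitLin lastRow 0 Var.p Var.n) :: readNat ::
      row (emitBin .floorDiv Var.p lastRow) ::
      row (emitLin (Var.W - (Var.N + Var.N) + Var.K) 0 Var.p lastRow) ::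
      row (emitBin .zeroCond lastRow Var.n) :: pushLast)
  | _ => skip

variable {κ : Par} {G : List Gate} {s : St} {P : ℕ}

theorem add_lt_pow_succ {a b B j : ℕ} (ha : a < B ^ j) (hb : b < B) : a * B + b < B ^ (j + 1) := by
  rw [pow_succ]
  nlinarith

/-- The effect of reading a leaf with truth value given by `F`. -/
def LeafPost (κ : Par) (G : List Gate) (s : St) (j : ℕ) (rest : List Sym)
    (F : (Fin κ.n → ℤ) → ℕ → ℤ) (t : St) : Prop :=
  ∃ G' A, G <+: G' ∧ Inv κ G' t ∧ t.inp = rest ∧ t.W ≤ s.W + κ.N * (κ.n + κ.m + 5) ∧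
    t.skel = Sym.mark :: s.skel ∧ t.S = s.S ∧ A < κ.B ∧ IsRow κ G' A F ∧ t.T = s.T * κ.B + A ∧
    t.T < κ.B ^ (j + 1)

theorem run_pushLast {t : St} {G' : List Gate} {j : ℕ} {rest : List Sym}
    {F : (Fin κ.n → ℤ) → ℕ → ℤ} (h : Inv κ G' t) (hG : G <+: G') (hN0 : 0 < κ.N) (hi : t.inp = rest)
    (hW : t.W ≤ s.W + κ.N * (κ.n + κ.m + 5)) (hB : s.W + κ.N * (κ.n + κ.m + 5) ≤ κ.B)
    (hf : Frame s t) (hr : IsRow κ G' (t.W - κ.N) F) (hT : s.T < κ.B ^ j) (hP : κ.B ^ (j + 1) ≤ P) :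
    Run P (block pushLast) t (LeafPost κ G s j rest F) := by
  have hlen := h.len
  have hA : t.W - κ.N < κ.B := by omega
  have key := add_lt_pow_succ hT hA
  refine Run.assign (s.T * κ.B + (t.W - κ.N)) (by decide) (fun _ => ?_) ?_
    (Tr.push.run_cons (Run.nil ?_))
  · simp only [Expr.bdd_add, Expr.bdd_sub, Expr.bdd_var, Expr.bdd_mul, Expr.eval_var,
      Expr.eval_sub, Expr.eval_mul, true_and]
    simp only [St.get, h.B, h.N, hf.T]
    omega
  · simp only [Expr.eval_add, Expr.eval_sub, Expr.eval_mul, Expr.eval_var]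
    simp only [St.get, h.B, h.N, hf.T]
  · exact ⟨G', t.W - κ.N, hG, (h.set (v := .T) rfl _).with_skel _, hi, hW,
      congrArg (Sym.mark :: ·) hf.skel, hf.S, hA, hr, rfl, key⟩

theorem Run.pop {k : Stack} {f : Option Sym → Cmd} {R : St → Prop} (o : Option Sym)
    (ho : (s.getS k).head? = o) (h : Run P (f o) (s.setS k (s.getS k).tail) R) :
    Run P (.pop k f) s R := fun hs => by
  subst ho
  exact h (by simpa [St.Le] using hs)

theorem run_leaf_ineq (h : Inv κ G s) (hy : CandRows κ G) (hN0 : 0 < κ.N) {a : Fin κ.n → ℤ}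
    {c : Fin κ.m → ℤ} {b : ℤ} {rest : List Sym} {j : ℕ}
    (hi : s.inp = (Formula.ineq a c b).encodeTree ++ rest) (hP : 2 ^ s.inp.length ≤ P)
    (hB : s.W + κ.N * (κ.n + κ.m + 5) ≤ κ.B) (hyP : κ.yAddr κ.m ≤ P)
    (hT : s.T < κ.B ^ j) (hPB : κ.B ^ (j + 1) ≤ P) (hBP : κ.B ≤ P) :
    Run P leafStep s (LeafPost κ G s j rest
      fun x K => (Formula.ineq a c b).defect x fun j => κ.cand j x K) := by
  refine Run.pop (some .ineq) (by simp [St.getS, hi, Formula.encodeTree]) ?_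
  have hi' : s.inp.tail = encodeCoeffs a c ++ (encodeInt b ++ rest) := by
    simp [hi, Formula.encodeTree]
  have hs : Inv κ G (s.setS .inp (s.getS .inp).tail) := h.with_inp _
  have e5 : κ.N * (κ.n + κ.m + 5) = κ.N * (κ.n + κ.m + 1) + κ.N + κ.N + κ.N + κ.N := by ring
  refine run_coeffs hs hy hN0 hi' ((Nat.pow_le_pow_right (by norm_num) (by
    simp [St.setS, St.getS])).trans hP) (by change s.W + _ ≤ _; omega) hyP
    fun t G₁ hG₁ hI₁ hW₁ hinp₁ hf₁ hP₁ hr₁ => ?_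
  replace hW₁ : t.W = s.W + κ.N * (κ.n + κ.m + 1) := hW₁
  have hlen := h.len
  have hN1 : κ.N ≤ κ.N * (κ.n + κ.m + 1) := Nat.le_mul_of_pos_right _ (by omega)
  refine hI₁.readInt_row hinp₁ hP₁ (by omega) hr₁ (by omega) (δ := fun _ => κ.n)
    (fun u _ _ hn K _ => ?_) (fun K hK => by omega) (fun x K hK => rfl)
    fun t₂ G₂ hG₂ hI₂ hW₂ hinp₂ _ _ hf₂ hP₂ hr₂ => ?_
  · have : κ.n = u.n := by rw [hn, hI₁.n]
    rw [this]
    exact good_var (by decide)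
  have hn₁ := hI₂.n₁
  refine hI₂.row_lin (fun x K => 0 - (linForm a c x (fun j => κ.cand j x K) + b))
    (fun K _ => good_var (by decide)) (fun K _ => good_zero)
    (γ := fun _ => 1) (fun K _ => ⟨by decide, by decide, fun _ => by simp; omega, rfl⟩)
    (fun K hK => hI₂.good_lastRow hK (by omega) (by omega)) (fun K hK => ⟨?_, by omega⟩)
    (fun x K hK => ?_) (by omega) (by omega) fun g G₃ hG₃ hI₃ hr₃ => ?_
  · change t₂.n₁ < _
    omega
  · change wire G₂ x t₂.n₁ + _ = _
    rw [hn₁, hI₂.zero, hr₂.2 x K hK]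
    beta_reduce
    rw [hI₁.one]
    push_cast; ring
  have hW₃ : (t₂.addRow g).W = t₂.W + κ.N := by simp [hI₂.N]
  have hn₃ : (t₂.addRow g).n₁ = κ.n + 1 := hI₃.n₁
  refine hI₃.row_max (fun x K => (Formula.ineq a c b).defect x fun j => κ.cand j x K)
    (fun K hK => hI₃.good_lastRow hK (by omega) (by omega)) (fun K _ => good_var (by decide))
    (fun K hK => ⟨by omega, ?_⟩) (fun x K hK => ?_) (by omega) (by omega)
    fun g' G₄ hG₄ hI₄ hr₄ => ?_
  · change (t₂.addRow g).n₁ < _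
    omega
  · change max _ (wire G₃ x (t₂.addRow g).n₁) = _
    rw [hn₃, hI₃.zero, hW₃, Nat.add_sub_cancel, hr₃.2 x K hK]
    rfl
  have hW₄ : ((t₂.addRow g).addRow g').W = t₂.W + κ.N + κ.N := by simp [hI₂.N]
  refine run_pushLast hI₄ (((hG₁.trans hG₂).trans hG₃).trans hG₄) hN0 hinp₂ (by omega) hB
    ⟨hf₂.skel.trans hf₁.skel, hf₂.S.trans hf₁.S, hf₂.T.trans hf₁.T⟩ ?_ hT hPB
  rwa [hW₄, Nat.add_sub_cancel, ← hW₃]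

/-- Given the values `u` of a linear form, the rows for its residue and modulus are written; the last one
carries `u - r - M ⌊(u - r) / M⌋`. -/
theorem run_rest_congr (h : Inv κ G s) (hN0 : 0 < κ.N) {u : (Fin κ.n → ℤ) → ℕ → ℤ} {r M : ℕ}
    {rest : List Sym} (hM : 0 < M) (hi : s.inp = encodeNat r ++ (encodeNat M ++ rest))
    (hP : 2 ^ s.inp.length ≤ P) (hW : s.W + κ.N * 3 ≤ P) (hr : IsRow κ G (s.W - κ.N) u)
    (hN : κ.N ≤ s.W) {l : List Cmd} {R : St → Prop}
    (hR : ∀ t G', G <+: G' → Inv κ G' t → t.W = s.W + κ.N * 3 → t.inp = rest → Frame s t →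
      IsRow κ G' (t.W - κ.N) (fun x K => u x K - r - M * Int.fdiv (u x K - r) M) →
      Run P (block l) t R) :
    Run P (block (readNat :: row (emitLin lastRow 0 Var.p Var.n) :: readNat ::
      row (emitBin .floorDiv Var.p lastRow) ::
      row (emitLin (Var.W - (Var.N + Var.N) + Var.K) 0 Var.p lastRow) :: l)) s R := by
  have hlen := h.len
  refine (tr_readNat hi hP).run_cons ?_
  have hJ : Inv κ G {s with p := r, pw := 0, dn := 0, inp := encodeNat M ++ rest} :=
    {h with built := {h.built with}}
  refine hJ.row_lin (fun x K => u x K - r) (fun K hK => hJ.good_lastRow hK hN (by change s.W ≤ P; omega))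
    (fun K _ => good_zero) (fun K _ => good_var (by decide)) (fun K _ => good_var (by decide))
    (fun K hK => ⟨?_, ?_⟩) (fun x K hK => ?_) (by omega) (by change s.W + _ ≤ _; omega)
    fun g G₁ hG₁ hI₁ hr₁ => ?_
  · change s.W - κ.N + K < s.W
    omega
  · change s.n < s.W
    rw [h.n]; omega
  · change wire G x (s.W - κ.N + K) + ((0 : ℕ) - (r : ℤ)) * wire G x s.n = _
    rw [hr.2 x K hK, h.n, h.one]; push_cast; ring
  have hP' : 2 ^ (encodeNat M ++ rest).length ≤ P := by
    refine (Nat.pow_le_pow_right (by norm_num) ?_).trans hP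
    rw [hi]
    simp
  refine (tr_readNat (s := St.addRow _ g) (x := M) (rest := rest) rfl hP').run_cons ?_
  have hJ₂ := hI₁.with_inp rest
  set t : St := _
  change Run P _ t R
  have hJ₂ : Inv κ G₁ t := {hI₁ with built := {hI₁.built with}}
  have htW : t.W = s.W + κ.N := congrArg (s.W + ·) h.N
  refine hJ₂.row_div (fun x K => Int.fdiv (u x K - r) M) (fun K _ => good_var (by decide))
    (fun K hK => hJ₂.good_lastRow hK (by omega) (by omega)) (fun K hK => ⟨hM, by omega⟩)
    (fun x K hK => ?_) (by omega) (by omega) fun g' G₂ hG₂ hI₂ hr₂ => ?_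
  · rw [htW, Nat.add_sub_cancel, hr₁.2 x K hK]
    rfl
  have htW₂ : (t.addRow g').W = s.W + κ.N + κ.N := by simp [htW, hJ₂.N]
  have hr₁' := hr₁.mono hG₂
  replace hr₁' : IsRow κ G₂ s.W _ := hr₁'
  refine hI₂.row_lin (fun x K => u x K - r - M * Int.fdiv (u x K - r) M)
    (α := fun K => s.W + K) (fun K hK => ⟨by decide, by decide, fun _ => ?_, ?_⟩)
    (fun K _ => good_zero) (fun K _ => good_var (by decide))
    (fun K hK => hI₂.good_lastRow hK (by omega) (by omega)) (fun K hK => ⟨by omega, by omega⟩)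
    (fun x K hK => ?_) (by omega) (by omega) fun g₃ G₃ hG₃ hI₃ hr₃ => ?_
  · have hNN := hI₂.N
    simp only [Expr.bdd_add, Expr.bdd_sub, Expr.bdd_var, Expr.eval_var, Expr.eval_add,
      Expr.eval_sub, true_and]
    change (t.addRow g').N + (t.addRow g').N ≤ P ∧
      (t.addRow g').W - ((t.addRow g').N + (t.addRow g').N) + K ≤ P
    omega
  · have hNN := hI₂.N
    simp only [Expr.eval_var, Expr.eval_add, Expr.eval_sub]
    change (t.addRow g').W - ((t.addRow g').N + (t.addRow g').N) + K = _
    omega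
  · rw [hr₁'.2 x K hK, htW₂, Nat.add_sub_cancel, ← htW, hr₂.2 x K hK]
    change _ + ((0 : ℕ) - (M : ℤ)) * _ = _
    push_cast; ring
  have htW₃ : ((t.addRow g').addRow g₃).W = s.W + κ.N + κ.N + κ.N := by simp [htW, hJ₂.N]
  refine hR _ G₃ ((hG₁.trans hG₂).trans hG₃) hI₃ (by omega) rfl ⟨rfl, rfl, rfl⟩ ?_
  rwa [htW₃, Nat.add_sub_cancel, ← htW₂]

theorem run_leaf_congr (h : Inv κ G s) (hy : CandRows κ G) (hN0 : 0 < κ.N) {a : Fin κ.n → ℤ}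
    {c : Fin κ.m → ℤ} {r M : ℕ} {hM : r < M} {rest : List Sym} {j : ℕ}
    (hi : s.inp = (Formula.congr a c r M hM).encodeTree ++ rest) (hP : 2 ^ s.inp.length ≤ P)
    (hB : s.W + κ.N * (κ.n + κ.m + 5) ≤ κ.B) (hyP : κ.yAddr κ.m ≤ P)
    (hT : s.T < κ.B ^ j) (hPB : κ.B ^ (j + 1) ≤ P) (hBP : κ.B ≤ P) :
    Run P leafStep s (LeafPost κ G s j rest
      fun x K => (Formula.congr a c r M hM).defect x fun j => κ.cand j x K) := by
  refine Run.pop (some .congr) (by simp [St.getS, hi, Formula.encodeTree]) ?_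
  have hi' : s.inp.tail = encodeCoeffs a c ++ (encodeNat r ++ (encodeNat M ++ rest)) := by
    simp [hi, Formula.encodeTree]
  have hs : Inv κ G (s.setS .inp (s.getS .inp).tail) := h.with_inp _
  have e5 : κ.N * (κ.n + κ.m + 5) = κ.N * (κ.n + κ.m + 1) + κ.N * 3 + κ.N := by ring
  refine run_coeffs hs hy hN0 hi' ((Nat.pow_le_pow_right (by norm_num) (by
    simp [St.setS, St.getS])).trans hP) (by change s.W + _ ≤ _; omega) hyP
    fun t G₁ hG₁ hI₁ hW₁ hinp₁ hf₁ hP₁ hr₁ => ?_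
  replace hW₁ : t.W = s.W + κ.N * (κ.n + κ.m + 1) := hW₁
  have hN1 : κ.N ≤ κ.N * (κ.n + κ.m + 1) := Nat.le_mul_of_pos_right _ (by omega)
  refine run_rest_congr hI₁ hN0 (by omega) hinp₁ hP₁ (by omega) hr₁ (by omega)
    fun t₂ G₂ hG₂ hI₂ hW₂ hinp₂ hf₂ hr₂ => ?_
  exact run_pushLast hI₂ (hG₁.trans hG₂) hN0 hinp₂ (by omega) hB
    ⟨hf₂.skel.trans hf₁.skel, hf₂.S.trans hf₁.S, hf₂.T.trans hf₁.T⟩ hr₂ hT hPB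

theorem run_leaf_ncongr (h : Inv κ G s) (hy : CandRows κ G) (hN0 : 0 < κ.N) {a : Fin κ.n → ℤ}
    {c : Fin κ.m → ℤ} {r M : ℕ} {hM : r < M} {rest : List Sym} {j : ℕ}
    (hi : s.inp = (Formula.ncongr a c r M hM).encodeTree ++ rest) (hP : 2 ^ s.inp.length ≤ P)
    (hB : s.W + κ.N * (κ.n + κ.m + 5) ≤ κ.B) (hyP : κ.yAddr κ.m ≤ P)
    (hT : s.T < κ.B ^ j) (hPB : κ.B ^ (j + 1) ≤ P) (hBP : κ.B ≤ P) :
    Run P leafStep s (LeafPost κ G s j rest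
      fun x K => (Formula.ncongr a c r M hM).defect x fun j => κ.cand j x K) := by
  refine Run.pop (some .ncongr) (by simp [St.getS, hi, Formula.encodeTree]) ?_
  have hi' : s.inp.tail = encodeCoeffs a c ++ (encodeNat r ++ (encodeNat M ++ rest)) := by
    simp [hi, Formula.encodeTree]
  have hs : Inv κ G (s.setS .inp (s.getS .inp).tail) := h.with_inp _
  have e5 : κ.N * (κ.n + κ.m + 5) = κ.N * (κ.n + κ.m + 1) + κ.N * 3 + κ.N := by ring
  refine run_coeffs hs hy hN0 hi' ((Nat.pow_le_pow_right (by norm_num) (by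
    simp [St.setS, St.getS])).trans hP) (by change s.W + _ ≤ _; omega) hyP
    fun t G₁ hG₁ hI₁ hW₁ hinp₁ hf₁ hP₁ hr₁ => ?_
  replace hW₁ : t.W = s.W + κ.N * (κ.n + κ.m + 1) := hW₁
  have hN1 : κ.N ≤ κ.N * (κ.n + κ.m + 1) := Nat.le_mul_of_pos_right _ (by omega)
  have hlen := h.len
  refine run_rest_congr hI₁ hN0 (by omega) hinp₁ hP₁ (by omega) hr₁ (by omega)
    fun t₂ G₂ hG₂ hI₂ hW₂ hinp₂ hf₂ hr₂ => ?_
  refine hI₂.row_zeroCond (fun x K => (Formula.ncongr a c r M hM).defect x fun j => κ.cand j x K)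
    (fun K hK => hI₂.good_lastRow hK (by omega) (by omega)) (fun K _ => good_var (by decide))
    (fun K hK => ⟨by omega, ?_⟩) (fun x K hK => ?_) (by omega) (by omega)
    fun g G₃ hG₃ hI₃ hr₃ => ?_
  · change t₂.n < _
    rw [hI₂.n]; omega
  · change (if _ then wire G₂ x t₂.n else 0) = _
    rw [hI₂.n, hI₂.one, hr₂.2 x K hK]
    rfl
  have hW₃ : (t₂.addRow g).W = t₂.W + κ.N := by simp [hI₂.N]
  refine run_pushLast hI₃ ((hG₁.trans hG₂).trans hG₃) hN0 hinp₂ (by omega) hB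
    ⟨hf₂.skel.trans hf₁.skel, hf₂.S.trans hf₁.S, hf₂.T.trans hf₁.T⟩ ?_ hT hPB
  rwa [hW₃, Nat.add_sub_cancel]

end Cmd

/-! ### The gates for the connectives -/

namespace Cmd

/-- Takes the two topmost rows from the stack `S`. -/
def popTwo : List Cmd := [assign .a (Var.S % Var.B), assign .S (Var.S / Var.B),
  assign .c (Var.S % Var.B), assign .S (Var.S / Var.B)]

/-- Puts the last row on the stack `S`. -/
def pushResult : List Cmd := [assign .S (Var.S * Var.B + (Var.W - Var.N))]

/-- Evaluates the topmost symbol of the stack of connectives: the result for a leaf is moved from the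
stack `T` to the stack `S`, and a connective is applied to the two topmost rows of the stack `S`. -/
def opStep : Cmd := pop .skel fun o => match o with
  | some .and => block (popTwo ++ row (emitLin (Var.a + Var.K) 1 0 (Var.c + Var.K)) :: pushResult)
  | some .or => block (popTwo ++ row (emitBin .zeroCond (Var.a + Var.K) (Var.c + Var.K)) ::
      row (emitLin (Var.c + Var.K) 0 1 lastRow) :: pushResult)
  | some .mark => block [assign .S (Var.S * Var.B + Var.T % Var.B), assign .T (Var.T / Var.B)]
  | _ => skip

/-- The `k`-fold repetition of `c` leads from `s` to a memory with the property `R`, without numbers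
larger than `P`. -/
def RunN (P : ℕ) (c : Cmd) (k : ℕ) (s : St) (R : St → Prop) : Prop :=
  s.Le P → (∀ i < k, c.Ok P (c.run^[i] s)) ∧ R (c.run^[k] s) ∧ St.Le P (c.run^[k] s)

variable {κ : Par} {G : List Gate} {s : St} {P : ℕ}

theorem Run.toRunN {c : Cmd} {R : St → Prop} (h : Run P c s R) : RunN P c 1 s R := fun hs => by
  obtain ⟨h₁, h₂, h₃⟩ := h hs
  exact ⟨fun i hi => by obtain rfl : i = 0 := by omega
                        exact h₁, h₂, h₃⟩

theorem RunN.add {c : Cmd} {j k : ℕ} {R R' : St → Prop} (h₁ : RunN P c j s R)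
    (h₂ : ∀ t, R t → RunN P c k t R') : RunN P c (j + k) s R' := fun hs => by
  obtain ⟨a₁, b₁, c₁⟩ := h₁ hs
  obtain ⟨a₂, b₂, c₂⟩ := h₂ _ b₁ c₁
  rw [add_comm, Function.iterate_add_apply, add_comm]
  refine ⟨fun i hi => ?_, b₂, c₂⟩
  by_cases hij : i < j
  · exact a₁ i hij
  · obtain ⟨d, rfl⟩ := Nat.exists_eq_add_of_le (not_lt.mp hij)
    rw [add_comm, Function.iterate_add_apply]
    exact a₂ d (by omega)

theorem RunN.const {c : Cmd} {k : ℕ} {R : St → Prop} (h : Tr P c s s) (hR : R s) :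
    RunN P c k s R := fun hs => by
  obtain ⟨h₁, h₂, h₃⟩ := TrN.const (k := k) h hs
  exact ⟨h₁, by rwa [h₂], by rwa [h₂]⟩

theorem RunN.mono {c : Cmd} {k : ℕ} {R R' : St → Prop} (h : RunN P c k s R) (hR : ∀ t, R t → R' t) :
    RunN P c k s R' := fun hs => ⟨(h hs).1, hR _ (h hs).2.1, (h hs).2.2⟩

theorem Run.loopS {v : Stack} {c : Cmd} {k : ℕ} {R : St → Prop} (hk : (s.getS v).length = k)
    (hP : k ≤ P) (h : RunN P c k s R) : Run P (.loopS v c) s R := by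
  subst hk
  exact fun hs => ⟨⟨hP, (h hs).1⟩, (h hs).2⟩

/-- The addresses of the rows for the leaves of the formula, from left to right. -/
def _root_.PFnS.LeafRows (κ : Par) (G : List Gate) : Formula κ.n κ.m → List ℕ → Prop
  | .and φ ψ, l => ∃ l₁ l₂, l = l₁ ++ l₂ ∧ LeafRows κ G φ l₁ ∧ LeafRows κ G ψ l₂
  | .or φ ψ, l => ∃ l₁ l₂, l = l₁ ++ l₂ ∧ LeafRows κ G φ l₁ ∧ LeafRows κ G ψ l₂
  | φ, l => ∃ A, l = [A] ∧ A < κ.B ∧ IsRow κ G A fun x K => φ.defect x fun j => κ.cand j x K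

theorem _root_.PFnS.LeafRows.mono {G' : List Gate} (hG : G <+: G') : ∀ {φ : Formula κ.n κ.m}
    {l : List ℕ}, LeafRows κ G φ l → LeafRows κ G' φ l
  | .and _ _, _, ⟨l₁, l₂, e, h₁, h₂⟩ => ⟨l₁, l₂, e, h₁.mono hG, h₂.mono hG⟩
  | .or _ _, _, ⟨l₁, l₂, e, h₁, h₂⟩ => ⟨l₁, l₂, e, h₁.mono hG, h₂.mono hG⟩
  | .ineq _ _ _, _, ⟨A, e, hA, h⟩ => ⟨A, e, hA, h.mono hG⟩
  | .congr _ _ _ _ _, _, ⟨A, e, hA, h⟩ => ⟨A, e, hA, h.mono hG⟩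
  | .ncongr _ _ _ _ _, _, ⟨A, e, hA, h⟩ => ⟨A, e, hA, h.mono hG⟩

/-- The tree without the leaves, in reverse prefix order. -/
def _root_.PFnS.Formula.skeleton {n m : ℕ} : Formula n m → List Sym
  | .and φ ψ => ψ.skeleton ++ φ.skeleton ++ [Sym.and]
  | .or φ ψ => ψ.skeleton ++ φ.skeleton ++ [Sym.or]
  | _ => [Sym.mark]

/-- Pushes the elements of a list on a stack that is coded as a number in base `B`. -/
def pushAll (B : ℕ) (l : List ℕ) (T : ℕ) : ℕ := l.foldl (fun t a => t * B + a) T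

/-- The memory after reading `φ`. -/
def ReadPost (κ : Par) (G : List Gate) (s : St) (j : ℕ) (rest : List Sym) (φ : Formula κ.n κ.m)
    (t : St) : Prop :=
  ∃ G' l, G <+: G' ∧ Inv κ G' t ∧ t.inp = rest ∧
    t.W ≤ s.W + κ.N * (κ.n + κ.m + 5) * φ.nodes ∧ t.skel = φ.skeleton ++ s.skel ∧ t.S = s.S ∧
    LeafRows κ G' φ l ∧ t.T = pushAll κ.B l s.T ∧ t.T < κ.B ^ (j + φ.nodes)

/-- Reading a formula writes its leaf rows, and their addresses are put on the stack `T`. The symbols of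
the tree are consumed one per round, apart from the constants, which the round of their leaf consumes. -/
theorem runN_leafStep (hN0 : 0 < κ.N) (hB0 : 0 < κ.B) (hyP : κ.yAddr κ.m ≤ P) (hBP : κ.B ≤ P) :
    ∀ (φ : Formula κ.n κ.m) {G : List Gate} {s : St} {j : ℕ} {rest : List Sym}, Inv κ G s →
      CandRows κ G → s.inp = φ.encodeTree ++ rest → 2 ^ s.inp.length ≤ P →
      s.W + κ.N * (κ.n + κ.m + 5) * φ.nodes ≤ κ.B → s.T < κ.B ^ j → κ.B ^ (j + φ.nodes) ≤ P →
      RunN P leafStep φ.nodes s (ReadPost κ G s j rest φ) := by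
  have leaf : ∀ (φ : Formula κ.n κ.m) (_ : φ.nodes = 1) (_ : φ.skeleton = [Sym.mark])
      {G : List Gate} (_ : ∀ G' l, LeafRows κ G' φ l ↔ ∃ A, l = [A] ∧ A < κ.B ∧
        IsRow κ G' A fun x K => φ.defect x fun j => κ.cand j x K) {s : St} {j : ℕ} {rest : List Sym},
      Run P leafStep s (LeafPost κ G s j rest fun x K => φ.defect x fun j => κ.cand j x K) →
      RunN P leafStep φ.nodes s (ReadPost κ G s j rest φ) := by
    intro φ h1 h2 G hl s j rest h
    rw [h1]
    refine h.toRunN.mono ?_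
    rintro t ⟨G', A, e1, e2, e3, e4, e5, e6, e7, e8, e9, e10⟩
    exact ⟨G', [A], e1, e2, e3, by rw [h1, mul_one]; exact e4, by rw [h2]; exact e5, e6,
      (hl _ _).mpr ⟨A, rfl, e7, e8⟩, e9, by rw [h1]; exact e10⟩
  have bin : ∀ (φ ψ χ : Formula κ.n κ.m) (a : Sym) (_ : χ.nodes = φ.nodes + ψ.nodes + 1)
      (_ : χ.skeleton = ψ.skeleton ++ φ.skeleton ++ [a])
      (_ : χ.encodeTree = a :: (φ.encodeTree ++ ψ.encodeTree))
      (_ : ∀ G l, LeafRows κ G χ l ↔ ∃ l₁ l₂, l = l₁ ++ l₂ ∧ LeafRows κ G φ l₁ ∧ LeafRows κ G ψ l₂)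
      (_ : ∀ {s : St} {w : List Sym}, s.inp = a :: w →
        Tr P leafStep s {s with inp := w, skel := a :: s.skel})
      (_ : ∀ {G : List Gate} {s : St} {j : ℕ} {rest : List Sym}, Inv κ G s →
        CandRows κ G → s.inp = φ.encodeTree ++ rest → 2 ^ s.inp.length ≤ P →
        s.W + κ.N * (κ.n + κ.m + 5) * φ.nodes ≤ κ.B → s.T < κ.B ^ j → κ.B ^ (j + φ.nodes) ≤ P →
        RunN P leafStep φ.nodes s (ReadPost κ G s j rest φ))
      (_ : ∀ {G : List Gate} {s : St} {j : ℕ} {rest : List Sym}, Inv κ G s →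
        CandRows κ G → s.inp = ψ.encodeTree ++ rest → 2 ^ s.inp.length ≤ P →
        s.W + κ.N * (κ.n + κ.m + 5) * ψ.nodes ≤ κ.B → s.T < κ.B ^ j → κ.B ^ (j + ψ.nodes) ≤ P →
        RunN P leafStep ψ.nodes s (ReadPost κ G s j rest ψ))
      {G : List Gate} {s : St} {j : ℕ} {rest : List Sym}, Inv κ G s →
      CandRows κ G → s.inp = χ.encodeTree ++ rest → 2 ^ s.inp.length ≤ P →
      s.W + κ.N * (κ.n + κ.m + 5) * χ.nodes ≤ κ.B → s.T < κ.B ^ j → κ.B ^ (j + χ.nodes) ≤ P →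
      RunN P leafStep χ.nodes s (ReadPost κ G s j rest χ) := by
    intro φ ψ χ a hn hk he hl hs ihφ ihψ G s j rest h hy hi hP hW hT hPB
    rw [hn, mul_add, mul_add] at hW
    rw [hn] at hPB
    rw [he, List.cons_append, List.append_assoc] at hi
    have hlen : ∀ w : List Sym, w.length ≤ s.inp.length → 2 ^ w.length ≤ P := fun w hw =>
      (Nat.pow_le_pow_right (by norm_num) hw).trans hP
    have hpow : ∀ i ≤ φ.nodes + ψ.nodes, κ.B ^ (j + i) ≤ P := fun i hi =>
      (Nat.pow_le_pow_right hB0 (by omega)).trans hPB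
    rw [hn, add_comm]
    refine RunN.add (Run.toRunN (Tr.toRun (R := fun t => t =
      {s with inp := φ.encodeTree ++ (ψ.encodeTree ++ rest), skel := a :: s.skel}) (hs hi) rfl)) ?_
    rintro _ rfl
    have h' : Inv κ G {s with
      inp := φ.encodeTree ++ (ψ.encodeTree ++ rest), skel := a :: s.skel} :=
      {h with built := {h.built with}}
    refine RunN.add (ihφ (j := j) (rest := ψ.encodeTree ++ rest) h' hy rfl (hlen _ (by rw [hi]; simp))
      (by change s.W + _ ≤ _; omega) hT (hpow _ (by omega))) ?_
    rintro t ⟨G₁, l₁, hG₁, hI₁, hi₁, hW₁, hk₁, hS₁, hl₁, hT₁, hb₁⟩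
    replace hW₁ : t.W ≤ s.W + κ.N * (κ.n + κ.m + 5) * φ.nodes := hW₁
    refine (ihψ (j := j + φ.nodes) (rest := rest) hI₁ (hy.mono hG₁) hi₁
      (hlen _ (by rw [hi₁, hi]; simp; omega)) (by omega) hb₁
      (by rw [add_assoc]; exact hpow _ (by omega))).mono ?_
    rintro u ⟨G₂, l₂, hG₂, hI₂, hi₂, hW₂, hk₂, hS₂, hl₂, hT₂, hb₂⟩
    refine ⟨G₂, l₁ ++ l₂, hG₁.trans hG₂, hI₂, hi₂, ?_, ?_, hS₂.trans hS₁,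
      (hl _ _).mpr ⟨l₁, l₂, rfl, hl₁.mono hG₂, hl₂⟩, ?_, hb₂.trans_le ?_⟩
    · rw [hn, mul_add, mul_add]; omega
    · rw [hk₂, hk₁, hk]; simp
    · rw [hT₂, hT₁]; simp [pushAll]
    · exact Nat.pow_le_pow_right hB0 (by omega)
  intro φ
  induction φ with
  | ineq a c b =>
    intro G s j rest h hy hi hP hW hT hPB
    exact leaf _ rfl rfl (fun _ _ => Iff.rfl) (run_leaf_ineq h hy hN0 hi hP
      (by simpa [Formula.nodes] using hW) hyP hT hPB hBP)
  | congr a c r M hr =>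
    intro G s j rest h hy hi hP hW hT hPB
    exact leaf _ rfl rfl (fun _ _ => Iff.rfl) (run_leaf_congr h hy hN0 hi hP
      (by simpa [Formula.nodes] using hW) hyP hT hPB hBP)
  | ncongr a c r M hr =>
    intro G s j rest h hy hi hP hW hT hPB
    exact leaf _ rfl rfl (fun _ _ => Iff.rfl) (run_leaf_ncongr h hy hN0 hi hP
      (by simpa [Formula.nodes] using hW) hyP hT hPB hBP)
  | and φ ψ ihφ ihψ =>
    refine bin φ ψ _ .and rfl rfl rfl (fun _ _ => Iff.rfl) (fun {s w} hs => ?_) ihφ ihψ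
    exact Tr.pop (some .and) (by simp [St.getS, hs]) (Tr.push.of_eq (by
      simp [St.getS, St.setS, hs]))
  | or φ ψ ihφ ihψ =>
    refine bin φ ψ _ .or rfl rfl rfl (fun _ _ => Iff.rfl) (fun {s w} hs => ?_) ihφ ihψ
    exact Tr.pop (some .or) (by simp [St.getS, hs]) (Tr.push.of_eq (by
      simp [St.getS, St.setS, hs]))

/-- The memory after evaluating a formula with truth values given by `F`. -/
def EvalPost (κ : Par) (G : List Gate) (s : St) (k T : ℕ) (rest : List Sym)
    (F : (Fin κ.n → ℤ) → ℕ → ℤ) (t : St) : Prop :=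
  ∃ G' A, G <+: G' ∧ Inv κ G' t ∧ t.inp = s.inp ∧ t.W ≤ s.W + κ.N * 2 * k ∧ t.skel = rest ∧
    t.T = T ∧ A < κ.B ∧ IsRow κ G' A F ∧ t.S = s.S * κ.B + A

theorem run_popTwo {A C S₀ : ℕ} (h : Inv κ G s) (hA : A < κ.B) (hC : C < κ.B)
    (hS : s.S = (S₀ * κ.B + C) * κ.B + A) {l : List Cmd} {R : St → Prop}
    (hR : ∀ t, Inv κ G t → t.a = A → t.c = C → t.S = S₀ → t.W = s.W → t.T = s.T →
      t.skel = s.skel → t.inp = s.inp → Run P (block l) t R) :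
    Run P (block (popTwo ++ l)) s R := by
  have hB0 : 0 < κ.B := by omega
  have e₁ : ∀ X Y : ℕ, Y < κ.B → (X * κ.B + Y) % κ.B = Y := fun X Y hY => by
    rw [add_comm, Nat.add_mul_mod_self_right, Nat.mod_eq_of_lt hY]
  have e₂ : ∀ X Y : ℕ, Y < κ.B → (X * κ.B + Y) / κ.B = X := fun X Y hY => by
    rw [add_comm, Nat.add_mul_div_right _ _ hB0, Nat.div_eq_of_lt hY, zero_add]
  refine Run.assign A (by decide) (fun hs => ?_) ?_ (Run.assign (S₀ * κ.B + C) (by decide)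
    (fun hs => ?_) ?_ (Run.assign C (by decide) (fun hs => ?_) ?_ (Run.assign S₀ (by decide)
    (fun hs => ?_) ?_ ?_)))
  · rw [Expr.bdd_mod _ _ _ _ hs]
    simpa [St.get, h.B] using hB0
  · simp [St.get, h.B, hS, e₁, hA]
  · simpa [St.get, St.set, h.B] using hB0
  · simp [St.get, St.set, h.B, hS, e₂, hA]
  · rw [Expr.bdd_mod _ _ _ _ hs]
    simpa [St.get, St.set, h.B] using hB0
  · simp [St.get, St.set, h.B, e₁, hC]
  · simpa [St.get, St.set, h.B] using hB0
  · simp [St.get, St.set, h.B, e₂, hC]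
  · have := (((h.set (v := .a) rfl A).set (v := .S) rfl (S₀ * κ.B + C)).set (v := .c) rfl C).set
      (v := .S) rfl S₀
    exact hR _ this rfl rfl rfl rfl rfl rfl rfl

theorem run_pushResult {t : St} {G' : List Gate} {k T : ℕ} {rest : List Sym}
    {F : (Fin κ.n → ℤ) → ℕ → ℤ} (h : Inv κ G' t) (hG : G <+: G') (hN0 : 0 < κ.N) (hi : t.inp = s.inp)
    (hW : t.W ≤ s.W + κ.N * 2 * k) (hB : t.W ≤ κ.B) (hS : t.S = s.S) (hk : t.skel = rest)
    (hT : t.T = T) (hr : IsRow κ G' (t.W - κ.N) F) {i : ℕ} (hSi : s.S < κ.B ^ i)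
    (hP : κ.B ^ (i + 1) ≤ P) :
    Run P (block pushResult) t (EvalPost κ G s k T rest F) := by
  have hlen := h.len
  have hA : t.W - κ.N < κ.B := by omega
  have key := add_lt_pow_succ hSi hA
  refine Run.assign (s.S * κ.B + (t.W - κ.N)) (by decide) (fun _ => ?_) ?_ (Run.nil ?_)
  · simp only [Expr.bdd_add, Expr.bdd_sub, Expr.bdd_var, Expr.bdd_mul, Expr.eval_var,
      Expr.eval_sub, Expr.eval_mul, true_and]
    simp only [St.get, h.B, h.N, hS]
    omega
  · simp only [Expr.eval_add, Expr.eval_sub, Expr.eval_mul, Expr.eval_var]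
    simp only [St.get, h.B, h.N, hS]
  · exact ⟨G', t.W - κ.N, hG, h.set rfl _, hi, hW, hk, hT, hA, hr, rfl⟩

theorem run_mark (h : Inv κ G s) {A i T : ℕ} {rest : List Sym} {F : (Fin κ.n → ℤ) → ℕ → ℤ}
    (hA : A < κ.B) (hr : IsRow κ G A F) (hT : s.T = T * κ.B + A) (hk : s.skel = Sym.mark :: rest)
    (hS : s.S < κ.B ^ i) (hP : κ.B ^ (i + 1) ≤ P) :
    Run P opStep s (EvalPost κ G s 1 T rest F) := by
  have key := add_lt_pow_succ hS hA
  have hB0 : 0 < κ.B := by omega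
  have e₁ : (T * κ.B + A) % κ.B = A := by
    rw [add_comm, Nat.add_mul_mod_self_right, Nat.mod_eq_of_lt hA]
  have e₂ : (T * κ.B + A) / κ.B = T := by
    rw [add_comm, Nat.add_mul_div_right _ _ hB0, Nat.div_eq_of_lt hA, zero_add]
  refine Run.pop (some .mark) (by simp [St.getS, hk]) (Run.assign (s.S * κ.B + A) (by decide)
    (fun hs => ?_) ?_ (Run.assign T (by decide) (fun hs => ?_) ?_ (Run.nil ?_)))
  · rw [Expr.bdd_add, Expr.bdd_mod _ _ _ _ hs]
    simp only [Expr.bdd_var, Expr.bdd_mul, Expr.eval_var, Expr.eval_mul, Expr.eval_mod, true_and]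
    simp only [St.get, St.setS, h.B, hT, e₁]
    omega
  · simp only [Expr.eval_var, Expr.eval_mul, Expr.eval_mod, Expr.eval_add]
    simp only [St.get, St.setS, h.B, hT, e₁]
  · simpa [St.get, St.set, St.setS, h.B] using hB0
  · simp [St.get, St.set, St.setS, h.B, hT, e₂]
  · have h' := ((h.with_skel (s.getS .skel).tail).set (v := .S) rfl (s.S * κ.B + A)).set (v := .T) rfl T
    exact ⟨G, A, List.prefix_rfl, h', rfl, Nat.le_add_right _ _,
      by simp [St.set, St.setS, St.getS, hk], rfl, hA, hr, rfl⟩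

theorem run_and (h : Inv κ G s) (hN0 : 0 < κ.N) {A C S₀ i : ℕ} {rest : List Sym}
    {F F' : (Fin κ.n → ℤ) → ℕ → ℤ} (hA : A < κ.B) (hC : C < κ.B) (hr : IsRow κ G A F)
    (hr' : IsRow κ G C F') (hS : s.S = (S₀ * κ.B + C) * κ.B + A) (hk : s.skel = Sym.and :: rest)
    (hW : s.W + κ.N * 2 ≤ κ.B) (hBP : κ.B ≤ P) (hSi : S₀ < κ.B ^ i) (hP : κ.B ^ (i + 1) ≤ P) :
    Run P opStep s (EvalPost κ G {s with S := S₀} 1 s.T rest fun x K => F x K + F' x K) := by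
  refine Run.pop (some .and) (by simp [St.getS, hk]) (run_popTwo (S₀ := S₀)
    (h.with_skel (s.getS .skel).tail) hA hC hS
    fun t hI ha hc hS₀ hWt hTt hkt hit => ?_)
  replace hWt : t.W = s.W := hWt
  have hlen := h.len
  have b₁ := hr.1
  have b₂ := hr'.1
  have hsW := h.built.W
  refine hI.row_lin (α := fun K => A + K) (δ := fun K => C + K) (fun x K => F x K + F' x K)
    (fun K hK => ?_) (β := fun _ => 1) (fun K _ => ⟨by decide, by decide, fun _ => by simp; omega, rfl⟩)
    (fun K _ => good_zero) (fun K hK => ?_) (fun K hK => ?_) (fun x K hK => ?_) (by omega) ?_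
    fun g G' hG hI' hrow => ?_
  · rw [← ha]; exact good_offset (v := .a) (by decide) (by simp only [St.get]; omega)
  · rw [← hc]; exact good_offset (v := .c) (by decide) (by simp only [St.get]; omega)
  · omega
  · rw [hr.2 x K hK, hr'.2 x K hK]; push_cast; ring
  · omega
  · have hW' : (t.addRow g).W = s.W + κ.N := by simp [hWt, hI.N]
    refine run_pushResult (s := {s with S := S₀}) hI' hG hN0 hit ?_ (by omega) hS₀ ?_ hTt ?_ hSi hP
    · rw [hW']; change s.W + κ.N ≤ s.W + _; omega
    · refine hkt.trans ?_; simp [St.getS, hk]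
    · rwa [hW', Nat.add_sub_cancel, ← hWt]

theorem run_or (h : Inv κ G s) (hN0 : 0 < κ.N) {A C S₀ i : ℕ} {rest : List Sym}
    {F F' : (Fin κ.n → ℤ) → ℕ → ℤ} (hA : A < κ.B) (hC : C < κ.B) (hr : IsRow κ G A F)
    (hr' : IsRow κ G C F') (hS : s.S = (S₀ * κ.B + C) * κ.B + A) (hk : s.skel = Sym.or :: rest)
    (hW : s.W + κ.N * 2 ≤ κ.B) (hBP : κ.B ≤ P) (hSi : S₀ < κ.B ^ i) (hP : κ.B ^ (i + 1) ≤ P) :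
    Run P opStep s (EvalPost κ G {s with S := S₀} 1 s.T rest
      fun x K => F' x K - if F x K = 0 then F' x K else 0) := by
  refine Run.pop (some .or) (by simp [St.getS, hk]) (run_popTwo (S₀ := S₀)
    (h.with_skel (s.getS .skel).tail) hA hC hS
    fun t hI ha hc hS₀ hWt hTt hkt hit => ?_)
  replace hWt : t.W = s.W := hWt
  have hlen := h.len
  have b₁ := hr.1
  have b₂ := hr'.1
  have hsW := h.built.W
  refine hI.row_zeroCond (α := fun K => A + K) (δ := fun K => C + K)
    (fun x K => if F x K = 0 then F' x K else 0)
    (fun K hK => ?_) (fun K hK => ?_) (fun K hK => ?_) (fun x K hK => ?_) (by omega) ?_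
    fun g G' hG hI' hrow => ?_
  · rw [← ha]; exact good_offset (v := .a) (by decide) (by simp only [St.get]; omega)
  · rw [← hc]; exact good_offset (v := .c) (by decide) (by simp only [St.get]; omega)
  · omega
  · rw [hr.2 x K hK, hr'.2 x K hK]
  · omega
  · have hW' : (t.addRow g).W = s.W + κ.N := by simp [hWt, hI.N]
    refine hI'.row_lin (α := fun K => C + K) (fun x K => F' x K - if F x K = 0 then F' x K else 0)
      (fun K hK => ?_) (fun K _ => good_zero) (γ := fun _ => 1)
      (fun K _ => ⟨by decide, by decide, fun _ => by simp; omega, rfl⟩)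
      (fun K hK => hI'.good_lastRow hK (by omega) (by omega)) (fun K hK => ⟨by omega, by omega⟩)
      (fun x K hK => ?_) (by omega) (by omega) fun g₂ G₂ hG₂ hI₂ hrow₂ => ?_
    · rw [← hc]; exact good_offset (v := .c) (by decide) (by simp only [St.get, St.addRow_c]; omega)
    · rw [(hr'.mono hG).2 x K hK, hW', Nat.add_sub_cancel, ← hWt, hrow.2 x K hK]
      push_cast; ring
    · have hW₂ : ((t.addRow g).addRow g₂).W = s.W + κ.N + κ.N := by simp [hWt, hI.N]
      refine run_pushResult (s := {s with S := S₀}) hI₂ (hG.trans hG₂) hN0 hit ?_ (by omega) hS₀ ?_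
        hTt ?_ hSi hP
      · rw [hW₂]; change s.W + κ.N + κ.N ≤ s.W + _; omega
      · refine hkt.trans ?_; simp [St.getS, hk]
      · rwa [hW₂, Nat.add_sub_cancel, ← hWt, ← hI.N]

/-- The connectives are evaluated from right to left: of the two subformulas of a connective, the right
one comes first, so that the result for the left one is on top of the stack `S`. -/
theorem runN_opStep (hN0 : 0 < κ.N) (hB0 : 0 < κ.B) (hBP : κ.B ≤ P) :
    ∀ (φ : Formula κ.n κ.m) {G : List Gate} {s : St} {i T : ℕ} {l : List ℕ} {rest : List Sym},
      Inv κ G s → LeafRows κ G φ l → s.T = pushAll κ.B l T → s.skel = φ.skeleton ++ rest →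
      s.W + κ.N * 2 * φ.nodes ≤ κ.B → s.S < κ.B ^ i → κ.B ^ (i + φ.nodes) ≤ P →
      RunN P opStep φ.nodes s (EvalPost κ G s φ.nodes T rest
        fun x K => φ.defect x fun j => κ.cand j x K) := by
  have bin : ∀ (φ ψ χ : Formula κ.n κ.m) (a : Sym) (_ : χ.nodes = φ.nodes + ψ.nodes + 1)
      (_ : χ.skeleton = ψ.skeleton ++ φ.skeleton ++ [a])
      (_ : ∀ G l, LeafRows κ G χ l ↔ ∃ l₁ l₂, l = l₁ ++ l₂ ∧ LeafRows κ G φ l₁ ∧ LeafRows κ G ψ l₂)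
      (_ : ∀ {G : List Gate} {s : St} {A C S₀ i : ℕ} {rest : List Sym}, Inv κ G s → A < κ.B →
        C < κ.B → IsRow κ G A (fun x K => φ.defect x fun j => κ.cand j x K) →
        IsRow κ G C (fun x K => ψ.defect x fun j => κ.cand j x K) →
        s.S = (S₀ * κ.B + C) * κ.B + A → s.skel = a :: rest → s.W + κ.N * 2 ≤ κ.B →
        S₀ < κ.B ^ i → κ.B ^ (i + 1) ≤ P →
        Run P opStep s (EvalPost κ G {s with S := S₀} 1 s.T rest
          fun x K => χ.defect x fun j => κ.cand j x K))
      (_ : ∀ {G : List Gate} {s : St} {i T : ℕ} {l : List ℕ} {rest : List Sym},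
        Inv κ G s → LeafRows κ G φ l → s.T = pushAll κ.B l T → s.skel = φ.skeleton ++ rest →
        s.W + κ.N * 2 * φ.nodes ≤ κ.B → s.S < κ.B ^ i → κ.B ^ (i + φ.nodes) ≤ P →
        RunN P opStep φ.nodes s (EvalPost κ G s φ.nodes T rest
          fun x K => φ.defect x fun j => κ.cand j x K))
      (_ : ∀ {G : List Gate} {s : St} {i T : ℕ} {l : List ℕ} {rest : List Sym},
        Inv κ G s → LeafRows κ G ψ l → s.T = pushAll κ.B l T → s.skel = ψ.skeleton ++ rest →
        s.W + κ.N * 2 * ψ.nodes ≤ κ.B → s.S < κ.B ^ i → κ.B ^ (i + ψ.nodes) ≤ P →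
        RunN P opStep ψ.nodes s (EvalPost κ G s ψ.nodes T rest
          fun x K => ψ.defect x fun j => κ.cand j x K))
      {G : List Gate} {s : St} {i T : ℕ} {l : List ℕ} {rest : List Sym},
      Inv κ G s → LeafRows κ G χ l → s.T = pushAll κ.B l T → s.skel = χ.skeleton ++ rest →
      s.W + κ.N * 2 * χ.nodes ≤ κ.B → s.S < κ.B ^ i → κ.B ^ (i + χ.nodes) ≤ P →
      RunN P opStep χ.nodes s (EvalPost κ G s χ.nodes T rest
        fun x K => χ.defect x fun j => κ.cand j x K) := by
    intro φ ψ χ a hn hk hl hop ihφ ihψ G s i T l rest h hL hT hsk hW hS hP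
    obtain ⟨l₁, l₂, rfl, hl₁, hl₂⟩ := (hl _ _).mp hL
    rw [hn, mul_add, mul_add] at hW
    rw [hk] at hsk
    have hpos : ∀ φ : Formula κ.n κ.m, 0 < φ.nodes := fun φ => by cases φ <;> simp [Formula.nodes]
    have := hpos φ
    have := hpos ψ
    have hpow : ∀ k ≤ φ.nodes + ψ.nodes, κ.B ^ (i + k) ≤ P := fun k hk =>
      (Nat.pow_le_pow_right hB0 (by omega)).trans hP
    rw [show pushAll κ.B (l₁ ++ l₂) T = pushAll κ.B l₂ (pushAll κ.B l₁ T) by simp [pushAll]] at hT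
    rw [hn, show φ.nodes + ψ.nodes + 1 = ψ.nodes + (φ.nodes + 1) by ring]
    refine RunN.add (ihψ (i := i) (rest := φ.skeleton ++ (a :: rest)) h hl₂ hT (by simp [hsk])
      (by omega) hS (hpow _ (by omega))) ?_
    rintro t ⟨G₁, C, hG₁, hI₁, hi₁, hW₁, hk₁, hT₁, hC, hr₁, hS₁⟩
    have hS₁' := add_lt_pow_succ hS hC
    rw [← hS₁] at hS₁'
    refine RunN.add (ihφ (i := i + 1) (rest := a :: rest) hI₁ (hl₁.mono hG₁) hT₁ hk₁ (by omega) hS₁'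
      (by rw [add_assoc]; exact hpow _ (by omega))) ?_
    rintro u ⟨G₂, A, hG₂, hI₂, hi₂, hW₂, hk₂, hT₂, hA, hr₂, hS₂⟩
    rw [hS₁] at hS₂
    refine (hop hI₂ hA hC hr₂ (hr₁.mono hG₂) hS₂ hk₂ (by omega) hS (hpow 1 (by omega))).toRunN.mono ?_
    rintro v ⟨G₃, D, hG₃, hI₃, hi₃, hW₃, hk₃, hT₃, hD, hr₃, hS₃⟩
    refine ⟨G₃, D, (hG₁.trans hG₂).trans hG₃, hI₃, hi₃.trans (hi₂.trans hi₁), ?_, hk₃,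
      hT₃.trans hT₂, hD, hr₃, hS₃⟩
    replace hW₃ : v.W ≤ u.W + κ.N * 2 * 1 := hW₃
    rw [mul_add, mul_add]
    omega
  have leaf : ∀ (φ : Formula κ.n κ.m) (_ : φ.nodes = 1) (_ : φ.skeleton = [Sym.mark])
      {G : List Gate} {s : St} {i T : ℕ} {l : List ℕ} {rest : List Sym}, Inv κ G s →
      (∃ A, l = [A] ∧ A < κ.B ∧ IsRow κ G A fun x K => φ.defect x fun j => κ.cand j x K) →
      s.T = pushAll κ.B l T → s.skel = φ.skeleton ++ rest → s.S < κ.B ^ i →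
      κ.B ^ (i + φ.nodes) ≤ P → RunN P opStep φ.nodes s (EvalPost κ G s φ.nodes T rest
        fun x K => φ.defect x fun j => κ.cand j x K) := by
    rintro φ h1 h2 G s i T l rest h ⟨A, rfl, hA, hr⟩ hT hk hS hP
    rw [h1] at hP ⊢
    exact (run_mark h hA hr hT (by rw [hk, h2]; rfl) hS hP).toRunN
  intro φ
  induction φ with
  | ineq a c b => exact fun h hL hT hk _ hS hP => leaf _ rfl rfl h hL hT hk hS hP
  | congr a c r M hr => exact fun h hL hT hk _ hS hP => leaf _ rfl rfl h hL hT hk hS hP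
  | ncongr a c r M hr => exact fun h hL hT hk _ hS hP => leaf _ rfl rfl h hL hT hk hS hP
  | and φ ψ ihφ ihψ =>
    exact bin φ ψ _ .and rfl rfl (fun _ _ => Iff.rfl) (fun h hA hC hr hr' hS hk hW hSi hP => by
      simpa only [Formula.defect] using run_and h hN0 hA hC hr hr' hS hk hW hBP hSi hP) ihφ ihψ
  | or φ ψ ihφ ihψ =>
    exact bin φ ψ _ .or rfl rfl (fun _ _ => Iff.rfl) (fun h hA hC hr hr' hS hk hW hSi hP => by
      simpa only [Formula.defect] using run_or h hN0 hA hC hr hr' hS hk hW hBP hSi hP) ihφ ihψ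

end Cmd

/-! ### The selection of a solution -/

/-- The last zero of `Z` below a bound (zero if there is none). -/
def pick (Z : ℕ → ℤ) : ℕ → ℕ
  | 0 => 0
  | K + 1 => if Z K = 0 then K else pick Z K

theorem pick_spec {Z : ℕ → ℤ} {k : ℕ} (h : ∃ K < k, Z K = 0) : pick Z k < k ∧ Z (pick Z k) = 0 := by
  induction k with
  | zero => obtain ⟨K, hK, _⟩ := h; omega
  | succ k ih =>
    rw [pick]
    split
    · exact ⟨by omega, by assumption⟩
    · obtain ⟨K, hK, hZ⟩ := h
      obtain ⟨h₁, h₂⟩ := ih ⟨K, by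
        rcases Nat.lt_succ_iff_lt_or_eq.mp hK with h | rfl
        · exact h
        · contradiction, hZ⟩
      exact ⟨by omega, h₂⟩

namespace Cmd

variable {κ : Par} {G : List Gate} {s : St} {P : ℕ}

theorem _root_.PFnS.Inv.gate {c : Cmd} {l : List Cmd} {R : St → Prop} {g : Gate} (h : Inv κ G s)
    (he : Emits P c s g) (hg : g.WellFormed s.W) (hP : s.W + 1 ≤ P)
    (hR : ∀ t G', G <+: G' → Inv κ G' t → t.W = s.W + 1 → t.K = s.K → t.y = s.y → t.S = s.S →
      t.a = s.a → (∀ x : Fin κ.n → ℤ, wire G' x s.W = g.eval (wire G x)) →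
      (∀ x : Fin κ.n → ℤ, ∀ i < s.W, wire G' x i = wire G x i) → Run P (block l) t R) :
    Run P (block (c :: assign .W (Var.W + 1) :: l)) s R := by
  have hW := h.built.W
  have hlen := h.len
  refine (he s.k s.dn s.out).run_cons (Run.assign (s.W + 1) (by decide) (fun _ => ?_) ?_ ?_)
  · simp [St.get]; omega
  · simp [St.get]
  · refine hR _ (G ++ [g]) (List.prefix_append _ _) ⟨⟨?_, ?_, ?_⟩, h.n, h.m, h.H, h.Q, h.N, h.B, h.n₁,
      fun x => ?_, fun x => ?_, ?_⟩ rfl rfl rfl rfl rfl (fun x => ?_) fun x i hi => ?_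
    · simp [St.set, h.built.out]
    · simp [St.set, hW, add_assoc]
    · refine h.built.wf.append fun k hk => ?_
      obtain rfl : k = 0 := by simpa using hk
      simpa [← hW] using hg
    · rw [wire_append _ _ _ (by omega), h.one]
    · rw [wire_append _ _ _ (by omega), h.zero]
    · simp [St.set]; omega
    · rw [hW, wire_concat]
    · rw [wire_append _ _ _ (by omega)]

/-- Writes the gates that replace the previous wire `v` by the component of candidate `K` if this
candidate is a solution: `v + E(defect, y - v)`. -/
def selectOne : Cmd := block [
  emitLin (Var.y + Var.K) 0 1 (Var.W - 1), assign .W (Var.W + 1),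
  emitBin .zeroCond (Var.S + Var.K) (Var.W - 1), assign .W (Var.W + 1),
  emitLin (Var.W - 1) 1 0 (Var.W - 3), assign .W (Var.W + 1),
  assign .K (Var.K + 1)]

/-- Writes the gates that compute a component of a solution. -/
def select : Cmd := block [assign .K 0, loop .N selectOne,
  assign .y (Var.y + Var.N * (Var.n₁ + 2))]

theorem eval_linGate (A : ℕ) (z : ℤ) (C : ℕ) (w : ℕ → ℤ) :
    (linGate A z C).eval w = w A + z * w C := by
  simp [linGate, Gate.eval]

theorem good_lastWire (h : 1 ≤ P) : (Var.W - 1 : Expr).Good P s (s.W - 1) :=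
  ⟨by decide, by decide, fun _ => by simpa using h, rfl⟩

theorem good_one (h : 1 ≤ P) : (1 : Expr).Good P s 1 :=
  ⟨by decide, by decide, fun _ => by simpa using h, rfl⟩

theorem good_offset' {v : Var} (hv : v ≠ .k ∧ v ≠ .dn ∧ v ≠ .K) (h : s.get v + s.K ≤ P) :
    ((v : Expr) + Var.K : Expr).Good P s (s.get v + s.K) :=
  good_offset (s := s) hv h

/-- The wire before `W` carries component `j` of the last solution among the first `k` candidates. -/
def SelInv (κ : Par) (G : List Gate) (F : (Fin κ.n → ℤ) → ℕ → ℤ) (j V A a k : ℕ) (t : St) : Prop :=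
  ∃ G', G <+: G' ∧ Inv κ G' t ∧ t.W = V + 3 * k ∧ t.K = k ∧ t.y = κ.yAddr j ∧ t.S = A ∧ t.a = a ∧
    ∀ x, (∃ K < k, F x K = 0) → wire G' x (t.W - 1) = κ.cand j x (pick (F x) k)

theorem run_selectOne {F : (Fin κ.n → ℤ) → ℕ → ℤ} {j V A a k : ℕ} (hF : IsRow κ G A F)
    (hy : IsRow κ G (κ.yAddr j) (κ.cand j)) (hk : k < κ.N) (hP : V + 3 * κ.N ≤ P)
    (h : SelInv κ G F j V A a k s) : Run P selectOne s (SelInv κ G F j V A a (k + 1)) := by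
  obtain ⟨G₁, hG₁, hI₁, hW₁, hK₁, hy₁, hS₁, ha₁, hw₁⟩ := h
  have hlen := hI₁.len
  have hsW := hI₁.built.W
  have hF₁ := hF.mono hG₁
  have hyj₁ := hy.mono hG₁
  have b₁ := hF₁.1
  have b₂ := hyj₁.1
  refine hI₁.gate (emits_lin (by omega) (good_offset' (v := .y) (by decide) (by simp only [St.get]; omega))
    good_zero (good_one (by omega)) (good_lastWire (by omega))) (fun t ht => ?_) (by omega)
    fun t₂ G₂ hG₂ hI₂ hW₂ hK₂ hy₂ hS₂ ha₂ hw₂ ho₂ => ?_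
  · simp only [List.mem_cons, List.not_mem_nil, or_false] at ht
    rcases ht with rfl | rfl
    · simp only [St.get]; omega
    · change s.W - 1 < s.W; omega
  refine hI₂.gate (emits_zeroCond (by omega) (good_offset' (v := .S) (by decide) (by
    simp only [St.get]; omega)) (good_lastWire (by omega))) ⟨?_, ?_⟩
    (by omega) fun t₃ G₃ hG₃ hI₃ hW₃ hK₃ hy₃ hS₃ ha₃ hw₃ ho₃ => ?_
  · simp only [St.get]; omega
  · omega
  refine hI₃.gate (emits_lin (by omega) (good_lastWire (by omega)) (good_one (by omega)) good_zero
    (x := 1) (c := s.W - 1) ⟨by decide, by decide, fun _ => by simp; omega, ?_⟩) (fun t ht => ?_)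
    (by omega) fun t₄ G₄ hG₄ hI₄ hW₄ hK₄ hy₄ hS₄ ha₄ hw₄ ho₄ => ?_
  · simp [St.get]; omega
  · simp only [List.mem_cons, List.not_mem_nil, or_false] at ht
    rcases ht with rfl | rfl <;> omega
  refine Run.assign (k + 1) (by decide) (fun _ => ?_) ?_ (Run.nil ⟨_, ((hG₁.trans hG₂).trans
    hG₃).trans hG₄, hI₄.set rfl _, ?_, rfl, ?_, ?_, ?_, fun x hx => ?_⟩)
  · simp [St.get, hK₁, hK₂, hK₃, hK₄]; omega
  · simp [St.get, hK₁, hK₂, hK₃, hK₄]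
  · simp only [St.set]; omega
  · exact hy₄.trans (hy₃.trans (hy₂.trans hy₁))
  · exact hS₄.trans (hS₃.trans (hS₂.trans hS₁))
  · exact ha₄.trans (ha₃.trans (ha₂.trans ha₁))
  · have hy' : s.get .y + s.K = κ.yAddr j + k := congrArg₂ (· + ·) hy₁ hK₁
    have hS' : t₂.get .S + t₂.K = A + k := congrArg₂ (· + ·) (hS₂.trans hS₁) (hK₂.trans hK₁)
    have e₂ := hw₂ x
    have e₃ := hw₃ x
    have e₄ := hw₄ x
    rw [eval_linGate, hy', hyj₁.2 x k hk] at e₂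
    simp only [Gate.eval, hS', ho₂ x (A + k) (by omega), hF₁.2 x k hk] at e₃
    rw [show t₂.W - 1 = s.W by omega, e₂] at e₃
    rw [eval_linGate, show t₃.W - 1 = t₂.W by omega, e₃, ho₃ x _ (by omega), ho₂ x _ (by omega)] at e₄
    simp only [St.set]
    rw [show t₄.W - 1 = t₃.W by omega, e₄, pick]
    split
    · push_cast; ring
    · obtain ⟨K, hK, hZ⟩ := hx
      have hK' : K < k := by
        rcases Nat.lt_succ_iff_lt_or_eq.mp hK with h | rfl
        · exact h
        · contradiction
      rw [hw₁ x ⟨K, hK', hZ⟩]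
      push_cast; ring

/-- The outputs for the components below `j` have been computed. -/
def OutInv (κ : Par) (G : List Gate) (F : (Fin κ.n → ℤ) → ℕ → ℤ) (V A j : ℕ) (t : St) : Prop :=
  ∃ G', G <+: G' ∧ Inv κ G' t ∧ t.W = V + 3 * κ.N * j ∧ t.y = κ.yAddr j ∧ t.S = A ∧ t.a = V ∧
    ∀ j' < j, ∀ x, (∃ K < κ.N, F x K = 0) →
      wire G' x (V + 3 * κ.N * (j' + 1) - 1) = κ.cand j' x (pick (F x) κ.N)

theorem run_select {F : (Fin κ.n → ℤ) → ℕ → ℤ} {V A j : ℕ} (hF : IsRow κ G A F) (hN0 : 0 < κ.N)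
    (hy : CandRows κ G) (hj : j < κ.m) (hP : V + 3 * κ.N * κ.m ≤ P) (hyP : κ.yAddr κ.m ≤ P)
    (h : OutInv κ G F V A j s) : Run P select s (OutInv κ G F V A (j + 1)) := by
  obtain ⟨G₁, hG₁, hI₁, hW₁, hy₁, hS₁, ha₁, hw₁⟩ := h
  have hyj : κ.yAddr (j + 1) ≤ P := by
    refine le_trans ?_ hyP
    simp only [Par.yAddr]
    gcongr
    omega
  have hVP : V + 3 * κ.N * j + 3 * κ.N ≤ P := by
    have : 3 * κ.N * (j + 1) ≤ 3 * κ.N * κ.m := by gcongr; omega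
    linarith
  refine Run.assign 0 (by decide) (fun _ => by simp) rfl ?_
  refine Run.cons (Run.loop (k := κ.N) (by exact hI₁.N)
    (fun k => SelInv κ G₁ F j (V + 3 * κ.N * j) A V k) ?_ fun k hk t ht => ?_) ?_
  · exact ⟨G₁, List.prefix_rfl, hI₁.set rfl _, hW₁, rfl, hy₁, hS₁, ha₁,
      fun x ⟨K, hK, _⟩ => absurd hK (Nat.not_lt_zero K)⟩
  · exact run_selectOne (hF.mono hG₁) (hy.mono hG₁ j hj) hk hVP ht
  · rintro t ⟨G₂, hG₂, hI₂, hW₂, -, hy₂, hS₂, ha₂, hw₂⟩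
    refine run_next_y hI₂ hN0 hyj hy₂ fun hI₃ => Run.nil ⟨G₂, hG₁.trans hG₂, hI₃, ?_, rfl, hS₂, ha₂,
      fun j' hj' x hx => ?_⟩
    · simp only [St.set]; rw [hW₂]; ring
    · rcases Nat.lt_succ_iff_lt_or_eq.mp hj' with hlt | rfl
      · obtain ⟨E, rfl⟩ := hG₂
        rw [wire_append, hw₁ j' hlt x hx]
        have : 3 * κ.N * (j' + 1) ≤ 3 * κ.N * j := by gcongr; omega
        have := hI₁.len
        rw [← hI₁.built.W]
        omega
      · rw [← hw₂ x hx, hW₂]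
        congr 1
        rw [mul_add, mul_one, ← add_assoc]

/-- Writes an output. -/
def writeOutput : Cmd := block [assign .a (Var.a + (Var.N + Var.N + Var.N)), push .out .output,
  emitNat (Var.a - 1)]

/-- The string of the outputs that are the last of `3 N` wires each. -/
def outputString (N V j : ℕ) : List Sym :=
  (List.range j).flatMap fun j' => Sym.output :: encodeNat (V + 3 * N * (j' + 1) - 1)

theorem run_writeOutput {N V j : ℕ} {w : List Sym} (hP2 : 2 ≤ P) (hP : V + 3 * N * (j + 1) ≤ P)
    (hN : s.N = N) (ha : s.a = V + 3 * N * j) (ho : s.out = (w ++ outputString N V j).reverse) :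
    Run P writeOutput s fun t => t.N = N ∧ t.a = V + 3 * N * (j + 1) ∧
      t.out = (w ++ outputString N V (j + 1)).reverse := by
  have e : 3 * N * (j + 1) = 3 * N * j + N + N + N := by ring
  refine Run.assign (V + 3 * N * (j + 1)) (by decide) (fun _ => ?_) ?_ (Tr.push.run_cons
    ((tr_emitNat hP2 (by decide) fun _ => ?_).run_cons (Run.nil ⟨hN, rfl, ?_⟩)))
  · simp [St.get, hN, ha]; omega
  · simp [St.get, hN, ha]; omega
  · simp; omega
  · simp [St.get, St.set, St.setS, St.getS, ho, outputString, List.range_succ]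

end Cmd

/-! ### The generator -/

/-- The memory at the beginning. -/
def St.init (u : List Sym) : St :=
  ⟨0, 0, 0, 0, 0, 0, 0, 0, 0, 0, 0, 0, 0, 0, 0, 0, 0, 0, 0, 0, 0, u, [], []⟩

/-- The parameters for a formula with a string of length `L`. -/
def Par.of (n m L : ℕ) : Par :=
  let H := 2 ^ L ^ 4
  let N := (2 * H + 1) ^ (m * (n + 2))
  ⟨n, m, H, N, N * H⟩

namespace Cmd

/-- Computes the parameters. -/
def setup : List Cmd := [assign .H 1,
  loopS .inp (loopS .inp (loopS .inp (loopS .inp (assign .H (Var.H + Var.H))))),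
  readNat, assign .n Var.p, readNat, assign .m Var.p, assign .n₁ (Var.n + 1),
  assign .Q (Var.H + Var.H + 1), assign .N 1,
  loop .m (block [assign .N (Var.N * Var.Q), loop .n₁ (assign .N (Var.N * Var.Q))]),
  assign .B (Var.N * Var.H)]

/-- Writes the head of the circuit. -/
def header : List Cmd := [emitNat Var.n, emitNat Var.m, emitConst true, emitConst false,
  assign .W (Var.n₁ + 1), assign .D 1]

/-- Reads a formula and writes a circuit for a Skolem function. -/
def generator : Cmd := block (setup ++ (header ++ [loop .m candidate, loopS .inp leafStep,
  loopS .skel opStep, assign .a Var.W, assign .y yFirst, loop .m select, loop .m writeOutput]))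

variable {P : ℕ}

/-- If the body multiplies `H` by `2 ^ d`, then a loop over the input of length `L` multiplies it by
`2 ^ (L * d)`. -/
theorem tr_loopS_double {c : Cmd} {s : St} {L d : ℕ} (hL : s.inp.length = L) (hP : L ≤ P)
    (h : ∀ e, 2 ^ (e + d) ≤ P → Tr P c {s with H := 2 ^ e} {s with H := 2 ^ (e + d)}) (e : ℕ)
    (he : 2 ^ (e + L * d) ≤ P) :
    Tr P (loopS .inp c) {s with H := 2 ^ e} {s with H := 2 ^ (e + L * d)} := by
  refine Tr.loopS hL hP ?_
  have := TrN.of_seq (P := P) (c := c) (k := L) (fun i => {s with H := 2 ^ (e + i * d)})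
    fun i hi => ?_
  · simpa using this
  · refine (h (e + i * d) (le_trans (Nat.pow_le_pow_right (by norm_num) ?_) he)).of_eq ?_
    · have : (i + 1) * d ≤ L * d := by gcongr; omega
      linarith
    · rw [add_mul, one_mul, add_assoc]

theorem tr_power {s : St} {L : ℕ} (hL : s.inp.length = L) (hP : L ≤ P) (he : 2 ^ L ^ 4 ≤ P) :
    Tr P (loopS .inp (loopS .inp (loopS .inp (loopS .inp (assign .H (Var.H + Var.H))))))
      {s with H := 1} {s with H := 2 ^ L ^ 4} := by
  have h₀ : ∀ e, 2 ^ (e + 1) ≤ P →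
      Tr P (assign .H (Var.H + Var.H)) {s with H := 2 ^ e} {s with H := 2 ^ (e + 1)} := by
    intro e he
    rw [pow_succ] at he
    refine (Tr.assign (by decide) fun _ => ?_).of_eq ?_
    · simp [St.get]; omega
    · simp [St.get, St.set, pow_succ]; omega
  have h₁ := tr_loopS_double hL hP h₀
  have h₂ := tr_loopS_double hL hP h₁
  have h₃ := tr_loopS_double hL hP h₂
  have h₄ := tr_loopS_double hL hP h₃ 0
  have e : 0 + L * (L * (L * (L * 1))) = L ^ 4 := by ring
  rw [e] at h₄
  exact h₄ he

/-- The memory after the computation of the parameters. -/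
def SetupPost (κ : Par) (w : List Sym) (s : St) : Prop :=
  s.n = κ.n ∧ s.m = κ.m ∧ s.H = κ.H ∧ s.Q = κ.Q ∧ s.N = κ.N ∧ s.B = κ.B ∧ s.n₁ = κ.n + 1 ∧
    s.inp = w ∧ s.skel = [] ∧ s.out = [] ∧ s.S = 0 ∧ s.T = 0

theorem run_setup {u w : List Sym} {n m L : ℕ} (hu : u = encodeNat n ++ (encodeNat m ++ w))
    (hL : u.length = L) {l : List Cmd} {R : St → Prop} (hP : 2 ^ L ≤ P) (hn : n + 1 ≤ P)
    (hB : (Par.of n m L).B ≤ P) (hQ : (Par.of n m L).Q ≤ P)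
    (hR : ∀ s, SetupPost (Par.of n m L) w s → Run P (block l) s R) :
    Run P (block (setup ++ l)) (St.init u) R := by
  have hLP : L ≤ P := Nat.lt_two_pow_self.le.trans hP
  have h1P : 1 ≤ P := by omega
  set H := 2 ^ L ^ 4 with hH
  set Q := (Par.of n m L).Q with hQ'
  have hQ'' : Q = 2 * H + 1 := rfl
  have hNB : Q ^ (m * (n + 2)) * H ≤ P := hB
  have hHP : H ≤ P := by omega
  have hN : ∀ e ≤ m * (n + 2), Q ^ e ≤ P := fun e he =>
    calc Q ^ e ≤ Q ^ (m * (n + 2)) := Nat.pow_le_pow_right (by omega) he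
      _ ≤ Q ^ (m * (n + 2)) * H := Nat.le_mul_of_pos_right _ (by positivity)
      _ ≤ P := hNB
  refine Run.assign 1 (by decide) (fun _ => by simpa using h1P) rfl ?_
  refine (tr_power (s := St.init u) hL hLP hHP).run_cons ?_
  refine (tr_readNat (x := n) (rest := encodeNat m ++ w) hu (hL ▸ hP)).run_cons ?_
  refine Run.assign n (by decide) (fun _ => by simp) rfl ?_
  refine (tr_readNat (x := m) (rest := w) rfl ?_).run_cons ?_
  · refine le_trans (Nat.pow_le_pow_right (by norm_num) ?_) hP
    rw [← hL, hu]; simp [St.set]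
  refine Run.assign m (by decide) (fun _ => by simp) rfl ?_
  refine Run.assign (n + 1) (by decide) (fun _ => ?_) rfl ?_
  · simp [St.get, St.set]; omega
  refine Run.assign Q (by decide) (fun _ => ?_) ?_ ?_
  · simp [St.get, St.set]; omega
  · simp [St.get, St.set]; omega
  refine Run.assign 1 (by decide) (fun _ => by simpa using h1P) rfl ?_
  refine Run.cons (Run.loop (k := m) rfl (fun j s => s.n = n ∧ s.m = m ∧ s.H = H ∧ s.Q = Q ∧
      s.N = Q ^ (j * (n + 2)) ∧ s.n₁ = n + 1 ∧
    s.inp = w ∧ s.skel = [] ∧ s.out = [] ∧ s.S = 0 ∧ s.T = 0) ?_ ?_) ?_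
  · refine ⟨rfl, rfl, rfl, rfl, ?_, rfl, rfl, rfl, rfl, rfl, rfl⟩
    simp [St.set]
  · rintro j hj s ⟨h₁, h₂, h₃, h₄, h₅, h₆, h₇, h₈, h₉, h₁₀, h₁₁⟩
    have hj' : j * (n + 2) + (n + 2) ≤ m * (n + 2) := by nlinarith
    have step : ∀ {i : ℕ} {t : St}, i ≤ n + 1 → t.N = Q ^ (j * (n + 2) + i) → t.Q = Q →
        Tr P (assign .N (Var.N * Var.Q)) t (t.set .N (Q ^ (j * (n + 2) + (i + 1)))) := by
      intro i t hi htN htQ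
      refine (Tr.assign (by decide) fun _ => ?_).of_eq ?_
      · simp only [Expr.bdd_mul, Expr.bdd_var, true_and, Expr.eval_var]
        simp only [St.get, htN, htQ, ← pow_succ]
        exact hN _ (by omega)
      · simp only [Expr.eval_mul, Expr.eval_var]
        simp only [St.get, htN, htQ, ← pow_succ]
        rfl
    refine (step (i := 0) (by omega) h₅ h₄).run_cons (Run.cons (Run.loop (k := n + 1) (by exact h₆)
      (fun i s => s.n = n ∧ s.m = m ∧ s.H = H ∧ s.Q = Q ∧
      s.N = Q ^ (j * (n + 2) + (i + 1)) ∧ s.n₁ = n + 1 ∧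
      s.inp = w ∧ s.skel = [] ∧ s.out = [] ∧ s.S = 0 ∧ s.T = 0)
      ⟨h₁, h₂, h₃, h₄, rfl, h₆, h₇, h₈, h₉, h₁₀, h₁₁⟩ ?_) ?_)
    · rintro i hi t ⟨h₁, h₂, h₃, h₄, h₅, h₆, h₇, h₈, h₉, h₁₀, h₁₁⟩
      exact (step (by omega) h₅ h₄).toRun ⟨h₁, h₂, h₃, h₄, rfl, h₆, h₇, h₈, h₉, h₁₀, h₁₁⟩
    · rintro t ⟨h₁, h₂, h₃, h₄, h₅, h₆, h₇, h₈, h₉, h₁₀, h₁₁⟩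
      refine Run.nil ⟨h₁, h₂, h₃, h₄, ?_, h₆, h₇, h₈, h₉, h₁₀, h₁₁⟩
      rw [h₅]; congr 1; ring
  · rintro s ⟨h₁, h₂, h₃, h₄, h₅, h₆, h₇, h₈, h₉, h₁₀, h₁₁⟩
    refine Run.assign (Q ^ (m * (n + 2)) * H) (by decide) (fun _ => ?_) ?_
      (hR _ ⟨h₁, h₂, h₃, h₄, h₅, rfl, h₆, h₇, h₈, h₉, h₁₀, h₁₁⟩)
    · simp only [Expr.bdd_mul, Expr.bdd_var, true_and, Expr.eval_var]
      simp only [St.get, h₃, h₅]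
      exact hNB
    · simp only [Expr.eval_mul, Expr.eval_var]
      simp only [St.get, h₃, h₅]

theorem run_header {κ : Par} {s : St} {w : List Sym} (hs : SetupPost κ w s) {l : List Cmd}
    {R : St → Prop} (hP : κ.n + 2 ≤ P)
    (hR : ∀ t G, Inv κ G t → t.W = κ.n + 2 → t.D = 1 → t.inp = w → t.skel = [] → t.S = 0 → t.T = 0 →
      Run P (block l) t R) : Run P (block (header ++ l)) s R := by
  obtain ⟨h₁, h₂, h₃, h₄, h₅, h₆, h₇, h₈, h₉, h₁₀, h₁₁, h₁₂⟩ := hs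
  refine (tr_emitNat (by omega) (by decide) fun _ => by simp).run_cons ?_
  refine (tr_emitNat (by omega) (by decide) fun _ => by simp).run_cons ?_
  refine (tr_emitConst true _).run_cons ((tr_emitConst false _).run_cons ?_)
  refine Run.assign (κ.n + 2) (by decide) (fun _ => ?_) ?_ (Run.assign 1 (by decide) (fun _ => ?_) rfl ?_)
  · simp [St.get, h₇]; omega
  · simp [St.get, h₇]
  · simp; omega
  · have e₁ : ∀ x : Fin κ.n → ℤ, wire [Gate.linear [] 1, Gate.linear [] 0] x κ.n = 1 := fun x => by
      have := wire_concat [] (.linear [] 1) x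
      rw [show [Gate.linear [] 1, Gate.linear [] 0] = ([] ++ [Gate.linear [] 1]) ++ [.linear [] 0] from rfl,
        wire_append _ _ _ (by simp)]
      simpa [Gate.eval] using this
    have e₀ : ∀ x : Fin κ.n → ℤ, wire [Gate.linear [] 1, Gate.linear [] 0] x (κ.n + 1) = 0 := fun x => by
      have := wire_concat [.linear [] 1] (.linear [] 0) x
      simpa [Gate.eval] using this
    refine hR _ [.linear [] 1, .linear [] 0] ⟨⟨?_, rfl, ?_⟩, h₁, h₂, h₃, h₄, h₅, h₆, h₇, e₁, e₀, le_rfl⟩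
      rfl rfl h₈ h₉ h₁₁ h₁₂
    · simp [St.set, St.get, h₁, h₂, h₁₀]
    · intro k hk
      have : k = 0 ∨ k = 1 := by simp at hk; omega
      rcases this with rfl | rfl <;> simp [Gate.WellFormed]

theorem _root_.PFnS.Formula.nodes_le_length (φ : Formula n m) : φ.nodes ≤ φ.encodeTree.length := by
  induction φ with
  | ineq a c b => simp [Formula.nodes, Formula.encodeTree]
  | congr a c r M hr => simp [Formula.nodes, Formula.encodeTree]
  | ncongr a c r M hr => simp [Formula.nodes, Formula.encodeTree]
  | and φ ψ ihφ ihψ => simp [Formula.nodes, Formula.encodeTree]; omega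
  | or φ ψ ihφ ihψ => simp [Formula.nodes, Formula.encodeTree]; omega

theorem _root_.PFnS.Formula.length_skeleton (φ : Formula n m) : φ.skeleton.length = φ.nodes := by
  induction φ with
  | ineq a c b => rfl
  | congr a c r M hr => rfl
  | ncongr a c r M hr => rfl
  | and φ ψ ihφ ihψ => simp [Formula.nodes, Formula.skeleton, ihφ, ihψ]; omega
  | or φ ψ ihφ ihψ => simp [Formula.nodes, Formula.skeleton, ihφ, ihψ]; omega

/-- The part of the generator after the parameters and the head of the circuit have been dealt with. The
circuit computes a solution whenever some candidate is one. -/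
theorem run_main {κ : Par} (φ : Formula κ.n κ.m) {s : St} {G : List Gate}
    (hN : κ.N = κ.Q ^ (κ.m * (κ.n + 2))) (hB : κ.B = κ.N * κ.H)
    (hH : 2 * (κ.n + 2) + (κ.n + 3) * κ.m + (κ.n + κ.m + 5) * φ.nodes + 2 * φ.nodes + 3 * κ.m ≤ κ.H)
    (hP : κ.B ^ (φ.nodes + 1) ≤ P) (hLP : 2 ^ φ.encodeTree.length ≤ P)
    (hI : Inv κ G s) (hW : s.W = κ.n + 2) (hD : s.D = 1) (hi : s.inp = φ.encodeTree)
    (hk : s.skel = []) (hS : s.S = 0) (hT : s.T = 0) :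
    Run P (block [loop .m candidate, loopS .inp leafStep, loopS .skel opStep, assign .a Var.W,
      assign .y yFirst, loop .m select, loop .m writeOutput]) s fun t => ∃ C : Circuit κ.n κ.m,
      t.out = C.encode.reverse ∧
      ∀ x, (∃ K < κ.N, φ.Holds x fun j => κ.cand j x K) → φ.Holds x (C.eval x) := by
  have hQ0 : 0 < κ.Q := by simp [Par.Q]
  have hN0 : 0 < κ.N := by rw [hN]; positivity
  have hB0 : 0 < κ.B := by rw [hB]; exact Nat.mul_pos hN0 (by omega)
  have hBP : κ.B ≤ P := le_trans (Nat.le_self_pow (by omega) _) hP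
  have hLP' : φ.encodeTree.length ≤ P := Nat.lt_two_pow_self.le.trans hLP
  have hpow : κ.B ^ (0 + φ.nodes) ≤ P := (Nat.pow_le_pow_right hB0 (by omega)).trans hP
  -- the total number of wires is at most `B`
  have htot : κ.n + 2 + κ.N * ((κ.n + 3) * κ.m) + κ.N * (κ.n + κ.m + 5) * φ.nodes +
      κ.N * 2 * φ.nodes + 3 * κ.N * κ.m + κ.N * (κ.n + 2) ≤ κ.B := by
    have h₁ := Nat.mul_le_mul_left κ.N hH
    rw [← hB] at h₁
    have h₂ : κ.n + 2 ≤ κ.N * (κ.n + 2) := Nat.le_mul_of_pos_left _ hN0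
    nlinarith
  have hyP : κ.yAddr κ.m ≤ P := by
    refine le_trans ?_ hBP
    refine le_trans ?_ htot
    have : κ.m * (κ.N * (κ.n + 3)) = κ.N * ((κ.n + 3) * κ.m) := by ring
    simp only [Par.yAddr, this]
    omega
  -- the components of the candidates
  refine Run.cons (Run.loop (k := κ.m) (by exact hI.m) (CandInv κ s) ?_ fun j hj t ht =>
    run_candidate hj hN (by omega) ht) ?_
  · exact ⟨G, hI, by simp [hW], by simp [hD], by simp, rfl, rfl, rfl, rfl⟩
  rintro t₁ ⟨G₁, hI₁, hW₁, -, hy₁, hi₁, hk₁, hS₁, hT₁⟩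
  rw [hi] at hi₁
  -- the leaves; the loop runs for the length of the string, and is idle after `φ.nodes` rounds
  refine Run.cons (R := ReadPost κ G₁ t₁ 0 [] φ) (Run.loopS rfl
    (by simp only [St.getS, hi₁]; exact hLP') ?_) ?_
  · obtain ⟨d, hd⟩ := Nat.exists_eq_add_of_le φ.nodes_le_length
    simp only [St.getS, hi₁]
    rw [hd]
    refine (runN_leafStep hN0 hB0 hyP hBP φ (j := 0) (rest := []) hI₁ hy₁ (by simp [hi₁])
      (by rw [hi₁]; exact hLP) (by omega) (by simp [hT₁, hT]) hpow).add fun t ht => ?_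
    refine RunN.const (Tr.pop none ?_ (Tr.skip.of_eq ?_)) ht
    · obtain ⟨_, _, _, _, h, _⟩ := ht
      simp [St.getS, h]
    · obtain ⟨_, _, _, _, h, _⟩ := ht
      simp only [St.setS, St.getS, h, List.tail_nil]
      rw [← h]
  rintro t₂ ⟨G₂, l, hG₂, hI₂, hi₂, hW₂, hk₂, hS₂, hl₂, hT₂, hb₂⟩
  have hk₂' : t₂.skel = φ.skeleton := by rw [hk₂, hk₁, hk, List.append_nil]
  -- the connectives
  refine Run.cons (R := EvalPost κ G₂ t₂ φ.nodes t₁.T [] fun x K => φ.defect x fun j => κ.cand j x K)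
    (Run.loopS (k := φ.nodes) (by simp only [St.getS, hk₂']; exact φ.length_skeleton)
      (φ.nodes_le_length.trans hLP')
    (runN_opStep hN0 hB0 hBP φ (i := 0) (rest := []) hI₂ hl₂ hT₂ (by simp [hk₂']) (by omega)
      (by simp [hS₂, hS₁, hS]) hpow)) ?_
  rintro t₃ ⟨G₃, A, hG₃, hI₃, hi₃, hW₃, hk₃, hT₃, hA, hr₃, hS₃⟩
  -- the only row left on the stack `S`, that of the whole formula, is the register `S` itself
  have hS₃' : t₃.S = A := by rw [hS₃, hS₂, hS₁, hS]; simp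
  have hy₃ : CandRows κ G₃ := CandRows.mono (CandRows.mono hy₁ hG₂) hG₃
  refine Run.assign t₃.W (by decide) (fun _ => by simp) rfl ?_
  have hI₃' := hI₃.set (v := .a) rfl t₃.W
  refine Run.assign (κ.yAddr 0) (by decide) (fun _ => hI₃'.bdd_yFirst ?_) hI₃'.eval_yFirst ?_
  · refine le_trans ?_ hyP
    simp [Par.yAddr]
  have hV : t₃.W + 3 * κ.N * κ.m ≤ P := by omega
  -- the selection of the outputs
  refine Run.cons (Run.loop (k := κ.m) (by exact hI₃.m)
    (OutInv κ G₃ (fun x K => φ.defect x fun j => κ.cand j x K) t₃.W A) ?_ fun j hj t ht =>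
      run_select hr₃ hN0 hy₃ hj hV hyP ht) ?_
  · exact ⟨G₃, List.prefix_rfl, hI₃'.set rfl _, rfl, rfl, hS₃', rfl, by simp⟩
  rintro t₄ ⟨G₄, hG₄, hI₄, hW₄, hy₄, hS₄, ha₄, hw₄⟩
  refine Run.cons (Run.loop (k := κ.m) (by exact hI₄.m) (fun j t => t.N = κ.N ∧ t.a = t₃.W + 3 * κ.N * j ∧
    t.out = (encodeNat κ.n ++ encodeNat κ.m ++ G₄.flatMap Gate.encode ++
      outputString κ.N t₃.W j).reverse) ?_ fun j hj t ht => ?_) ?_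
  · exact ⟨hI₄.N, ha₄, by simp [hI₄.built.out, outputString]⟩
  · have : 3 * κ.N * (j + 1) ≤ 3 * κ.N * κ.m := by gcongr; omega
    have := hI₄.len
    exact run_writeOutput (by omega) (by omega) ht.1 ht.2.1 ht.2.2
  rintro t₅ ⟨-, -, ho₅⟩
  have hpos := hI₃.len
  refine Run.nil ⟨⟨G₄, fun j => t₃.W + 3 * κ.N * (j + 1) - 1, hI₄.built.wf, fun j => ?_⟩, ?_, ?_⟩
  · rw [← hI₄.built.W, hW₄]
    have : 3 * κ.N * (j + 1) ≤ 3 * κ.N * κ.m := by have := j.2; gcongr; omega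
    omega
  · rw [ho₅, Circuit.encode]
    congr 2
    rw [outputString, ← List.map_coe_finRange_eq_range, List.ofFn_eq_map, List.flatMap_map,
      List.flatMap_map]
  · rintro x ⟨K, hK, hx⟩
    have hz : ∃ K < κ.N, (φ.defect x fun j => κ.cand j x K) = 0 :=
      ⟨K, hK, (φ.defect_spec x _).2.mpr hx⟩
    have hp := (pick_spec hz).2
    refine (φ.defect_spec x _).2.mp ?_
    convert hp using 2
    funext j
    exact hw₄ j j.2 x hz

/-- The generator writes a circuit that computes a solution whenever some candidate is one. -/
theorem run_generator (φ : Formula n m) {κ : Par} (hκ : κ = Par.of n m φ.encode.length)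
    (hH : 2 * (n + 2) + (n + 3) * m + (n + m + 5) * φ.nodes + 2 * φ.nodes + 3 * m ≤ κ.H)
    (hP : κ.B ^ (φ.nodes + 1) ≤ P) (hLP : 2 ^ φ.encode.length ≤ P) (hQP : κ.Q ≤ P) :
    Run P generator (St.init φ.encode) fun t => ∃ C : Circuit n m, t.out = C.encode.reverse ∧
      ∀ x : Fin n → ℤ, (∃ K < κ.N, φ.Holds x fun j =>
        (Par.of n m φ.encode.length).cand j x K) → φ.Holds x (C.eval x) := by
  subst hκ
  have hBP : (Par.of n m φ.encode.length).B ≤ P := le_trans (Nat.le_self_pow (by omega) _) hP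
  have hHB : (Par.of n m φ.encode.length).H ≤ (Par.of n m φ.encode.length).B :=
    Nat.le_mul_of_pos_left _ (by positivity)
  refine run_setup (w := φ.encodeTree) (by simp [Formula.encode]) rfl hLP (by omega) hBP hQP
    fun s hs => ?_
  have hlen : φ.encodeTree.length ≤ φ.encode.length := by simp [Formula.encode]; omega
  have hn : (Par.of n m φ.encode.length).n = n := rfl
  refine run_header hs (by omega) fun t G hI hW hD hi hk hS hT => ?_
  exact run_main (κ := Par.of n m φ.encode.length) φ rfl rfl hH hP
    (le_trans (Nat.pow_le_pow_right (by norm_num) hlen) hLP)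
    hI hW hD hi hk hS hT

end Cmd

/-! ### Small integer vectors in kernels -/

/-- An integer matrix with more columns than rows and entries of absolute value at most `A` has a
nonzero integer vector with small entries in its kernel (Siegel's lemma). -/
theorem exists_small_kernel_vec {k m : ℕ} (hkm : k < m) (C : Matrix (Fin k) (Fin m) ℤ) {A : ℕ}
    (hA1 : 1 ≤ A) (hA : ∀ i j, |C i j| ≤ A) :
    ∃ v : Fin m → ℤ, v ≠ 0 ∧ C.mulVec v = 0 ∧ ∀ j, |v j| ≤ (m * A : ℕ) ^ m := by
  have hmA : (1 : ℝ) ≤ m * A := by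
    have : 1 ≤ m * A := Nat.mul_pos (by omega) hA1
    exact_mod_cast this
  rcases Nat.eq_zero_or_pos k with rfl | hk
  · refine ⟨fun _ => 1, fun h => ?_, Subsingleton.elim _ _, fun j => ?_⟩
    · simpa using congrFun h ⟨0, hkm⟩
    · rw [abs_one]
      exact_mod_cast Nat.one_le_pow _ _ (Nat.mul_pos hkm hA1)
  · obtain ⟨v, h0, hv, hle⟩ := Int.Matrix.exists_ne_zero_int_vec_norm_le C (by simpa using hkm)
      (by simpa using hk)
    refine ⟨v, h0, hv, fun j => ?_⟩
    have hC : @norm _ Matrix.seminormedAddCommGroup.toNorm C ≤ (A : ℝ) := by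
      refine (Matrix.norm_le_iff (Nat.cast_nonneg A)).mpr fun i j => ?_
      rw [Int.norm_eq_abs]
      exact_mod_cast hA i j
    simp only [Fintype.card_fin] at hle
    have h₁ : ‖v j‖ ≤ (m * A : ℝ) ^ ((k : ℝ) / (m - k)) := by
      refine (norm_le_pi_norm v j).trans (hle.trans ?_)
      refine Real.rpow_le_rpow (by positivity) ?_ ?_
      · gcongr
        exact max_le (by exact_mod_cast hA1) hC
      · have : (k : ℝ) < m := by exact_mod_cast hkm
        exact div_nonneg (Nat.cast_nonneg _) (by linarith)
    have h₂ : (m * A : ℝ) ^ ((k : ℝ) / (m - k)) ≤ (m * A : ℝ) ^ (m : ℝ) := by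
      refine Real.rpow_le_rpow_of_exponent_le hmA ?_
      have : (k : ℝ) + 1 ≤ m := by exact_mod_cast hkm
      rw [div_le_iff₀ (by linarith)]
      nlinarith
    rw [Real.rpow_natCast] at h₂
    rw [Int.norm_eq_abs] at h₁
    exact_mod_cast h₁.trans h₂

/-! ### Solutions at which many inequalities are nearly tight -/

/-- A linear inequality `∑ aᵢ xᵢ + ∑ cⱼ yⱼ + b ≥ 0`. -/
structure LinIneq (n m : ℕ) : Type where
  a : Fin n → ℤ
  c : Fin m → ℤ
  b : ℤ

/-- The left-hand side of the inequality. -/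
def LinIneq.slack {n m : ℕ} (r : LinIneq n m) (x : Fin n → ℤ) (y : Fin m → ℤ) : ℤ :=
  linForm r.a r.c x y + r.b

open Matrix in
theorem LinIneq.slack_add (r : LinIneq n m) (x : Fin n → ℤ) (y v : Fin m → ℤ) (t : ℤ) :
    r.slack x (y + t • v) = r.slack x y + t * (r.c ⬝ᵥ v) := by
  simp only [slack, linForm, dotProduct, Pi.add_apply, Pi.smul_apply, smul_eq_mul, mul_add,
    Finset.sum_add_distrib, Finset.mul_sum]
  have : ∑ j, r.c j * (t * v j) = ∑ j, t * (r.c j * v j) :=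
    Finset.sum_congr rfl fun j _ => by ring
  rw [this]; ring

open Matrix in
/-- A solution can be moved, within its residue class, to a solution at which `k` linearly independent
inequalities are nearly tight: as long as `k < m`, move along a small vector in the kernel of the
inequalities found so far, until another inequality would be violated. -/
theorem exists_nearly_tight {T : Set (LinIneq n m)} {x : Fin n → ℤ} {A M : ℕ} (hA1 : 1 ≤ A) (hM : 1 ≤ M)
    (hA : ∀ r ∈ T, ∀ j, |r.c j| ≤ A)
    (hspan : ∀ v : Fin m → ℤ, (∀ r ∈ T, r.c ⬝ᵥ v = 0) → v = 0)
    {y : Fin m → ℤ} (hy : ∀ r ∈ T, 0 ≤ r.slack x y) : ∀ k ≤ m, ∃ y' : Fin m → ℤ,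
      (∀ j, (M : ℤ) ∣ y' j - y j) ∧ (∀ r ∈ T, 0 ≤ r.slack x y') ∧ ∃ r : Fin k → LinIneq n m,
      (∀ i, r i ∈ T ∧ (r i).slack x y' ≤ (M * (m * A * (m * A) ^ m) : ℕ)) ∧
      ∀ g : Fin k → ℤ, ∑ i, g i • (r i).c = 0 → g = 0 := by
  intro k
  induction k with
  | zero => exact fun _ => ⟨y, by simp, hy, Fin.elim0, fun i => i.elim0, fun g _ => Subsingleton.elim _ _⟩
  | succ k ih =>
    intro hk
    obtain ⟨y', hmod, hy', r, hr, hind⟩ := ih (by omega)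
    obtain ⟨v, h0, hv, hle⟩ := exists_small_kernel_vec (by omega : k < m) (Matrix.of fun i => (r i).c)
      hA1 fun i j => hA _ (hr i).1 j
    have hv' : ∀ i, (r i).c ⬝ᵥ v = 0 := fun i => congrFun hv i
    -- some inequality is violated far away in the direction of `v` or of `-v`
    obtain ⟨w, hw, hwle, r₀, hr₀, hneg⟩ : ∃ w : Fin m → ℤ, (∀ i, (r i).c ⬝ᵥ w = 0) ∧
        (∀ j, |w j| ≤ (m * A : ℕ) ^ m) ∧ ∃ r₀ ∈ T, r₀.c ⬝ᵥ w < 0 := by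
      by_contra! hcon
      refine h0 (hspan v fun r₀ hr₀ => le_antisymm ?_ (hcon v hv' hle r₀ hr₀))
      have := hcon (-v) (fun i => by rw [dotProduct_neg, hv' i, neg_zero])
        (fun j => by rw [Pi.neg_apply, abs_neg]; exact hle j) r₀ hr₀
      rw [dotProduct_neg] at this
      omega
    -- at the last multiple of `M • w` before the first violation, the violated `r₁` is nearly tight
    have hex : ∃ t : ℕ, ∃ r₁ ∈ T, r₁.slack x (y' + ((t * M : ℕ) : ℤ) • w) < 0 := by
      refine ⟨(r₀.slack x y').toNat + 1, r₀, hr₀, ?_⟩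
      rw [LinIneq.slack_add]
      have h₁ := hy' r₀ hr₀
      have h₂ : (r₀.slack x y') < ((((r₀.slack x y').toNat + 1) * M : ℕ) : ℤ) := by
        have : (r₀.slack x y').toNat + 1 ≤ ((r₀.slack x y').toNat + 1) * M :=
          Nat.le_mul_of_pos_right _ hM
        omega
      nlinarith
    classical
    obtain ⟨r₁, hr₁, hlt⟩ := Nat.find_spec hex
    have hmin := fun t => @Nat.find_min _ _ hex t
    set t := Nat.find hex with ht
    have ht0 : t ≠ 0 := by
      intro h
      rw [h] at hlt
      have := hy' r₁ hr₁
      simp at hlt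
      omega
    obtain ⟨t', ht'⟩ := Nat.exists_eq_succ_of_ne_zero ht0
    have hok := hmin t' (by omega)
    push Not at hok
    rw [LinIneq.slack_add] at hlt
    have hlt' := hok r₁ hr₁
    rw [LinIneq.slack_add] at hlt'
    have hneg₁ : r₁.c ⬝ᵥ w < 0 := by
      by_contra hge
      have := hy' r₁ hr₁
      have := mul_nonneg (Nat.cast_nonneg (α := ℤ) (t * M)) (not_lt.mp hge)
      omega
    refine ⟨y' + ((t' * M : ℕ) : ℤ) • w, fun j => ?_, hok, Fin.cons r₁ r, fun i => ?_, fun g hg => ?_⟩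
    · have := hmod j
      have e : (y' + ((t' * M : ℕ) : ℤ) • w) j - y j = (y' j - y j) + M * (t' * w j) := by
        simp; ring
      rw [e]
      exact dvd_add this (dvd_mul_right _ _)
    · refine Fin.cases ⟨hr₁, ?_⟩ (fun i => ⟨(hr i).1, ?_⟩) i
      · simp only [Fin.cons_zero]
        rw [LinIneq.slack_add]
        have hdot : -(r₁.c ⬝ᵥ w) ≤ (m * A * (m * A) ^ m : ℕ) := by
          refine (neg_le_abs _).trans ((Finset.abs_sum_le_sum_abs _ _).trans ?_)
          calc ∑ j, |r₁.c j * w j| ≤ ∑ _j : Fin m, (A : ℤ) * ((m * A : ℕ) ^ m : ℤ) :=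
                Finset.sum_le_sum fun j _ => by
                  rw [abs_mul]
                  exact mul_le_mul (hA _ hr₁ j) (hwle j) (abs_nonneg _) (by positivity)
            _ = _ := by simp; ring
        rw [ht', Nat.succ_mul] at hlt
        push_cast at hlt hdot ⊢
        nlinarith
      · simp only [Fin.cons_succ]
        rw [LinIneq.slack_add, hw i, mul_zero, add_zero]
        exact (hr i).2
    · -- independence: `w` is orthogonal to the old inequalities, but not to `r₁`
      rw [Fin.sum_univ_succ] at hg
      simp only [Fin.cons_zero, Fin.cons_succ] at hg
      have h₁ : g 0 * (r₁.c ⬝ᵥ w) = 0 := by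
        have := congrArg (· ⬝ᵥ w) hg
        simp only [add_dotProduct, sum_dotProduct, smul_dotProduct, hw, mul_zero,
          Finset.sum_const_zero, add_zero, zero_dotProduct, smul_eq_mul] at this
        exact this
      have h₂ : g 0 = 0 := by
        rcases mul_eq_zero.mp h₁ with h | h
        · exact h
        · omega
      rw [h₂, zero_smul, zero_add] at hg
      have h₃ := hind (fun i => g i.succ) hg
      funext i
      exact Fin.cases h₂ (fun i => congrFun h₃ i) i

/-! ### Components as rounded affine functions -/

/-- The integer is given by an affine function of `x` that is divided by a positive number. The
coefficients are at most `H` in absolute value, and the denominator is at most `2 H + 1`. -/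
def IsRounded (H : ℕ) (x : Fin n → ℤ) (z : ℤ) : Prop :=
  ∃ (α : Fin n → ℤ) (β : ℤ) (d : ℕ), (∀ i, |α i| ≤ H) ∧ |β| ≤ H ∧ 0 < d ∧ d ≤ 2 * H + 1 ∧
    z = Int.fdiv (∑ i, α i * x i + β) d

open Matrix in
/-- Cramer's rule: given the slacks, the nearly tight inequalities are linear equations for `y`. Since
the slacks are small, they can be absorbed into the constant terms. The division is exact, rounding is
only a matter of form. -/
theorem isRounded_of_nearly_tight {x : Fin n → ℤ} {y : Fin m → ℤ} {r : Fin m → LinIneq n m}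
    {A D H : ℕ} (hA1 : 1 ≤ A) (ha : ∀ i j, |(r i).a j| ≤ A) (hc : ∀ i j, |(r i).c j| ≤ A)
    (hb : ∀ i, |(r i).b| ≤ A) (h0 : ∀ i, 0 ≤ (r i).slack x y) (hD : ∀ i, (r i).slack x y ≤ D)
    (hind : ∀ g : Fin m → ℤ, ∑ i, g i • (r i).c = 0 → g = 0)
    (hH : m * (m.factorial * A ^ m) * (D + A) ≤ H) (j : Fin m) : IsRounded H x (y j) := by
  classical
  set C : Matrix (Fin m) (Fin m) ℤ := Matrix.of fun i => (r i).c with hC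
  have hm : 0 < m := j.pos
  have hdet : C.det ≠ 0 := by
    intro h
    obtain ⟨v, hv0, hv⟩ := Matrix.exists_vecMul_eq_zero_iff.mpr h
    refine hv0 (hind v ?_)
    rw [← hv]
    funext k
    simp [vecMul, dotProduct, hC, Finset.sum_apply]
  set F : ℕ := m.factorial * A ^ m with hF
  have hF1 : 1 ≤ F := Nat.mul_pos (Nat.factorial_pos m) (by positivity)
  have hdetF : |C.det| ≤ F := by
    have := Matrix.det_le (A := C) (abv := AbsoluteValue.abs) (x := (A : ℤ)) fun i k => hc i k
    simpa [hF] using this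
  have hadj : ∀ i k, |C.adjugate i k| ≤ F := fun i k => by
    rw [adjugate_apply]
    have := Matrix.det_le (A := C.updateRow k (Pi.single i 1)) (abv := AbsoluteValue.abs)
      (x := (A : ℤ)) fun i' k' => ?_
    · simpa [hF] using this
    · rw [AbsoluteValue.abs_apply, updateRow_apply]
      split
      · rw [Pi.single_apply]
        split
        · rw [abs_one]; exact_mod_cast hA1
        · rw [abs_zero]; exact Nat.cast_nonneg _
      · exact hc _ _
  -- the equations `C y = slack - b - a x`, multiplied by the adjugate matrix
  have hCy : C.mulVec y = fun i => (r i).slack x y - (r i).b - ∑ k, (r i).a k * x k := by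
    funext i
    simp only [LinIneq.slack, linForm, mulVec, dotProduct, hC, of_apply]
    ring
  have hmain : C.det * y j = ∑ i, C.adjugate j i *
      ((r i).slack x y - (r i).b - ∑ k, (r i).a k * x k) := by
    have h₁ : (C.adjugate * C).mulVec y = C.det • y := by rw [adjugate_mul, smul_mulVec, one_mulVec]
    rw [← mulVec_mulVec, hCy] at h₁
    have := congrFun h₁ j
    simp only [mulVec, dotProduct, Pi.smul_apply, smul_eq_mul] at this
    exact this.symm
  -- multiplication by the sign of the determinant makes the denominator positive
  set σ : ℤ := C.det.sign with hσ
  have hσ1 : |σ| ≤ 1 := by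
    rcases lt_trichotomy C.det 0 with h | h | h
    · simp [hσ, Int.sign_eq_neg_one_of_neg h]
    · exact absurd h hdet
    · simp [hσ, Int.sign_eq_one_of_pos h]
  have hσd : σ * C.det = C.det.natAbs := by rw [hσ, Int.sign_mul_self_eq_natAbs]
  have hd0 : 0 < C.det.natAbs := Int.natAbs_pos.mpr hdet
  have hsum : ∀ (f : Fin m → ℤ) (E : ℕ), (∀ i, |f i| ≤ E) →
      |σ * ∑ i, C.adjugate j i * f i| ≤ (m * F * E : ℕ) := by
    intro f E hf
    rw [abs_mul]
    calc |σ| * |∑ i, C.adjugate j i * f i| ≤ 1 * |∑ i, C.adjugate j i * f i| :=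
          mul_le_mul_of_nonneg_right hσ1 (abs_nonneg _)
      _ ≤ ∑ i, |C.adjugate j i * f i| := by rw [one_mul]; exact Finset.abs_sum_le_sum_abs _ _
      _ ≤ ∑ _i : Fin m, (F * E : ℤ) := Finset.sum_le_sum fun i _ => by
          rw [abs_mul]
          exact mul_le_mul (hadj j i) (hf i) (abs_nonneg _) (by positivity)
      _ = (m * F * E : ℕ) := by simp; ring
  refine ⟨fun k => σ * ∑ i, C.adjugate j i * -(r i).a k,
    σ * ∑ i, C.adjugate j i * ((r i).slack x y - (r i).b), C.det.natAbs, fun k => ?_, ?_, hd0, ?_, ?_⟩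
  · refine (hsum (fun i => -(r i).a k) A fun i => by rw [abs_neg]; exact ha i k).trans ?_
    refine le_trans ?_ (Nat.cast_le.mpr hH)
    gcongr
    omega
  · refine (hsum (fun i => (r i).slack x y - (r i).b) (D + A) fun i => ?_).trans (Nat.cast_le.mpr hH)
    have h₁ := abs_le.mp (hb i)
    have h₂ := h0 i
    have h₃ := hD i
    rw [abs_le]
    push_cast
    constructor <;> linarith
  · have : C.det.natAbs ≤ F := by zify; exact hdetF
    have : F ≤ m * F * (D + A) := by
      calc F = 1 * F * 1 := by ring
        _ ≤ m * F * (D + A) := by gcongr <;> omega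
    omega
  · have e : ∑ k, (σ * ∑ i, C.adjugate j i * -(r i).a k) * x k +
        σ * ∑ i, C.adjugate j i * ((r i).slack x y - (r i).b) = C.det.natAbs * y j := by
      rw [← hσd, mul_assoc, hmain]
      have h₁ : ∑ k, (σ * ∑ i, C.adjugate j i * -(r i).a k) * x k =
          σ * ∑ i, C.adjugate j i * -(∑ k, (r i).a k * x k) := by
        simp only [Finset.mul_sum, Finset.sum_mul, mul_neg, neg_mul, Finset.sum_neg_distrib]
        rw [Finset.sum_comm]
        congr 1
        exact Finset.sum_congr rfl fun i _ => Finset.sum_congr rfl fun k _ => by ring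
      rw [h₁, ← mul_add, ← Finset.sum_add_distrib]
      congr 1
      exact Finset.sum_congr rfl fun i _ => by ring
    rw [e, Int.fdiv_eq_ediv_of_nonneg _ (Nat.cast_nonneg _), Int.mul_ediv_cancel_left]
    exact_mod_cast hd0.ne'

/-! ### Small solutions of formulas -/

namespace Formula

/-- The inequalities of a formula. -/
def ineqs : Formula n m → Set (LinIneq n m)
  | ineq a c b => {⟨a, c, b⟩}
  | and φ ψ => φ.ineqs ∪ ψ.ineqs
  | or φ ψ => φ.ineqs ∪ ψ.ineqs
  | _ => ∅

/-- The product of the moduli of a formula. -/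
def modulus : Formula n m → ℕ
  | congr _ _ _ M _ => M
  | ncongr _ _ _ M _ => M
  | and φ ψ => φ.modulus * ψ.modulus
  | or φ ψ => φ.modulus * ψ.modulus
  | _ => 1

theorem modulus_pos (φ : Formula n m) : 0 < φ.modulus := by
  induction φ with
  | ineq a c b => exact Nat.one_pos
  | congr a c r M hr => exact (Nat.zero_le r).trans_lt hr
  | ncongr a c r M hr => exact (Nat.zero_le r).trans_lt hr
  | and φ ψ ihφ ihψ => exact Nat.mul_pos ihφ ihψ
  | or φ ψ ihφ ihψ => exact Nat.mul_pos ihφ ihψ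

theorem exists_linForm_iff {a : Fin n → ℤ} {c : Fin m → ℤ} {r M : ℕ} {x : Fin n → ℤ} {y y' : Fin m → ℤ}
    (h : ∀ j, (M : ℤ) ∣ y' j - y j) :
    (∃ k : ℤ, linForm a c x y' = k * M + r) ↔ ∃ k : ℤ, linForm a c x y = k * M + r := by
  have hd : (M : ℤ) ∣ linForm a c x y' - linForm a c x y := by
    have : linForm a c x y' - linForm a c x y = ∑ j, c j * (y' j - y j) := by
      simp only [linForm, mul_sub, Finset.sum_sub_distrib]; ring
    rw [this]
    exact Finset.dvd_sum fun j _ => (h j).mul_left _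
  obtain ⟨q, hq⟩ := hd
  constructor
  · rintro ⟨k, hk⟩
    exact ⟨k - q, by linear_combination hk - hq⟩
  · rintro ⟨k, hk⟩
    exact ⟨k + q, by linear_combination hk + hq⟩

/-- A solution remains a solution when it is moved within its residue class, as long as no true
inequality becomes false: the formula is in negation normal form. -/
theorem Holds.move {φ : Formula n m} {x : Fin n → ℤ} {y y' : Fin m → ℤ} (h : φ.Holds x y)
    (hmod : ∀ j, (φ.modulus : ℤ) ∣ y' j - y j)
    (hin : ∀ r ∈ φ.ineqs, 0 ≤ r.slack x y → 0 ≤ r.slack x y') : φ.Holds x y' := by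
  induction φ with
  | ineq a c b => exact hin ⟨a, c, b⟩ rfl h
  | congr a c r M hr => exact (exists_linForm_iff hmod).mpr h
  | ncongr a c r M hr => exact fun h' => h ((exists_linForm_iff hmod).mp h')
  | and φ ψ ihφ ihψ =>
    refine ⟨ihφ h.1 (fun j => ?_) fun r hr => hin r (.inl hr),
      ihψ h.2 (fun j => ?_) fun r hr => hin r (.inr hr)⟩
    · exact (Int.natCast_dvd_natCast.mpr (Nat.dvd_mul_right _ _)).trans (hmod j)
    · exact (Int.natCast_dvd_natCast.mpr (Nat.dvd_mul_left _ _)).trans (hmod j)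
  | or φ ψ ihφ ihψ =>
    refine h.imp (fun h => ihφ h (fun j => ?_) fun r hr => hin r (.inl hr))
      fun h => ihψ h (fun j => ?_) fun r hr => hin r (.inr hr)
    · exact (Int.natCast_dvd_natCast.mpr (Nat.dvd_mul_right _ _)).trans (hmod j)
    · exact (Int.natCast_dvd_natCast.mpr (Nat.dvd_mul_left _ _)).trans (hmod j)

theorem modulus_le (φ : Formula n m) : φ.modulus ≤ 2 ^ φ.constBits := by
  have leaf : ∀ (a : Fin n → ℤ) (c : Fin m → ℤ) (r M : ℕ),
      M ≤ 2 ^ (coeffBits a c + bitLength r + bitLength M) := fun a c r M => by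
    refine (Nat.lt_size_self M).le.trans (Nat.pow_le_pow_right (by norm_num) ?_)
    simp [bitLength]; omega
  induction φ with
  | ineq a c b => exact Nat.one_le_two_pow
  | congr a c r M hr => exact leaf a c r M
  | ncongr a c r M hr => exact leaf a c r M
  | and φ ψ ihφ ihψ => rw [constBits, pow_add]; exact Nat.mul_le_mul ihφ ihψ
  | or φ ψ ihφ ihψ => rw [constBits, pow_add]; exact Nat.mul_le_mul ihφ ihψ

theorem abs_le_two_pow (z : ℤ) {k : ℕ} (h : bitLength z ≤ k) : |z| ≤ (2 ^ k : ℕ) := by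
  have h₁ := Nat.lt_size_self z.natAbs
  have h₂ : 2 ^ z.natAbs.size ≤ 2 ^ k := Nat.pow_le_pow_right (by norm_num) (by
    simp only [bitLength] at h; omega)
  rw [Int.abs_eq_natAbs]
  exact_mod_cast (h₁.trans_le h₂).le

theorem abs_ineqs_le (φ : Formula n m) : ∀ r ∈ φ.ineqs, (∀ i, |r.a i| ≤ (2 ^ φ.constBits : ℕ)) ∧
    (∀ j, |r.c j| ≤ (2 ^ φ.constBits : ℕ)) ∧ |r.b| ≤ (2 ^ φ.constBits : ℕ) := by
  have mono : ∀ (k l : ℕ) (r : LinIneq n m), k ≤ l → ((∀ i, |r.a i| ≤ (2 ^ k : ℕ)) ∧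
      (∀ j, |r.c j| ≤ (2 ^ k : ℕ)) ∧ |r.b| ≤ (2 ^ k : ℕ)) → (∀ i, |r.a i| ≤ (2 ^ l : ℕ)) ∧
      (∀ j, |r.c j| ≤ (2 ^ l : ℕ)) ∧ |r.b| ≤ (2 ^ l : ℕ) := by
    rintro k l r hkl ⟨h₁, h₂, h₃⟩
    have : ((2 ^ k : ℕ) : ℤ) ≤ (2 ^ l : ℕ) :=
      Nat.cast_le.mpr (Nat.pow_le_pow_right (by norm_num) hkl)
    exact ⟨fun i => (h₁ i).trans this, fun j => (h₂ j).trans this, h₃.trans this⟩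
  induction φ with
  | ineq a c b =>
    rintro r rfl
    have h₁ : ∀ i, bitLength (a i) ≤ ∑ i, bitLength (a i) := fun i =>
      Finset.single_le_sum (f := fun i => bitLength (a i)) (fun _ _ => Nat.zero_le _)
        (Finset.mem_univ i)
    have h₂ : ∀ j, bitLength (c j) ≤ ∑ j, bitLength (c j) := fun j =>
      Finset.single_le_sum (f := fun j => bitLength (c j)) (fun _ _ => Nat.zero_le _)
        (Finset.mem_univ j)
    refine ⟨fun i => abs_le_two_pow _ ?_, fun j => abs_le_two_pow _ ?_, abs_le_two_pow _ ?_⟩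
    · have := h₁ i
      simp only [constBits, coeffBits]; omega
    · have := h₂ j
      simp only [constBits, coeffBits]; omega
    · simp only [constBits]; omega
  | congr a c r M hr => exact fun r hr => absurd hr (Set.notMem_empty r)
  | ncongr a c r M hr => exact fun r hr => absurd hr (Set.notMem_empty r)
  | and φ ψ ihφ ihψ =>
    rintro r (hr | hr)
    · exact mono _ _ r (by simp [constBits]) (ihφ r hr)
    · exact mono _ _ r (by simp [constBits]) (ihψ r hr)
  | or φ ψ ihφ ihψ =>
    rintro r (hr | hr)
    · exact mono _ _ r (by simp [constBits]) (ihφ r hr)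
    · exact mono _ _ r (by simp [constBits]) (ihψ r hr)

/-- If there is a solution, then there is one whose components are rounded affine functions with small
coefficients. The signs of the components of the given solution are kept, so that there are enough
inequalities. -/
theorem exists_isRounded (φ : Formula n m) {x : Fin n → ℤ} (h : ∃ y, φ.Holds x y) {s H : ℕ}
    (hs : φ.constBits ≤ s)
    (hH : m * (m.factorial * (2 ^ s) ^ m) * (2 ^ s * (m * 2 ^ s * (m * 2 ^ s) ^ m) + 2 ^ s) ≤ H) :
    ∃ y, φ.Holds x y ∧ ∀ j, IsRounded H x (y j) := by
  obtain ⟨y, hy⟩ := h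
  let sgn : Fin m → LinIneq n m := fun j => ⟨0, Pi.single j (if 0 ≤ y j then 1 else -1), 0⟩
  let T : Set (LinIneq n m) := {r | r ∈ φ.ineqs ∧ 0 ≤ r.slack x y} ∪ Set.range sgn
  have hA1 : 1 ≤ 2 ^ s := Nat.one_le_two_pow
  have hA1' : (1 : ℤ) ≤ (2 ^ s : ℕ) := by exact_mod_cast hA1
  have hbd : ∀ r ∈ T, (∀ i, |r.a i| ≤ (2 ^ s : ℕ)) ∧ (∀ j, |r.c j| ≤ (2 ^ s : ℕ)) ∧
      |r.b| ≤ (2 ^ s : ℕ) := by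
    rintro r (⟨hr, -⟩ | ⟨j, rfl⟩)
    · obtain ⟨h₁, h₂, h₃⟩ := φ.abs_ineqs_le r hr
      have : ((2 ^ φ.constBits : ℕ) : ℤ) ≤ (2 ^ s : ℕ) :=
        Nat.cast_le.mpr (Nat.pow_le_pow_right (by norm_num) hs)
      exact ⟨fun i => (h₁ i).trans this, fun j => (h₂ j).trans this, h₃.trans this⟩
    · refine ⟨fun i => by simp [sgn], fun k => ?_, by simp [sgn]⟩
      simp only [sgn, Pi.single_apply]
      split
      · split <;> simpa using hA1'
      · simp
  have hsat : ∀ r ∈ T, 0 ≤ r.slack x y := by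
    rintro r (⟨-, hr⟩ | ⟨j, rfl⟩)
    · exact hr
    · simp only [LinIneq.slack, linForm, sgn, Pi.zero_apply, zero_mul, Finset.sum_const_zero,
        Pi.single_apply, ite_mul, Finset.sum_ite_eq', Finset.mem_univ, if_true]
      split <;> omega
  have hspan : ∀ v : Fin m → ℤ, (∀ r ∈ T, r.c ⬝ᵥ v = 0) → v = 0 := by
    intro v hv
    funext j
    have := hv (sgn j) (.inr ⟨j, rfl⟩)
    simp only [sgn, single_dotProduct] at this
    split at this <;> simpa using this
  obtain ⟨y', hmod, hy', r, hr, hind⟩ := exists_nearly_tight hA1 φ.modulus_pos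
    (fun r hr => (hbd r hr).2.1) hspan hsat m le_rfl
  refine ⟨y', hy.move hmod fun r hr h0 => hy' r (.inl ⟨hr, h0⟩), isRounded_of_nearly_tight hA1
    (fun i => (hbd _ (hr i).1).1) (fun i => (hbd _ (hr i).1).2.1) (fun i => (hbd _ (hr i).1).2.2)
    (fun i => hy' _ (hr i).1) (fun i => (hr i).2) hind (le_trans ?_ hH)⟩
  have hM : φ.modulus ≤ 2 ^ s := φ.modulus_le.trans (Nat.pow_le_pow_right (by norm_num) hs)
  gcongr

end Formula

/-! ### The candidates contain a solution -/

theorem exists_digits {Q : ℕ} : ∀ (l : ℕ) (f : ℕ → ℕ), (∀ e < l, f e < Q) →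
    ∃ K < Q ^ l, ∀ e < l, K / Q ^ e % Q = f e
  | 0, f, _ => ⟨0, by simp, fun e he => absurd he (Nat.not_lt_zero e)⟩
  | l + 1, f, hf => by
    obtain ⟨K, hK, h⟩ := exists_digits l (fun e => f (e + 1)) fun e he => hf _ (by omega)
    have h0 := hf 0 (by omega)
    have hQ : 0 < Q := by omega
    refine ⟨f 0 + Q * K, ?_, fun e he => ?_⟩
    · rw [pow_succ]
      nlinarith
    · cases e with
      | zero => rw [pow_zero, Nat.div_one, Nat.add_mul_mod_self_left, Nat.mod_eq_of_lt h0]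
      | succ e =>
        rw [pow_succ', ← Nat.div_div_eq_div_mul, Nat.add_mul_div_left _ _ hQ, Nat.div_eq_of_lt h0,
          zero_add]
        exact h e (by omega)

/-- All rounded affine functions with coefficients bounded by `H` occur among the candidates. -/
theorem exists_cand_eq {κ : Par} (hN : κ.N = κ.Q ^ (κ.m * (κ.n + 2))) {x : Fin κ.n → ℤ}
    {y : Fin κ.m → ℤ} (h : ∀ j, IsRounded κ.H x (y j)) :
    ∃ K < κ.N, (fun j : Fin κ.m => κ.cand j x K) = y := by
  choose α β d hα hβ hd hd' hy using h
  -- the digit at position `e = j (n + 2) + i`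
  let f : ℕ → ℕ := fun e =>
    if hj : e / (κ.n + 2) < κ.m then
      if hi : e % (κ.n + 2) < κ.n then (α ⟨_, hj⟩ ⟨_, hi⟩ + κ.H).toNat
      else if e % (κ.n + 2) = κ.n then (β ⟨_, hj⟩ + κ.H).toNat
      else d ⟨_, hj⟩ - 1
    else 0
  have hf : ∀ e < κ.m * (κ.n + 2), f e < κ.Q := by
    intro e _
    simp only [f, Par.Q]
    split
    · rename_i hj
      split
      · rename_i hi
        have := abs_le.mp (hα ⟨_, hj⟩ ⟨_, hi⟩)
        omega
      · split
        · have := abs_le.mp (hβ ⟨_, hj⟩)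
          omega
        · have := hd' ⟨_, hj⟩
          omega
    · omega
  obtain ⟨K, hK, hdig⟩ := exists_digits _ f hf
  refine ⟨K, hN ▸ hK, funext fun j => ?_⟩
  have hpos : ∀ i < κ.n + 2, κ.digit K (j * (κ.n + 2) + i) = f (j * (κ.n + 2) + i) := fun i hi => by
    refine hdig _ ?_
    have : (j + 1) * (κ.n + 2) ≤ κ.m * (κ.n + 2) := Nat.mul_le_mul_right _ j.2
    nlinarith
  have hdiv : ∀ i < κ.n + 2, (j * (κ.n + 2) + i) / (κ.n + 2) = j := fun i hi => by
    rw [mul_comm, Nat.mul_add_div (by omega), Nat.div_eq_of_lt hi, add_zero]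
  have hmod : ∀ i < κ.n + 2, (j * (κ.n + 2) + i) % (κ.n + 2) = i := fun i hi => by
    rw [mul_comm, Nat.mul_add_mod, Nat.mod_eq_of_lt hi]
  have h₁ : ∀ i : Fin κ.n, ((κ.digit K (j * (κ.n + 2) + i) : ℤ) - κ.H) = α j i := fun i => by
    have hi : (i : ℕ) < κ.n + 2 := by omega
    rw [hpos i hi]
    simp only [f, hdiv i hi, hmod i hi, j.2, i.2, dif_pos, Fin.eta]
    have := abs_le.mp (hα j i)
    omega
  have h₂ : ((κ.digit K (j * (κ.n + 2) + κ.n) : ℤ) - κ.H) = β j := by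
    have hi : κ.n < κ.n + 2 := by omega
    rw [hpos _ hi]
    simp only [f, hdiv _ hi, hmod _ hi, j.2, dif_pos, lt_irrefl, dite_false, if_true, Fin.eta]
    have := abs_le.mp (hβ j)
    omega
  have h₃ : κ.digit K (j * (κ.n + 2) + (κ.n + 1)) + 1 = d j := by
    have hi : κ.n + 1 < κ.n + 2 := by omega
    rw [hpos _ hi]
    have e₁ : ¬ κ.n + 1 < κ.n := by omega
    have e₂ : ¬ κ.n + 1 = κ.n := by omega
    simp only [f, hdiv _ hi, hmod _ hi, j.2, dif_pos, e₁, e₂, dite_false, if_false, Fin.eta]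
    have := hd j
    omega
  rw [hy j, Par.cand, h₃, Finset.sum_range_succ, h₂, Finset.sum_range]
  simp only [h₁, inputVal, Fin.is_lt, dif_pos, lt_irrefl, dite_false, mul_one]

/-! ### Bounds -/

theorem length_encodeNat (k : ℕ) : (encodeNat k).length = bitLength k := by
  simp [encodeNat, bitLength, Nat.size_eq_bits_len]

theorem length_encodeInt (z : ℤ) : (encodeInt z).length = bitLength z + 1 := by
  rw [encodeInt, List.length_cons, length_encodeNat, bitLength, Int.natAbs_natCast, bitLength]

theorem length_encodeCoeffs (a : Fin n → ℤ) (c : Fin m → ℤ) :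
    (encodeCoeffs a c).length = coeffBits a c + (n + m) := by
  have : ∀ {l : ℕ} (a : Fin l → ℤ), ((List.ofFn a).flatMap encodeInt).length =
      ∑ i, bitLength (a i) + l := fun a => by
    simp [List.length_flatMap, List.map_ofFn, List.sum_ofFn, length_encodeInt,
      Finset.sum_add_distrib]
  rw [encodeCoeffs, List.length_append, this, this, coeffBits]
  ring

theorem bitLength_pos (z : ℤ) : 0 < bitLength z := by simp [bitLength]

theorem le_coeffBits (a : Fin n → ℤ) (c : Fin m → ℤ) : n + m ≤ coeffBits a c := by
  have : ∀ {l : ℕ} (a : Fin l → ℤ), l ≤ ∑ i, bitLength (a i) := fun {l} a =>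
    calc l = ∑ _i : Fin l, 1 := by simp
      _ ≤ _ := Finset.sum_le_sum fun i _ => bitLength_pos (a i)
  exact Nat.add_le_add (this a) (this c)

namespace Formula

theorem length_encodeTree_le (φ : Formula n m) : φ.encodeTree.length ≤ φ.nodes + 2 * φ.constBits := by
  induction φ with
  | ineq a c b =>
    have := le_coeffBits a c
    have := bitLength_pos b
    simp only [encodeTree, List.length_cons, List.length_append, length_encodeCoeffs,
      length_encodeInt, nodes, constBits]
    omega
  | congr a c r M hr =>
    have := le_coeffBits a c
    simp only [encodeTree, List.length_cons, List.length_append, length_encodeCoeffs,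
      length_encodeNat, nodes, constBits]
    omega
  | ncongr a c r M hr =>
    have := le_coeffBits a c
    simp only [encodeTree, List.length_cons, List.length_append, length_encodeCoeffs,
      length_encodeNat, nodes, constBits]
    omega
  | and φ ψ ihφ ihψ =>
    simp only [encodeTree, List.length_cons, List.length_append, nodes, constBits]
    omega
  | or φ ψ ihφ ihψ =>
    simp only [encodeTree, List.length_cons, List.length_append, nodes, constBits]
    omega

theorem le_length_encodeTree (φ : Formula n m) :
    n + m + φ.nodes ≤ φ.encodeTree.length ∧ φ.constBits ≤ φ.encodeTree.length ∧
      3 ≤ φ.encodeTree.length ∧ 1 ≤ φ.nodes := by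
  induction φ with
  | ineq a c b =>
    have := bitLength_pos b
    simp only [encodeTree, List.length_cons, List.length_append, length_encodeCoeffs,
      length_encodeInt, nodes, constBits]
    omega
  | congr a c r M hr =>
    have := bitLength_pos r
    have := bitLength_pos M
    simp only [encodeTree, List.length_cons, List.length_append, length_encodeCoeffs,
      length_encodeNat, nodes, constBits]
    omega
  | ncongr a c r M hr =>
    have := bitLength_pos r
    have := bitLength_pos M
    simp only [encodeTree, List.length_cons, List.length_append, length_encodeCoeffs,
      length_encodeNat, nodes, constBits]
    omega
  | and φ ψ ihφ ihψ =>
    simp only [encodeTree, List.length_cons, List.length_append, nodes, constBits]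
    omega
  | or φ ψ ihφ ihψ =>
    simp only [encodeTree, List.length_cons, List.length_append, nodes, constBits]
    omega

theorem bitLength_natCast_le (k : ℕ) : bitLength k ≤ k + 1 := by
  have : Nat.size k ≤ k := Nat.size_le.mpr Nat.lt_two_pow_self
  simpa [bitLength] using this

/-- Besides the bits of a number, its string has at most a sign and an end mark, hence the factor two. -/
theorem length_encode_le (φ : Formula n m) : φ.encode.length ≤ 2 * φ.size + 2 := by
  have h₁ := φ.length_encodeTree_le
  have h₂ := bitLength_natCast_le n
  have h₃ := bitLength_natCast_le m
  simp only [encode, List.length_append, length_encodeNat, size]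
  omega

theorem le_length_encode (φ : Formula n m) : n + m + φ.nodes ≤ φ.encode.length ∧
    φ.constBits ≤ φ.encode.length ∧ 5 ≤ φ.encode.length ∧ 1 ≤ φ.nodes := by
  have := φ.le_length_encodeTree
  have := bitLength_pos n
  have := bitLength_pos m
  simp only [encode, List.length_append, length_encodeNat]
  omega

theorem two_le_size (φ : Formula n m) : 2 ≤ φ.size := by
  have h₁ := φ.length_encodeTree_le
  have h₂ := φ.le_length_encodeTree
  simp only [size]
  omega

end Formula

/-- The bound on coefficients in `Formula.exists_isRounded`, for constants of at most `L` bits in total,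
is at most `2 ^ L ^ 4`. -/
theorem coefficient_bound {m L : ℕ} (hm : m ≤ L) (hL : 5 ≤ L) :
    m * (m.factorial * (2 ^ L) ^ m) * (2 ^ L * (m * 2 ^ L * (m * 2 ^ L) ^ m) + 2 ^ L) ≤ 2 ^ L ^ 4 := by
  have h₀ : m ≤ 2 ^ L := hm.trans Nat.lt_two_pow_self.le
  have hp : ∀ {a b : ℕ}, a ≤ b → 2 ^ a ≤ 2 ^ b := fun h => Nat.pow_le_pow_right (by norm_num) h
  have h₁ : m.factorial ≤ 2 ^ (L * L) := by
    refine (Nat.factorial_le_pow m).trans ((Nat.pow_le_pow_left h₀ m).trans ?_)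
    rw [← pow_mul]
    exact hp (Nat.mul_le_mul_left L hm)
  have h₂ : (2 ^ L) ^ m ≤ 2 ^ (L * L) := by
    rw [← pow_mul]
    exact hp (Nat.mul_le_mul_left L hm)
  have h₃ : m * 2 ^ L ≤ 2 ^ (2 * L) := by
    calc m * 2 ^ L ≤ 2 ^ L * 2 ^ L := Nat.mul_le_mul_right _ h₀
      _ = 2 ^ (2 * L) := by rw [← pow_add]; congr 1; ring
  have h₄ : (m * 2 ^ L) ^ m ≤ 2 ^ (2 * L * L) := by
    refine (Nat.pow_le_pow_left h₃ m).trans ?_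
    rw [← pow_mul]
    exact hp (Nat.mul_le_mul_left _ hm)
  calc _ ≤ 2 ^ L * (2 ^ (L * L) * 2 ^ (L * L)) *
        (2 ^ L * (2 ^ (2 * L) * 2 ^ (2 * L * L)) + 2 ^ (L + (2 * L + 2 * L * L))) := by
        have : 2 ^ L ≤ 2 ^ (L + (2 * L + 2 * L * L)) := hp (by omega)
        gcongr
    _ = 2 ^ (4 * (L * L) + 4 * L + 1) := by
        ring
    _ ≤ 2 ^ L ^ 4 := by
        refine hp ?_
        have : 25 ≤ L * L := Nat.mul_le_mul hL hL
        have e : L ^ 4 = (L * L) * (L * L) := by ring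
        rw [e]
        nlinarith

/-- Some candidate is a solution, if there is a solution at all. -/
theorem exists_cand_holds (φ : Formula n m) {x : Fin n → ℤ} (h : ∃ y, φ.Holds x y) :
    ∃ K < (Par.of n m φ.encode.length).N,
      φ.Holds x fun j => (Par.of n m φ.encode.length).cand j x K := by
  obtain ⟨h₁, h₂, h₃, -⟩ := φ.le_length_encode
  obtain ⟨y, hy, hr⟩ := φ.exists_isRounded h h₂ (coefficient_bound (by omega) h₃)
  obtain ⟨K, hK, rfl⟩ := exists_cand_eq (κ := Par.of n m φ.encode.length) rfl hr
  exact ⟨K, hK, hy⟩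

/-! ### Bounds on time and size -/

theorem RunsInTime.mono {T : Turing.TM2ComputableAux Sym Sym} {u v : List Sym} {s t : ℕ}
    (h : RunsInTime T u v s) (hst : s ≤ t) : RunsInTime T u v t := by
  obtain ⟨h⟩ := h
  exact ⟨⟨h.toEvalsTo, h.steps_le_m.trans hst⟩⟩

/-- At the beginning the machine of the generator holds its input only. -/
theorem St.repr_init (u : List Sym) :
    (St.init u).repr = Function.update (fun _ => []) (Reg.stack .inp) u := by
  funext r
  cases r with
  | num v => cases v <;> rfl
  | tmp i => simp [St.repr]
  | stack k => cases k <;> simp [St.repr, St.getS, St.init]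
  | fin => simp [St.repr]

/-- The parameters for a string of length `L` are at most `2 ^ L ^ 11`, with room for a stack of wires. -/
theorem parameter_bounds {L k : ℕ} (hL : 5 ≤ L) (hnm : n + m + k ≤ L) :
    (Par.of n m L).B ^ (k + 1) ≤ 2 ^ L ^ 11 ∧ 2 ^ L ≤ 2 ^ L ^ 11 ∧
      (Par.of n m L).Q ≤ 2 ^ L ^ 11 := by
  have hp : ∀ {a b : ℕ}, a ≤ b → 2 ^ a ≤ 2 ^ b := fun h => Nat.pow_le_pow_right (by norm_num) h
  have hL' : ∀ {a b : ℕ}, a ≤ b → L ^ a ≤ L ^ b := fun h => Nat.pow_le_pow_right (by omega) h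
  have hmul : ∀ {a b : ℕ}, b = a + 1 → 5 * L ^ a ≤ L ^ b := fun {a b} h => by
    rw [h, pow_succ, mul_comm]; exact Nat.mul_le_mul_left _ hL
  have h1 : ∀ a, 1 ≤ L ^ a := fun a => Nat.one_le_pow _ _ (by omega)
  have hQ : (Par.of n m L).Q ≤ 2 ^ L ^ 5 := by
    have h₁ : (Par.of n m L).Q = 2 * 2 ^ L ^ 4 + 1 := rfl
    have h₂ : 2 ^ (L ^ 4 + 2) ≤ 2 ^ L ^ 5 :=
      hp (by have := hmul (show 5 = 4 + 1 from rfl); have := h1 4; omega)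
    have h₃ : 1 ≤ 2 ^ L ^ 4 := Nat.one_le_two_pow
    rw [pow_add] at h₂
    omega
  have hN : (Par.of n m L).N ≤ 2 ^ L ^ 8 := by
    have h₁ : (Par.of n m L).N = (Par.of n m L).Q ^ (m * (n + 2)) := rfl
    rw [h₁]
    refine (Nat.pow_le_pow_left hQ _).trans ?_
    rw [← pow_mul]
    refine hp ?_
    calc L ^ 5 * (m * (n + 2)) ≤ L ^ 5 * (L * (5 * L)) := by gcongr <;> omega
      _ = L ^ 5 * L * (5 * L ^ 1) := by ring
      _ ≤ L ^ 5 * L * L ^ 2 := by gcongr; exact hmul rfl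
      _ = L ^ 8 := by ring
  have hB : (Par.of n m L).B ≤ 2 ^ L ^ 9 := by
    have h₁ : (Par.of n m L).B = (Par.of n m L).N * 2 ^ L ^ 4 := rfl
    rw [h₁]
    refine (Nat.mul_le_mul_right _ hN).trans ?_
    rw [← pow_add]
    exact hp (by have := hmul (show 9 = 8 + 1 from rfl); have := hL' (show 4 ≤ 8 by norm_num); omega)
  refine ⟨?_, hp ?_, hQ.trans (hp (hL' (by norm_num)))⟩
  · refine (Nat.pow_le_pow_left hB _).trans ?_
    rw [← pow_mul]
    refine hp ?_
    calc L ^ 9 * (k + 1) ≤ L ^ 9 * (5 * L ^ 1) := by rw [pow_one]; gcongr; omega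
      _ ≤ L ^ 9 * L ^ 2 := by gcongr; exact hmul rfl
      _ = L ^ 11 := by ring
  · calc L = L ^ 1 := (pow_one L).symm
      _ ≤ L ^ 11 := hL' (by norm_num)

/-- A bound on the number of wires per candidate, for a formula with `k` nodes. -/
theorem wire_count_bound {L k : ℕ} (hL : 5 ≤ L) (hnm : n + m + k ≤ L) :
    2 * (n + 2) + (n + 3) * m + (n + m + 5) * k + 2 * k + 3 * m ≤ (Par.of n m L).H := by
  calc _ ≤ 2 * (L + 2) + (L + 3) * L + (L + 5) * L + 2 * L + 3 * L := by gcongr <;> omega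
    _ ≤ L ^ 4 := by
      have : 25 ≤ L * L := Nat.mul_le_mul hL hL
      have e : L ^ 4 = (L * L) * (L * L) := by ring
      rw [e]
      nlinarith
    _ ≤ 2 ^ L ^ 4 := Nat.lt_two_pow_self.le

/-- Here `L` is the length of the string of a formula, and `σ` is its size. -/
theorem time_bound {C L σ : ℕ} (hσ : 2 ≤ σ) (hL : L ≤ 2 * σ + 2) :
    L + C * (2 ^ L ^ 11 + 1) ^ C ≤ 2 ^ σ ^ (C + 35) := by
  have hp : ∀ {a b : ℕ}, a ≤ b → 2 ^ a ≤ 2 ^ b := fun h => Nat.pow_le_pow_right (by norm_num) h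
  have hσp : ∀ {a b : ℕ}, a ≤ b → σ ^ a ≤ σ ^ b := fun h => Nat.pow_le_pow_right (by omega) h
  have hdbl : ∀ {a b : ℕ}, b = a + 1 → 2 * σ ^ a ≤ σ ^ b := fun {a b} h => by
    rw [h, pow_succ, mul_comm]; exact Nat.mul_le_mul_left _ hσ
  have h1 : ∀ a, 1 ≤ σ ^ a := fun a => Nat.one_le_pow _ _ (by omega)
  have hL3 : L ≤ σ ^ 3 := by
    have h₁ := hdbl (show 2 = 1 + 1 from rfl)
    have h₂ := hdbl (show 3 = 2 + 1 from rfl)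
    rw [pow_one] at h₁
    omega
  have hL33 : L ^ 11 ≤ σ ^ 33 := by
    rw [show 33 = 3 * 11 by norm_num, pow_mul]
    exact Nat.pow_le_pow_left hL3 11
  have hP : 2 ^ L ^ 11 + 1 ≤ 2 ^ σ ^ 34 := by
    have h₁ : 2 ^ L ^ 11 ≤ 2 ^ σ ^ 33 := hp hL33
    have h₂ : 2 ^ (σ ^ 33 + 1) ≤ 2 ^ σ ^ 34 :=
      hp (by have := hdbl (show 34 = 33 + 1 from rfl); have := h1 33; omega)
    have h₃ : 1 ≤ 2 ^ σ ^ 33 := Nat.one_le_two_pow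
    rw [pow_succ] at h₂
    omega
  have hC : C * (2 ^ L ^ 11 + 1) ^ C ≤ 2 ^ (C + σ ^ 34 * C) := by
    rw [pow_add, pow_mul]
    exact Nat.mul_le_mul Nat.lt_two_pow_self.le (Nat.pow_le_pow_left hP C)
  have hL2 : L ≤ 2 ^ (C + σ ^ 34 * C + σ ^ 3) :=
    (hL3.trans Nat.lt_two_pow_self.le).trans (hp (by omega))
  have hC2 : 2 ^ (C + σ ^ 34 * C) ≤ 2 ^ (C + σ ^ 34 * C + σ ^ 3) := hp (by omega)
  calc L + C * (2 ^ L ^ 11 + 1) ^ C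
      ≤ 2 ^ (C + σ ^ 34 * C + σ ^ 3) + 2 ^ (C + σ ^ 34 * C + σ ^ 3) :=
        Nat.add_le_add hL2 (hC.trans hC2)
    _ = 2 ^ (C + σ ^ 34 * C + σ ^ 3 + 1) := by rw [pow_succ _ (_ + σ ^ 3)]; ring
    _ ≤ 2 ^ σ ^ (C + 35) := by
      refine hp ?_
      have h₁ : C + 1 ≤ σ ^ C :=
        (Nat.lt_two_pow_self (n := C)).trans_le (Nat.pow_le_pow_left hσ C)
      have h₂ : σ ^ 3 + 1 ≤ σ ^ 34 := by
        have := hdbl (show 4 = 3 + 1 from rfl)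
        have := h1 3
        have := hσp (show 4 ≤ 34 by norm_num)
        omega
      calc C + σ ^ 34 * C + σ ^ 3 + 1 ≤ σ ^ 34 * C + σ ^ 34 * C + σ ^ 34 + σ ^ 34 := by
            have : 1 * C ≤ σ ^ 34 * C := Nat.mul_le_mul_right _ (h1 34)
            omega
        _ = (C + 1) * (2 * σ ^ 34) := by ring
        _ ≤ σ ^ C * σ ^ 35 := Nat.mul_le_mul h₁ (hdbl rfl)
        _ = σ ^ (C + 35) := by rw [pow_add]

end PFnS

theorem mainTheorem1 :
    ∃ (T : Turing.TM2ComputableAux PFnS.Sym PFnS.Sym) (c : ℕ),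
      ∀ (n m : ℕ) (φ : PFnS.Formula n m), ∃ C : PFnS.Circuit n m,
        φ.IsSkolem C.eval ∧
        C.size ≤ 2 ^ (φ.size ^ c) ∧
        PFnS.RunsInTime T φ.encode C.encode (2 ^ (φ.size ^ c)) := by
  open PFnS in
  obtain ⟨T, D, hT⟩ := Prog.exists_machine Cmd.generator.comp (inp := Reg.stack .inp)
    (out := Reg.stack .out) (fin := Reg.fin) (by decide)
  refine ⟨T, D + 35, fun n m φ => ?_⟩
  obtain ⟨hnm, -, hL, -⟩ := φ.le_length_encode
  obtain ⟨hB, hLP, hQ⟩ := parameter_bounds hL hnm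
  have hle : (St.init φ.encode).Le (2 ^ φ.encode.length ^ 11) := fun v => by
    cases v <;> exact Nat.zero_le _
  obtain ⟨hok, ⟨C, hout, hC⟩, -⟩ :=
    Cmd.run_generator φ rfl (wire_count_bound hL hnm) hB hLP hQ hle
  obtain ⟨hbdd, hexec, -⟩ := Cmd.comp_spec _ _ hle hok
  rw [St.repr_init] at hbdd hexec
  obtain ⟨hrun, hlen⟩ := hT φ.encode C.encode _ (Nat.lt_two_pow_self.le.trans hLP) hbdd
    (by rw [hexec]; exact hout) (by rw [hexec]; rfl)
  have hbound := time_bound (C := D) φ.two_le_size φ.length_encode_le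
  refine ⟨C, fun x hx => hC x (exists_cand_holds φ hx), ?_, hrun.mono (by omega)⟩
  have := C.size_le
  omega
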